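/- Let $1/3<\beta<\alpha<1/2$, $\tfrac12-\alpha<\chi<\beta/2$, $\theta>1$, $\sigma>0$, $T>0$, and set $\gamma=\frac{\alpha-\beta}{4}$. For $W:\mathbb R\to\mathbb R$ let $W^1(x,y)=W(y)-W(x)$, $W^2(x,y)=\frac12(W(y)-W(x))^2$. For $F:\mathbb R^2\to\mathbb R$ write $\|F\|_{r}^{[-a,a]}=\sup_{-a\le x\ne y\le a}|F(x,y)|/|y-x|^r$, and let $$\kappa(\mathbf W)=\sup_{a\ge1}\Big(\frac{\|W^1\|_\alpha^{[-a,a]}}{a^{\chi}}+\frac{\|W^2\|_{2\alpha}^{[-a,a]}}{a^{2\chi}}\Big).$$ Throughout, $W$ is a path with $\kappa(\mathbf W)<\infty$ (for instance almost every path of a two-sided Brownian motion), and $\lambda>1$. For a pair $\mathcal V=(v,\partial_Wv)$ of functions $[0,T]\times\mathbb R\to\mathbb R$ let $\mathcal R^{\mathcal V_t}(x,y)=v_t(y)-v_t(x)-\partial_Wv_t(x)\,(W(y)-W(x))$, and for $f:[0,T]\times\mathbb R\to\mathbb R$ let $$\llbracket f\rrbracket^{[0,t]\times[-a,a]}=\sup_{[0,t]\times[-a,a]}|f|+a^{-\beta/2}\sup_{(s,x)\ne(s',x')\in[0,t]\times[-a,a]}\frac{|f_{s'}(x')-f_s(x)|}{|s'-s|^{\beta/2}+|x'-x|^\beta}.$$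 Put $E(a,t)=e^{\lambda t+\theta a+\theta at}$, $Q(a,t)=a^\chi(a^{\beta/2}+t^{-\beta/2})$ for $t>0$, $Q(a,0)^{-1}=0$, and $$\Theta(\mathcal V)=\Theta^{\theta,\lambda}(\mathcal V)=\sup_{t\in[0,T],\,a\ge1}E(a,t)^{-1}\Big(\llbracket v\rrbracket^{[0,t]\times[-a,a]}+\lambda^{-\gamma}\llbracket\partial_Wv\rrbracket^{[0,t]\times[-a,a]}+\lambda^{-\gamma}Q(a,t)^{-1}\|\mathcal R^{\mathcal V_t}\|_{2\beta}^{[-a,a]}\Big),$$ where the last term is $0$ at $t=0$ (no condition is imposed on $\mathcal R^{\mathcal V_0}$). Let $\mathcal B^{\theta,\lambda}$ be the vector space of pairs $\mathcal V$ with $\Theta(\mathcal V)<\infty$. Let $p_t(x)=(2\pi\sigma^2t)^{-1/2}e^{-x^2/(2\sigma^2t)}$ and define $\mathcal M\mathcal V=\big((\mathcal M\mathcal V)_t(x),\,-\tfrac{2}{\sigma^2}v_t(x)\big)$ with $$(\mathcal M\mathcal V)_t(x)=\int_0^t\int_{\mathbb R}\partial^2_{xx}p_{t-s}(x-y)\Big(\int_x^yv_s(z)\,dW(z)\Big)dy\,ds,$$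 where $\int_x^yv_s\,dW$ is the rough integral of the controlled path $(v_s,\partial_Wv_s)$, i.e. the limit, as the mesh tends to $0$, of the sums $\sum_i\big(v_s(x_i)W^1(x_i,x_{i+1})+\partial_Wv_s(x_i)W^2(x_i,x_{i+1})\big)$ (with $\int_x^y=-\int_y^x$ if $y<x$). Then there is a constant $C>0$ depending only on $\alpha,\beta,\chi,\theta,\sigma,T$ (not on $\lambda$, $W$, $\mathcal V$) such that for all such $W$ and $\lambda$: 1. $(\mathcal B^{\theta,\lambda},\Theta)$ is a Banach space, and $\mathcal M$ is a well-defined linear map of $\mathcal B^{\theta,\lambda}$ to itself: for $\mathcal V\in\mathcal B^{\theta,\lambda}$ the rough integrals exist for all $s\in(0,T]$ and $x,y\in\mathbb R$, the integrand is integrable in $(s,y)\in(0,t]\times\mathbb R$ for all $t\in[0,T]$, $x\in\mathbb R$, and $\mathcal M\mathcal V\in\mathcal B^{\theta,\lambda}$. 2. For all $\mathcal V\in\mathcal B^{\theta,\lambda}$, $$\Theta^{\theta,\lambda}(\mathcal M\mathcal V)\le C\,(1+\kappa(\mathbf W))\,\lambda^{-\frac{\alpha-\beta}{4}}\,\Theta^{\theta,\lambda}(\mathcal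 V).$$ 3. There is $\Lambda$, depending only on $\alpha,\beta,\chi,\theta,\sigma,T$ and $\kappa(\mathbf W)$, such that for $\lambda\ge\Lambda$ one has $\Theta^{\theta,\lambda}(\mathcal M\mathcal V)\le\frac12\Theta^{\theta,\lambda}(\mathcal V)$ for all $\mathcal V\in\mathcal B^{\theta,\lambda}$. Hence $\mathcal M$ is a contraction: $\Theta^{\theta,\lambda}(\mathcal M\mathcal V-\mathcal M\mathcal V')\le\frac12\Theta^{\theta,\lambda}(\mathcal V-\mathcal V')$ for all $\mathcal V,\mathcal V'\in\mathcal B^{\theta,\lambda}$. -/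

import Mathlib

open MeasureTheory
open scoped ENNReal

noncomputable section

/-! ### The one-dimensional rough path over a path `W` -/

/-- First level `W¹(x,y) = W(y) - W(x)`. -/
def roughOne (W : ℝ → ℝ) (x y : ℝ) : ℝ := W y - W x

/-- Second level `W²(x,y) = (W(y) - W(x))² / 2`. -/
def roughTwo (W : ℝ → ℝ) (x y : ℝ) : ℝ := (W y - W x) ^ 2 / 2

/-- `‖F‖_r^{[-a,a]} = sup_{-a ≤ x ≠ y ≤ a} |F(x,y)| / |y-x|^r`, with values in `[0,∞]`. -/
def incrNorm (F : ℝ → ℝ → ℝ) (r a : ℝ) : ℝ≥0∞ :=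
  ⨆ x ∈ Set.Icc (-a) a, ⨆ y ∈ Set.Icc (-a) a, ⨆ _ : x ≠ y,
    ENNReal.ofReal (|F x y| / |y - x| ^ r)

/-- `κ_{α,χ}(W) = sup_{a ≥ 1} (‖W¹‖_α^{[-a,a]} / a^χ + ‖W²‖_{2α}^{[-a,a]} / a^{2χ})`. -/
def kappa (α χ : ℝ) (W : ℝ → ℝ) : ℝ≥0∞ :=
  ⨆ a : ℝ, ⨆ _ : 1 ≤ a,
    (incrNorm (roughOne W) α a / ENNReal.ofReal (a ^ χ)
      + incrNorm (roughTwo W) (2 * α) a / ENNReal.ofReal (a ^ (2 * χ)))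

/-! ### The rough integral of a controlled path -/

/-- Compensated Riemann sum over the points `u 0, …, u n`. -/
def compensatedSum (W v v' : ℝ → ℝ) (n : ℕ) (u : ℕ → ℝ) : ℝ :=
  ∑ i ∈ Finset.range n,
    (v (u i) * roughOne W (u i) (u (i + 1)) + v' (u i) * roughTwo W (u i) (u (i + 1)))

/-- For `x ≤ y`: the compensated Riemann sums over partitions of `[x,y]` converge to `I`
as the mesh tends to `0`. -/
def IsCompensatedLimit (W v v' : ℝ → ℝ) (x y I : ℝ) : Prop :=
  ∀ ε > 0, ∃ δ > 0, ∀ (n : ℕ) (u : ℕ → ℝ), Monotone u → u 0 = x → u n = y →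
    (∀ i < n, u (i + 1) - u i < δ) → |compensatedSum W v v' n u - I| < ε

/-- `I` is the rough integral `∫_x^y v dW` of the controlled path `(v, v')`,
oriented so that `∫_x^y = -∫_y^x`. -/
def HasRoughIntegral (W v v' : ℝ → ℝ) (x y I : ℝ) : Prop :=
  (x ≤ y ∧ IsCompensatedLimit W v v' x y I) ∨ (y < x ∧ IsCompensatedLimit W v v' y x (-I))

open Classical in
/-- The rough integral `∫_x^y v dW` (and `0` where it does not exist). -/
def roughIntegral (W v v' : ℝ → ℝ) (x y : ℝ) : ℝ :=
  if h : ∃ I, HasRoughIntegral W v v' x y I then h.choose else 0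

/-! ### Pairs `𝒱 = (v, ∂_W v)` and the norm `Θ` -/

/-- Pairs `(v, ∂_W v)` of functions on `[0,T] × ℝ`. -/
abbrev CPair (T : ℝ) : Type :=
  (Set.Icc (0 : ℝ) T → ℝ → ℝ) × (Set.Icc (0 : ℝ) T → ℝ → ℝ)

/-- The spatial slice of `f` at a real time `s` (set to `0` for `s` outside `[0,T]`). -/
def slice {T : ℝ} (f : Set.Icc (0 : ℝ) T → ℝ → ℝ) (s : ℝ) : ℝ → ℝ :=
  if h : s ∈ Set.Icc (0 : ℝ) T then f ⟨s, h⟩ else 0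

/-- The remainder `v_t(y) - v_t(x) - ∂_W v_t(x) (W(y) - W(x))`. -/
def remainder {T : ℝ} (W : ℝ → ℝ) (V : CPair T) (t : Set.Icc (0 : ℝ) T) (x y : ℝ) : ℝ :=
  V.1 t y - V.1 t x - V.2 t x * (W y - W x)

/-- `‖f‖_∞^{[0,t]×[-a,a]}`. -/
def supNormOn {T : ℝ} (f : Set.Icc (0 : ℝ) T → ℝ → ℝ) (t : Set.Icc (0 : ℝ) T) (a : ℝ) : ℝ≥0∞ :=
  ⨆ s ∈ Set.Iic t, ⨆ x ∈ Set.Icc (-a) a, ENNReal.ofReal |f s x|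

/-- `‖f‖_{β/2,β}^{[0,t]×[-a,a]}`: the supremum over `(s,x) ≠ (s',x')` in `[0,t] × [-a,a]` of
`|f_{s'}(x') - f_s(x)| / (|s'-s|^{β/2} + |x'-x|^β)`. -/
def parHolderOn {T : ℝ} (β : ℝ) (f : Set.Icc (0 : ℝ) T → ℝ → ℝ) (t : Set.Icc (0 : ℝ) T)
    (a : ℝ) : ℝ≥0∞ :=
  ⨆ p ∈ Set.Iic t ×ˢ Set.Icc (-a) a, ⨆ q ∈ Set.Iic t ×ˢ Set.Icc (-a) a, ⨆ _ : p ≠ q,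
    ENNReal.ofReal (|f q.1 q.2 - f p.1 p.2|
      / (|(q.1 : ℝ) - (p.1 : ℝ)| ^ (β / 2) + |q.2 - p.2| ^ β))

/-- `⟦f⟧_{β/2,β}^{[0,t]×[-a,a]} = ‖f‖_∞ + a^{-β/2} ‖f‖_{β/2,β}`. -/
def dblNorm {T : ℝ} (β : ℝ) (f : Set.Icc (0 : ℝ) T → ℝ → ℝ) (t : Set.Icc (0 : ℝ) T)
    (a : ℝ) : ℝ≥0∞ :=
  supNormOn f t a + ENNReal.ofReal (a ^ (-(β / 2))) * parHolderOn β f t a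

/-- The weight `E^{θ,λ}(a,t) = exp(λt + θa + θat)`. -/
def weightE (θ lam a t : ℝ) : ℝ := Real.exp (lam * t + θ * a + θ * a * t)

/-- The inverse weight `Q(a,t)⁻¹`, where `Q(a,t) = a^χ (a^{β/2} + t^{-β/2})` for `t > 0`,
with the convention `Q(a,0)⁻¹ = 0`. -/
def weightQInv (β χ a t : ℝ) : ℝ :=
  if t = 0 then 0 else (a ^ χ * (a ^ (β / 2) + t ^ (-(β / 2))))⁻¹

/-- The expression under the supremum in `Θ`, with `γ = (α-β)/4`. At `t = 0` the last summand
vanishes (`0 * ∞ = 0` in `[0,∞]`), so the remainder at time `0` is not constrained. -/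
def thetaAt {T : ℝ} (α β χ θ lam : ℝ) (W : ℝ → ℝ) (V : CPair T) (t : Set.Icc (0 : ℝ) T)
    (a : ℝ) : ℝ≥0∞ :=
  ENNReal.ofReal (weightE θ lam a t)⁻¹ *
    (dblNorm β V.1 t a
      + ENNReal.ofReal (lam ^ (-((α - β) / 4))) * dblNorm β V.2 t a
      + ENNReal.ofReal (lam ^ (-((α - β) / 4))) * ENNReal.ofReal (weightQInv β χ a t)
          * incrNorm (remainder W V t) (2 * β) a)

/-- The norm `Θ^{θ,λ}(𝒱)`, with values in `[0,∞]`. -/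
def Theta {T : ℝ} (α β χ θ lam : ℝ) (W : ℝ → ℝ) (V : CPair T) : ℝ≥0∞ :=
  ⨆ t : Set.Icc (0 : ℝ) T, ⨆ a : ℝ, ⨆ _ : 1 ≤ a, thetaAt α β χ θ lam W V t a

/-! ### `Θ` is subadditive and homogeneous, so `{Θ < ∞}` is a vector space -/

theorem incrNorm_add_le (F G : ℝ → ℝ → ℝ) (r a : ℝ) :
    incrNorm (fun x y => F x y + G x y) r a ≤ incrNorm F r a + incrNorm G r a := by
  unfold incrNorm
  refine iSup₂_le fun x hx => iSup₂_le fun y hy => iSup_le fun hxy => ?_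
  calc ENNReal.ofReal (|F x y + G x y| / |y - x| ^ r)
      ≤ ENNReal.ofReal (|F x y| / |y - x| ^ r + |G x y| / |y - x| ^ r) := by
        apply ENNReal.ofReal_le_ofReal
        rw [← add_div]
        gcongr
        exact abs_add_le _ _
    _ ≤ ENNReal.ofReal (|F x y| / |y - x| ^ r) + ENNReal.ofReal (|G x y| / |y - x| ^ r) :=
        ENNReal.ofReal_add_le
    _ ≤ _ := by
        refine add_le_add ?_ ?_
        · exact le_iSup₂_of_le x hx (le_iSup₂_of_le y hy (le_iSup_of_le hxy le_rfl))
        · exact le_iSup₂_of_le x hx (le_iSup₂_of_le y hy (le_iSup_of_le hxy le_rfl))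

theorem incrNorm_smul_le (c : ℝ) (F : ℝ → ℝ → ℝ) (r a : ℝ) :
    incrNorm (fun x y => c * F x y) r a ≤ ENNReal.ofReal |c| * incrNorm F r a := by
  unfold incrNorm
  refine iSup₂_le fun x hx => iSup₂_le fun y hy => iSup_le fun hxy => ?_
  rw [abs_mul, mul_div_assoc, ENNReal.ofReal_mul (abs_nonneg c)]
  gcongr
  exact le_iSup₂_of_le x hx (le_iSup₂_of_le y hy (le_iSup_of_le hxy le_rfl))

theorem dblNorm_add_le {T : ℝ} (β : ℝ) (f g : Set.Icc (0 : ℝ) T → ℝ → ℝ)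
    (t : Set.Icc (0 : ℝ) T) (a : ℝ) :
    dblNorm β (f + g) t a ≤ dblNorm β f t a + dblNorm β g t a := by
  have h1 : supNormOn (f + g) t a ≤ supNormOn f t a + supNormOn g t a := by
    unfold supNormOn
    refine iSup₂_le fun s hs => iSup₂_le fun x hx => ?_
    calc ENNReal.ofReal |f s x + g s x|
        ≤ ENNReal.ofReal (|f s x| + |g s x|) := ENNReal.ofReal_le_ofReal (abs_add_le _ _)
      _ ≤ ENNReal.ofReal |f s x| + ENNReal.ofReal |g s x| := ENNReal.ofReal_add_le
      _ ≤ _ := by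
          refine add_le_add ?_ ?_
          · exact le_iSup₂_of_le s hs (le_iSup₂_of_le x hx le_rfl)
          · exact le_iSup₂_of_le s hs (le_iSup₂_of_le x hx le_rfl)
  have h2 : parHolderOn β (f + g) t a ≤ parHolderOn β f t a + parHolderOn β g t a := by
    unfold parHolderOn
    refine iSup₂_le fun p hp => iSup₂_le fun q hq => iSup_le fun hpq => ?_
    set D := |(q.1 : ℝ) - (p.1 : ℝ)| ^ (β / 2) + |q.2 - p.2| ^ β with hD
    have hD0 : 0 ≤ D := by positivity
    calc ENNReal.ofReal (|(f q.1 q.2 + g q.1 q.2) - (f p.1 p.2 + g p.1 p.2)| / D)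
        ≤ ENNReal.ofReal (|f q.1 q.2 - f p.1 p.2| / D + |g q.1 q.2 - g p.1 p.2| / D) := by
          apply ENNReal.ofReal_le_ofReal
          rw [← add_div, add_sub_add_comm]
          gcongr
          exact abs_add_le _ _
      _ ≤ ENNReal.ofReal (|f q.1 q.2 - f p.1 p.2| / D)
            + ENNReal.ofReal (|g q.1 q.2 - g p.1 p.2| / D) := ENNReal.ofReal_add_le
      _ ≤ _ := by
          refine add_le_add ?_ ?_
          · exact le_iSup₂_of_le p hp (le_iSup₂_of_le q hq (le_iSup_of_le hpq le_rfl))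
          · exact le_iSup₂_of_le p hp (le_iSup₂_of_le q hq (le_iSup_of_le hpq le_rfl))
  unfold dblNorm
  calc _ ≤ (supNormOn f t a + supNormOn g t a) + ENNReal.ofReal (a ^ (-(β / 2)))
        * (parHolderOn β f t a + parHolderOn β g t a) := by gcongr
    _ = _ := by ring

theorem dblNorm_smul_le {T : ℝ} (β c : ℝ) (f : Set.Icc (0 : ℝ) T → ℝ → ℝ)
    (t : Set.Icc (0 : ℝ) T) (a : ℝ) :
    dblNorm β (c • f) t a ≤ ENNReal.ofReal |c| * dblNorm β f t a := by
  have h1 : supNormOn (c • f) t a ≤ ENNReal.ofReal |c| * supNormOn f t a := by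
    unfold supNormOn
    refine iSup₂_le fun s hs => iSup₂_le fun x hx => ?_
    rw [Pi.smul_apply, Pi.smul_apply, smul_eq_mul, abs_mul, ENNReal.ofReal_mul (abs_nonneg c)]
    gcongr
    exact le_iSup₂_of_le s hs (le_iSup₂_of_le x hx le_rfl)
  have h2 : parHolderOn β (c • f) t a ≤ ENNReal.ofReal |c| * parHolderOn β f t a := by
    unfold parHolderOn
    refine iSup₂_le fun p hp => iSup₂_le fun q hq => iSup_le fun hpq => ?_
    simp only [Pi.smul_apply, smul_eq_mul]
    rw [← mul_sub, abs_mul, mul_div_assoc, ENNReal.ofReal_mul (abs_nonneg c)]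
    gcongr
    exact le_iSup₂_of_le p hp (le_iSup₂_of_le q hq (le_iSup_of_le hpq le_rfl))
  unfold dblNorm
  calc _ ≤ ENNReal.ofReal |c| * supNormOn f t a + ENNReal.ofReal (a ^ (-(β / 2)))
        * (ENNReal.ofReal |c| * parHolderOn β f t a) := by gcongr
    _ = _ := by ring

theorem Theta_add_le {T : ℝ} (α β χ θ lam : ℝ) (W : ℝ → ℝ) (V V' : CPair T) :
    Theta α β χ θ lam W (V + V') ≤ Theta α β χ θ lam W V + Theta α β χ θ lam W V' := by
  unfold Theta
  refine iSup_le fun t => iSup₂_le fun a ha => ?_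
  have hR : incrNorm (remainder W (V + V') t) (2 * β) a
      ≤ incrNorm (remainder W V t) (2 * β) a + incrNorm (remainder W V' t) (2 * β) a := by
    have : remainder W (V + V') t = fun x y => remainder W V t x y + remainder W V' t x y := by
      funext x y
      simp only [remainder, Prod.fst_add, Prod.snd_add, Pi.add_apply]
      ring
    rw [this]
    exact incrNorm_add_le _ _ _ _
  calc thetaAt α β χ θ lam W (V + V') t a
      ≤ thetaAt α β χ θ lam W V t a + thetaAt α β χ θ lam W V' t a := by
        unfold thetaAt
        rw [Prod.fst_add, Prod.snd_add, ← mul_add]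
        refine mul_le_mul_right ?_ _
        calc _ ≤ (dblNorm β V.1 t a + dblNorm β V'.1 t a)
              + ENNReal.ofReal (lam ^ (-((α - β) / 4))) * (dblNorm β V.2 t a + dblNorm β V'.2 t a)
              + ENNReal.ofReal (lam ^ (-((α - β) / 4))) * ENNReal.ofReal (weightQInv β χ a t)
                * (incrNorm (remainder W V t) (2 * β) a
                  + incrNorm (remainder W V' t) (2 * β) a) := by
              gcongr
              · exact dblNorm_add_le β _ _ t a
              · exact dblNorm_add_le β _ _ t a
          _ = _ := by ring
    _ ≤ _ := by
        refine add_le_add ?_ ?_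
        · exact le_iSup_of_le t (le_iSup₂_of_le a ha le_rfl)
        · exact le_iSup_of_le t (le_iSup₂_of_le a ha le_rfl)

theorem Theta_smul_le {T : ℝ} (α β χ θ lam : ℝ) (W : ℝ → ℝ) (c : ℝ) (V : CPair T) :
    Theta α β χ θ lam W (c • V) ≤ ENNReal.ofReal |c| * Theta α β χ θ lam W V := by
  unfold Theta
  refine iSup_le fun t => iSup₂_le fun a ha => ?_
  have hR : incrNorm (remainder W (c • V) t) (2 * β) a
      ≤ ENNReal.ofReal |c| * incrNorm (remainder W V t) (2 * β) a := by
    have : remainder W (c • V) t = fun x y => c * remainder W V t x y := by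
      funext x y
      simp only [remainder, Prod.smul_fst, Prod.smul_snd, Pi.smul_apply, smul_eq_mul]
      ring
    rw [this]
    exact incrNorm_smul_le _ _ _ _
  calc thetaAt α β χ θ lam W (c • V) t a
      ≤ ENNReal.ofReal |c| * thetaAt α β χ θ lam W V t a := by
        unfold thetaAt
        rw [Prod.smul_fst, Prod.smul_snd, mul_left_comm]
        gcongr
        calc _ ≤ ENNReal.ofReal |c| * dblNorm β V.1 t a
              + ENNReal.ofReal (lam ^ (-((α - β) / 4)))
                * (ENNReal.ofReal |c| * dblNorm β V.2 t a)
              + ENNReal.ofReal (lam ^ (-((α - β) / 4))) * ENNReal.ofReal (weightQInv β χ a t)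
                * (ENNReal.ofReal |c| * incrNorm (remainder W V t) (2 * β) a) := by
              gcongr
              · exact dblNorm_smul_le β c _ t a
              · exact dblNorm_smul_le β c _ t a
          _ = _ := by ring
    _ ≤ _ := by
        gcongr
        exact le_iSup_of_le t (le_iSup₂_of_le a ha le_rfl)

theorem Theta_zero {T : ℝ} (α β χ θ lam : ℝ) (W : ℝ → ℝ) :
    Theta α β χ θ lam W (0 : CPair T) = 0 := by
  have h := Theta_smul_le α β χ θ lam W 0 (0 : CPair T)
  simpa using h

/-- The space `ℬ^{θ,λ}` of pairs `𝒱` with `Θ^{θ,λ}(𝒱) < ∞`. -/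
def spaceB (T α β χ θ lam : ℝ) (W : ℝ → ℝ) : Submodule ℝ (CPair T) where
  carrier := {V | Theta α β χ θ lam W V < ∞}
  add_mem' {V V'} hV hV' :=
    lt_of_le_of_lt (Theta_add_le α β χ θ lam W V V') (ENNReal.add_lt_top.2 ⟨hV, hV'⟩)
  zero_mem' := by
    change Theta α β χ θ lam W (0 : CPair T) < ∞
    rw [Theta_zero]
    exact ENNReal.zero_lt_top
  smul_mem' c V hV :=
    lt_of_le_of_lt (Theta_smul_le α β χ θ lam W c V)
      (ENNReal.mul_lt_top ENNReal.ofReal_lt_top hV)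

/-! ### The map `ℳ` -/

/-- The heat kernel `p_t(x) = (2πσ²t)^{-1/2} exp(-x²/(2σ²t))`. -/
def heatKernel (σ t x : ℝ) : ℝ :=
  1 / Real.sqrt (2 * Real.pi * σ ^ 2 * t) * Real.exp (-(x ^ 2) / (2 * σ ^ 2 * t))

/-- The integrand `∂²_{xx} p_{t-s}(x-y) ∫_x^y v_s(z) dW(z)`. -/
def mapMIntegrand {T : ℝ} (σ : ℝ) (W : ℝ → ℝ) (V : CPair T) (t x s y : ℝ) : ℝ :=
  iteratedDeriv 2 (heatKernel σ (t - s)) (x - y)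
    * roughIntegral W (slice V.1 s) (slice V.2 s) x y

/-- The map `ℳ`: the first component of `ℳ𝒱` is
`∫_0^t ∫_ℝ ∂²_{xx} p_{t-s}(x-y) (∫_x^y v_s(z) dW(z)) dy ds`, and its Gubinelli derivative is
`-(2/σ²) v`. -/
def mapM {T : ℝ} (σ : ℝ) (W : ℝ → ℝ) (V : CPair T) : CPair T :=
  (fun t x => ∫ s in (0 : ℝ)..(t : ℝ), ∫ y : ℝ, mapMIntegrand σ W V t x s y,
    fun t x => -(2 / σ ^ 2) * V.1 t x)

end

noncomputable section

/-! ### Sewing -/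

/-! The map gains a power of `λ` because the weight `E(a,t)` grows fast in time. With `τ = t - s`
one has `E(a,s) = E(a,t) exp(-λτ) exp(-θaτ)`. Since `exp(-x) ≤ x^(-η)` for `0 ≤ η ≤ 1`, each power
of `τ` that the singularity of the time integral can spare is exchanged for the same negative power
of `λ` or of `a`. Powers of `λ` give the contraction. Powers of `a` pay for the growth of the path
on large windows. This trade is `weight_monomial_le`; the exponents are balanced in
`weighted_decay_sup_le`, `weighted_decay_hol_le` and `weighted_decay_rem_le`.

The inputs are as follows. The sewing estimate `AlmostAdditive.abs_sum_sub_le`, applied to the germ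
`v W¹ + v' W²`, gives the rough integral and shows that `∫_x^y v dW - v(x) W¹(x,y)` is of order
`|y-x|^(2α)` and `|y-x|^(2β+α)`, with weights (`exists_roughIntegral_bound`); the exponent `2β + α`
exceeds `1` because `1/3 < β < α`. The kernel `∂²p_τ` is dominated by `τ^(-3/2)` times a Gaussian at
scale `√τ`, so averaging a two-point function of order `r` against it costs `τ^(-1+r/2)`
(`integral_conv_le`). A spatial increment of exponent `η` costs a further `τ^(-η/2)`, and a time
increment of exponent `η` costs `τ^(-η)` (`heatAvg_bounds`). Increments in `x` reduce to increments
of the kernel because `∂²p_τ` has integral zero and the rough integral is additive, so its base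
point may be moved (`AdditiveGerm.heatAvg_eq`). Integrating over `s` gives the bounds on the first
component (`flowMap_bounds`).

The Gubinelli derivative comes from the heat equation: `∂²p` is `2/σ²` times the time derivative of
`p`, so replacing `v_s` by `v_t(x)` turns the flow into `(2/σ²) v_t(x) ∫ p_t(x-y) W¹(x,y) dy`, that
is `(2/σ²) v_t(x) (p_t * W - W)(x)`. Its increment is `-(2/σ²) v_t(x) W¹` plus an increment of `p_t
* W`, whose blow-up as `t → 0` is what `Q(a,t)` admits (`flowMap_rem_le`). The derivative `-(2/σ²)
v` and the new remainder need no gain from the time integral, since `Θ` already weights them by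
`λ^(-γ)`. `Theta_mapM_le` collects the three estimates.

Completeness holds because `Θ` is lower semicontinuous for pointwise convergence: a Cauchy sequence
converges pointwise, and its Cauchy bounds pass to the limit (`exists_limit_of_Theta_cauchy`). -/

/-- The constant of the sewing estimate with exponent `ζ`. -/
def sewConst (ζ : ℝ) : ℝ := 2 / (1 - 2 ^ (1 - ζ))

theorem two_rpow_one_sub_lt_one {ζ : ℝ} (hζ : 1 < ζ) : (2 : ℝ) ^ (1 - ζ) < 1 :=
  Real.rpow_lt_one_of_one_lt_of_neg (by norm_num) (by linarith)

theorem sewConst_pos {ζ : ℝ} (hζ : 1 < ζ) : 0 < sewConst ζ :=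
  div_pos two_pos (by linarith [two_rpow_one_sub_lt_one hζ])

/-- The fixed-point equation of the induction below: two halves reproduce the estimate with factor
`2^(1-ζ)`, and two defects are added. -/
theorem sewConst_eq {ζ : ℝ} (hζ : 1 < ζ) :
    sewConst ζ * 2 ^ (1 - ζ) + 2 = sewConst ζ := by
  have h := two_rpow_one_sub_lt_one hζ
  have h' : (1 - (2 : ℝ) ^ (1 - ζ)) ≠ 0 := by linarith
  unfold sewConst
  field_simp
  ring

theorem two_mul_half_rpow (L : ℝ) (hL : 0 ≤ L) (ζ : ℝ) :
    2 * (L / 2) ^ ζ = 2 ^ (1 - ζ) * L ^ ζ := by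
  rw [Real.div_rpow hL (by norm_num), Real.rpow_sub (by norm_num), Real.rpow_one]
  ring

theorem exists_index_mid (u : ℕ → ℝ) (n : ℕ) (c : ℝ) (h0 : u 0 ≤ c) (hn : c ≤ u n) (hpos : 0 < n) :
    ∃ j < n, u j ≤ c ∧ c ≤ u (j + 1) := by
  by_contra! H
  have key : ∀ k < n, u k ≤ c := by
    intro k
    induction k with
    | zero => intro _; exact h0
    | succ k ih => intro hk; exact (H k (by omega) (ih (by omega))).le
  have := H (n - 1) (by omega) (key _ (by omega))
  rw [Nat.sub_add_cancel hpos] at this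
  linarith

/-- A two-point function on `[p, q]` whose defect of additivity is of order `ζ`. -/
structure AlmostAdditive (A : ℝ → ℝ → ℝ) (p q M ζ : ℝ) : Prop where
  one_lt : 1 < ζ
  nonneg : 0 ≤ M
  diag : ∀ z, A z z = 0
  defect : ∀ x u y, p ≤ x → x ≤ u → u ≤ y → y ≤ q → |A x y - A x u - A u y| ≤ M * (y - x) ^ ζ

/-- Induction on the number of intervals, for arbitrary partitions. Take out the partition interval
that contains the midpoint of `[u 0, u n]`. The points on either side of it span at most half the
length, so the induction hypothesis applies with `L / 2`. Regluing the three pieces costs two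
defects, and `sewConst_eq` closes the estimate. -/
theorem AlmostAdditive.abs_sum_sub_le {A : ℝ → ℝ → ℝ} {p q M ζ : ℝ}
    (h : AlmostAdditive A p q M ζ) (n : ℕ) : ∀ u : ℕ → ℝ, Monotone u → p ≤ u 0 → u n ≤ q →
    |∑ i ∈ Finset.range n, A (u i) (u (i + 1)) - A (u 0) (u n)|
      ≤ sewConst ζ * M * (u n - u 0) ^ ζ := by
  induction n using Nat.strong_induction_on with
  | _ n ih =>
  intro u hu hp hq
  rcases Nat.eq_zero_or_pos n with rfl | hn
  · have h0 : ζ ≠ 0 := by linarith [h.one_lt]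
    simp [h.diag, Real.zero_rpow h0]
  have hL : 0 ≤ u n - u 0 := sub_nonneg.2 (hu (Nat.zero_le n))
  obtain ⟨j, hj, hj1, hj2⟩ := exists_index_mid u n ((u 0 + u n) / 2) (by linarith) (by linarith) hn
  obtain ⟨k, rfl⟩ : ∃ k, n = j + 1 + k := ⟨n - (j + 1), by omega⟩
  have hM := h.nonneg
  have hC := (sewConst_pos h.one_lt).le
  have hζ : 0 ≤ ζ := by linarith [h.one_lt]
  have m1 : u 0 ≤ u j := hu (Nat.zero_le j)
  have m2 : u j ≤ u (j + 1) := hu (Nat.le_succ j)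
  have m3 : u (j + 1) ≤ u (j + 1 + k) := hu (by omega)
  set L := u (j + 1 + k) - u 0 with hLdef
  have e1 : |∑ i ∈ Finset.range j, A (u i) (u (i + 1)) - A (u 0) (u j)|
      ≤ sewConst ζ * M * (L / 2) ^ ζ := by
    refine (ih j (by omega) u hu hp (by linarith)).trans ?_
    gcongr
    linarith
  have e2 : |∑ i ∈ Finset.range k, A (u (j + 1 + i)) (u (j + 1 + i + 1))
      - A (u (j + 1)) (u (j + 1 + k))| ≤ sewConst ζ * M * (L / 2) ^ ζ := by
    have := ih k (by omega) (fun i => u (j + 1 + i)) (fun a b hab => hu (by omega))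
      (by simpa using by linarith) hq
    refine this.trans ?_
    simp only [add_zero]
    gcongr
    linarith
  have d1 : |A (u 0) (u (j + 1 + k)) - A (u 0) (u j) - A (u j) (u (j + 1 + k))| ≤ M * L ^ ζ :=
    h.defect _ _ _ hp m1 (by linarith) hq
  have d2 : |A (u j) (u (j + 1 + k)) - A (u j) (u (j + 1)) - A (u (j + 1)) (u (j + 1 + k))|
      ≤ M * L ^ ζ := by
    refine (h.defect _ _ _ (by linarith) m2 m3 hq).trans ?_
    gcongr
    · linarith
    · linarith
  have e3 : 2 * (sewConst ζ * M * (L / 2) ^ ζ) + 2 * (M * L ^ ζ) = sewConst ζ * M * L ^ ζ := by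
    calc _ = sewConst ζ * M * (2 * (L / 2) ^ ζ) + 2 * (M * L ^ ζ) := by ring
      _ = (sewConst ζ * 2 ^ (1 - ζ) + 2) * (M * L ^ ζ) := by rw [two_mul_half_rpow L hL]; ring
      _ = _ := by rw [sewConst_eq h.one_lt]; ring
  rw [Finset.sum_range_add, Finset.sum_range_succ]
  rw [abs_le] at *
  constructor <;> linarith [e1.1, e1.2, e2.1, e2.2, d1.1, d1.2, d2.1, d2.2]

/-- Projection of `w` to `[a, b]`. -/
def clampTo (a b w : ℝ) : ℝ := max a (min b w)

theorem clampTo_mono (a b : ℝ) : Monotone (clampTo a b) := fun _ _ h =>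
  max_le_max le_rfl (min_le_min le_rfl h)

/-- If the two intervals meet, clamping either one to the other yields their intersection; otherwise
both sides are values on the diagonal. A double sum over clamped intervals can thus play the role of
the common refinement of two partitions, with no need to sort their points. -/
theorem clamp_symm {A : ℝ → ℝ → ℝ} (hA : ∀ z, A z z = 0) {a b c d : ℝ} (hab : a ≤ b)
    (hcd : c ≤ d) : A (clampTo a b c) (clampTo a b d) = A (clampTo c d a) (clampTo c d b) := by
  unfold clampTo
  rcases lt_or_ge b c with h | h
  · rw [min_eq_left h.le, min_eq_left (h.le.trans hcd), min_eq_right (hab.trans (h.le.trans hcd)),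
      min_eq_right (h.le.trans hcd), max_eq_left (hab.trans h.le), max_eq_left h.le, hA, hA]
  rcases lt_or_ge d a with h' | h'
  · rw [min_eq_right h, min_eq_right (h'.le.trans hab), min_eq_left h'.le,
      min_eq_left (h'.le.trans hab), max_eq_left h'.le, max_eq_left (hcd.trans h'.le), hA, hA]
  · rw [min_eq_right h, min_eq_right h', max_comm a c, max_eq_right (le_min hab h'),
      max_eq_right (le_min hcd h), min_comm b d]

/-- For fixed `i` the clamped points of `w` form a partition of `[u i, u (i+1)]`, with many
repetitions that do no harm, so the previous estimate applies on each interval of `u`. -/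
theorem AlmostAdditive.abs_sum_sub_clamp_le {A : ℝ → ℝ → ℝ} {p q M ζ : ℝ}
    (h : AlmostAdditive A p q M ζ) {n m : ℕ} {u w : ℕ → ℝ} (hu : Monotone u) (hw : Monotone w)
    (hu0 : u 0 = p) (hun : u n = q) (hw0 : w 0 = p) (hwm : w m = q) :
    |∑ i ∈ Finset.range n, A (u i) (u (i + 1)) - ∑ i ∈ Finset.range n, ∑ j ∈ Finset.range m,
        A (clampTo (u i) (u (i + 1)) (w j)) (clampTo (u i) (u (i + 1)) (w (j + 1)))|
      ≤ sewConst ζ * M * ∑ i ∈ Finset.range n, (u (i + 1) - u i) ^ ζ := by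
  rw [← Finset.sum_sub_distrib, Finset.mul_sum]
  refine (Finset.abs_sum_le_sum_abs _ _).trans (Finset.sum_le_sum fun i hi => ?_)
  have hi : i < n := Finset.mem_range.1 hi
  have h1 : p ≤ u i := hu0 ▸ hu (Nat.zero_le i)
  have h2 : u (i + 1) ≤ q := hun ▸ hu hi
  have h3 : u i ≤ u (i + 1) := hu (Nat.le_succ i)
  have c0 : clampTo (u i) (u (i + 1)) (w 0) = u i := by
    unfold clampTo; rw [hw0, max_eq_left ((min_le_right _ _).trans h1)]
  have c1 : clampTo (u i) (u (i + 1)) (w m) = u (i + 1) := by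
    unfold clampTo; rw [hwm, min_eq_left h2, max_eq_right h3]
  have := h.abs_sum_sub_le m (fun j => clampTo (u i) (u (i + 1)) (w j))
    ((clampTo_mono _ _).comp hw) (by simpa [c0] using h1) (by simpa [c1] using h2)
  simp only [c0, c1] at this
  rwa [abs_sub_comm]

theorem sum_rpow_le_of_mesh {n : ℕ} {u : ℕ → ℝ} {ζ δ : ℝ} (hζ : 1 < ζ) (hu : Monotone u)
    (hδ : ∀ i < n, u (i + 1) - u i < δ) :
    ∑ i ∈ Finset.range n, (u (i + 1) - u i) ^ ζ ≤ δ ^ (ζ - 1) * (u n - u 0) := by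
  rw [← Finset.sum_range_sub, Finset.mul_sum]
  refine Finset.sum_le_sum fun i hi => ?_
  have h0 : 0 ≤ u (i + 1) - u i := sub_nonneg.2 (hu (Nat.le_succ i))
  have := hδ i (Finset.mem_range.1 hi)
  rcases h0.eq_or_lt with h | h
  · rw [← h, Real.zero_rpow (by linarith), mul_zero]
  · calc (u (i + 1) - u i) ^ ζ = (u (i + 1) - u i) ^ (ζ - 1) * (u (i + 1) - u i) := by
          rw [← Real.rpow_add_one h.ne']; ring_nf
      _ ≤ _ := by gcongr

/-- Both sums are close to the same double sum over clamped intervals, by `clamp_symm` and an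
exchange of the summations. -/
theorem AlmostAdditive.abs_sum_sub_sum_le {A : ℝ → ℝ → ℝ} {p q M ζ δ : ℝ}
    (h : AlmostAdditive A p q M ζ) {n m : ℕ} {u w : ℕ → ℝ} (hu : Monotone u) (hw : Monotone w)
    (hu0 : u 0 = p) (hun : u n = q) (hw0 : w 0 = p) (hwm : w m = q)
    (hδu : ∀ i < n, u (i + 1) - u i < δ) (hδw : ∀ i < m, w (i + 1) - w i < δ) :
    |∑ i ∈ Finset.range n, A (u i) (u (i + 1)) - ∑ i ∈ Finset.range m, A (w i) (w (i + 1))|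
      ≤ 2 * (sewConst ζ * M * (q - p)) * δ ^ (ζ - 1) := by
  have e1 := h.abs_sum_sub_clamp_le hu hw hu0 hun hw0 hwm
  have e2 := h.abs_sum_sub_clamp_le hw hu hw0 hwm hu0 hun
  have e3 : ∑ i ∈ Finset.range n, ∑ j ∈ Finset.range m,
        A (clampTo (u i) (u (i + 1)) (w j)) (clampTo (u i) (u (i + 1)) (w (j + 1)))
      = ∑ i ∈ Finset.range m, ∑ j ∈ Finset.range n,
        A (clampTo (w i) (w (i + 1)) (u j)) (clampTo (w i) (w (i + 1)) (u (j + 1))) := by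
    rw [Finset.sum_comm]
    exact Finset.sum_congr rfl fun i _ => Finset.sum_congr rfl fun j _ =>
      clamp_symm h.diag (hu (Nat.le_succ j)) (hw (Nat.le_succ i))
  have hC : 0 ≤ sewConst ζ * M := mul_nonneg (sewConst_pos h.one_lt).le h.nonneg
  have f1 := mul_le_mul_of_nonneg_left (sum_rpow_le_of_mesh h.one_lt hu hδu) hC
  have f2 := mul_le_mul_of_nonneg_left (sum_rpow_le_of_mesh h.one_lt hw hδw) hC
  rw [hun, hu0] at f1
  rw [hwm, hw0] at f2
  rw [e3] at e1
  rw [abs_le] at *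
  constructor <;> nlinarith [e1.1, e1.2, e2.1, e2.2]

/-! ### Limits of Riemann sums -/

/-- The uniform partition of `[x, y]` into `n + 1` intervals. -/
def unifPart (x y : ℝ) (n i : ℕ) : ℝ := x + i * ((y - x) / (n + 1))

theorem unifPart_mono {x y : ℝ} (h : x ≤ y) (n : ℕ) : Monotone (unifPart x y n) := by
  intro i j hij
  unfold unifPart
  have : 0 ≤ (y - x) / (n + 1) := div_nonneg (by linarith) (by positivity)
  gcongr

theorem unifPart_zero (x y : ℝ) (n : ℕ) : unifPart x y n 0 = x := by simp [unifPart]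

theorem unifPart_last (x y : ℝ) (n : ℕ) : unifPart x y n (n + 1) = y := by
  unfold unifPart; push_cast; field_simp; ring

theorem unifPart_step (x y : ℝ) (n i : ℕ) :
    unifPart x y n (i + 1) - unifPart x y n i = (y - x) / (n + 1) := by
  unfold unifPart; push_cast; ring

theorem eventually_unifPart_step_lt (x y : ℝ) {δ : ℝ} (hδ : 0 < δ) :
    ∀ᶠ n : ℕ in Filter.atTop, (y - x) / ((n : ℝ) + 1) < δ := by
  have : Filter.Tendsto (fun n : ℕ => (y - x) / ((n : ℝ) + 1)) Filter.atTop (nhds 0) :=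
    Filter.Tendsto.div_atTop tendsto_const_nhds
      (Filter.tendsto_atTop_add_const_right _ _ tendsto_natCast_atTop_atTop)
  exact this.eventually_lt_const hδ

/-- Convergence of the Riemann sums of a two-point function over `[x, y]`. -/
def IsSewLimit (A : ℝ → ℝ → ℝ) (x y I : ℝ) : Prop :=
  ∀ ε > 0, ∃ δ > 0, ∀ (n : ℕ) (u : ℕ → ℝ), Monotone u → u 0 = x → u n = y →
    (∀ i < n, u (i + 1) - u i < δ) → |∑ i ∈ Finset.range n, A (u i) (u (i + 1)) - I| < ε

theorem IsSewLimit.tendsto_unif {A : ℝ → ℝ → ℝ} {x y I : ℝ} (h : IsSewLimit A x y I)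
    (hxy : x ≤ y) : Filter.Tendsto (fun n : ℕ => ∑ i ∈ Finset.range (n + 1),
      A (unifPart x y n i) (unifPart x y n (i + 1))) Filter.atTop (nhds I) := by
  rw [Metric.tendsto_atTop']
  intro ε hε
  obtain ⟨δ, hδ, H⟩ := h ε hε
  obtain ⟨N, hN⟩ := Filter.eventually_atTop.1 (eventually_unifPart_step_lt x y hδ)
  refine ⟨N, fun n hn => ?_⟩
  rw [Real.dist_eq]
  exact H _ _ (unifPart_mono hxy n) (unifPart_zero x y n) (unifPart_last x y n)
    fun i _ => by rw [unifPart_step]; exact hN n hn.le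

theorem IsSewLimit.unique {A : ℝ → ℝ → ℝ} {x y I J : ℝ} (h : IsSewLimit A x y I)
    (h' : IsSewLimit A x y J) (hxy : x ≤ y) : I = J :=
  tendsto_nhds_unique (h.tendsto_unif hxy) (h'.tendsto_unif hxy)

/-- Two fine partitions have sums within `D δ^(ζ-1)` of each other. The uniform partitions therefore
give a Cauchy sequence, and its limit attracts every other fine partition. -/
theorem AlmostAdditive.exists_sewLimit {A : ℝ → ℝ → ℝ} {p q M ζ : ℝ}
    (h : AlmostAdditive A p q M ζ) (hpq : p ≤ q) :
    ∃ I, IsSewLimit A p q I ∧ |I - A p q| ≤ sewConst ζ * M * (q - p) ^ ζ := by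
  set S : ℕ → ℝ := fun n => ∑ i ∈ Finset.range (n + 1),
      A (unifPart p q n i) (unifPart p q n (i + 1)) with hS
  set D := 2 * (sewConst ζ * M * (q - p)) with hD
  have hC : 0 ≤ sewConst ζ * M := mul_nonneg (sewConst_pos h.one_lt).le h.nonneg
  have hD0 : 0 ≤ D := by have := mul_nonneg hC (sub_nonneg.2 hpq); linarith
  have hsmall : ∀ ε > 0, ∃ δ > 0, D * δ ^ (ζ - 1) < ε := by
    intro ε hε
    have ht : Filter.Tendsto (fun δ : ℝ => D * δ ^ (ζ - 1)) (nhdsWithin 0 (Set.Ioi 0)) (nhds 0) := by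
      have : Filter.Tendsto (fun δ : ℝ => D * δ ^ (ζ - 1)) (nhds 0) (nhds (D * 0 ^ (ζ - 1))) :=
        ((Real.continuousAt_rpow_const _ _ (Or.inr (by linarith [h.one_lt]))).tendsto).const_mul D
      rw [Real.zero_rpow (by linarith [h.one_lt]), mul_zero] at this
      exact this.mono_left nhdsWithin_le_nhds
    obtain ⟨δ, h1, h2⟩ := ((ht.eventually_lt_const hε).and self_mem_nhdsWithin).exists
    exact ⟨δ, h2, h1⟩
  have hcomp : ∀ (δ : ℝ) (n : ℕ), (q - p) / ((n : ℝ) + 1) < δ → ∀ (m : ℕ) (u : ℕ → ℝ), Monotone u →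
      u 0 = p → u m = q → (∀ i < m, u (i + 1) - u i < δ) →
      |∑ i ∈ Finset.range m, A (u i) (u (i + 1)) - S n| ≤ D * δ ^ (ζ - 1) := by
    intro δ n hn m u hu h0 hm hmesh
    exact h.abs_sum_sub_sum_le hu (unifPart_mono hpq n) h0 hm (unifPart_zero p q n)
      (unifPart_last p q n) hmesh fun i _ => by rw [unifPart_step]; exact hn
  have hcau : CauchySeq S := by
    rw [Metric.cauchySeq_iff]
    intro ε hε
    obtain ⟨δ, hδ, hlt⟩ := hsmall ε hε
    obtain ⟨N, hN⟩ := Filter.eventually_atTop.1 (eventually_unifPart_step_lt p q hδ)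
    refine ⟨N, fun m hm n hn => ?_⟩
    rw [Real.dist_eq]
    exact (hcomp δ n (hN n hn) (m + 1) _ (unifPart_mono hpq m) (unifPart_zero p q m)
      (unifPart_last p q m) fun i _ => by rw [unifPart_step]; exact hN m hm).trans_lt hlt
  obtain ⟨I, hI⟩ := cauchySeq_tendsto_of_complete hcau
  refine ⟨I, ?_, ?_⟩
  · intro ε hε
    obtain ⟨δ, hδ, hlt⟩ := hsmall ε hε
    refine ⟨δ, hδ, fun m u hu h0 hm hmesh => ?_⟩
    refine lt_of_le_of_lt ?_ hlt
    refine le_of_tendsto ((tendsto_const_nhds.sub hI).abs) ?_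
    filter_upwards [eventually_unifPart_step_lt p q hδ] with n hn
    exact hcomp δ n hn m u hu h0 hm hmesh
  · refine le_of_tendsto ((hI.sub_const _).abs) (Filter.Eventually.of_forall fun n => ?_)
    have := h.abs_sum_sub_le (n + 1) (unifPart p q n) (unifPart_mono hpq n)
      (by rw [unifPart_zero]) (by rw [unifPart_last])
    rwa [unifPart_zero, unifPart_last] at this

/-- Concatenation of the first `n` steps of `u` with `w`. -/
def concatPart (u w : ℕ → ℝ) (n i : ℕ) : ℝ := if i ≤ n then u i else w (i - n)

theorem IsSewLimit.add {A : ℝ → ℝ → ℝ} {x y z I J K : ℝ} (hI : IsSewLimit A x y I)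
    (hJ : IsSewLimit A y z J) (hK : IsSewLimit A x z K) (hxy : x ≤ y) (hyz : y ≤ z) :
    K = I + J := by
  have h1 := (hI.tendsto_unif hxy).add (hJ.tendsto_unif hyz)
  refine tendsto_nhds_unique ?_ h1
  rw [Metric.tendsto_atTop']
  intro ε hε
  obtain ⟨δ, hδ, H⟩ := hK ε hε
  obtain ⟨N, hN⟩ := Filter.eventually_atTop.1 ((eventually_unifPart_step_lt x y hδ).and
    (eventually_unifPart_step_lt y z hδ))
  refine ⟨N, fun n hn => ?_⟩
  obtain ⟨hN1, hN2⟩ := hN n hn.le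
  set u := concatPart (unifPart x y n) (unifPart y z n) (n + 1) with hu
  have hl : ∀ i ≤ n + 1, u i = unifPart x y n i := fun i hi => by simp [hu, concatPart, hi]
  -- At the seam `i = 0` the concatenation still takes its value from the first partition; both
  -- values are `y`.
  have hr : ∀ i, u (n + 1 + i) = unifPart y z n i := by
    intro i
    rcases Nat.eq_zero_or_pos i with rfl | hi
    · rw [add_zero, hl _ le_rfl, unifPart_last, unifPart_zero]
    · have : ¬ (n + 1 + i ≤ n + 1) := by omega
      simp only [hu, concatPart, this, if_false]
      congr 1; omega
  have hstep : ∀ i, 0 ≤ u (i + 1) - u i ∧ (u (i + 1) - u i < δ) := by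
    intro i
    rcases le_or_gt (i + 1) (n + 1) with hi | hi
    · rw [hl _ hi, hl i (by omega), unifPart_step]
      exact ⟨div_nonneg (by linarith) (by positivity), hN1⟩
    · obtain ⟨k, rfl⟩ : ∃ k, i = n + 1 + k := ⟨i - (n + 1), by omega⟩
      rw [add_assoc, hr, hr, unifPart_step]
      exact ⟨div_nonneg (by linarith) (by positivity), hN2⟩
  have := H (n + 1 + (n + 1)) u (monotone_nat_of_le_succ fun i => by linarith [(hstep i).1])
    (by rw [hl _ (by omega), unifPart_zero]) (by rw [hr, unifPart_last]) fun i _ => (hstep i).2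
  rw [Finset.sum_range_add] at this
  rw [Real.dist_eq]
  convert this using 4
  · refine Finset.sum_congr rfl fun i hi => ?_
    have := Finset.mem_range.1 hi
    rw [hl i (by omega), hl (i + 1) (by omega)]
  · refine Finset.sum_congr rfl fun i _ => ?_
    rw [hr, add_assoc, hr]

/-! ### Real bounds from the extended norms -/

theorem incrNorm_le_iff {F : ℝ → ℝ → ℝ} {r a M : ℝ} (hM : 0 ≤ M) :
    incrNorm F r a ≤ ENNReal.ofReal M ↔
      ∀ x ∈ Set.Icc (-a) a, ∀ y ∈ Set.Icc (-a) a, x ≠ y → |F x y| ≤ M * |y - x| ^ r := by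
  unfold incrNorm
  simp only [iSup_le_iff]
  refine forall₂_congr fun x _ => forall₂_congr fun y _ => forall_congr' fun hxy => ?_
  rw [ENNReal.ofReal_le_ofReal_iff hM, div_le_iff₀]
  exact Real.rpow_pos_of_pos (abs_pos.2 (sub_ne_zero.2 hxy.symm)) _

theorem supNormOn_le_iff {T : ℝ} {f : Set.Icc (0 : ℝ) T → ℝ → ℝ} {t : Set.Icc (0 : ℝ) T}
    {a M : ℝ} (hM : 0 ≤ M) : supNormOn f t a ≤ ENNReal.ofReal M ↔
      ∀ s ≤ t, ∀ x ∈ Set.Icc (-a) a, |f s x| ≤ M := by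
  unfold supNormOn
  simp only [iSup_le_iff, Set.mem_Iic]
  exact forall₂_congr fun s _ => forall₂_congr fun x _ => ENNReal.ofReal_le_ofReal_iff hM

theorem parHolderOn_le_iff {T β : ℝ} {f : Set.Icc (0 : ℝ) T → ℝ → ℝ}
    {t : Set.Icc (0 : ℝ) T} {a M : ℝ} (hM : 0 ≤ M) :
    parHolderOn β f t a ≤ ENNReal.ofReal M ↔
      ∀ s ≤ t, ∀ x ∈ Set.Icc (-a) a, ∀ s' ≤ t, ∀ x' ∈ Set.Icc (-a) a, (s, x) ≠ (s', x') →
        |f s' x' - f s x| ≤ M * (|(s' : ℝ) - s| ^ (β / 2) + |x' - x| ^ β) := by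
  unfold parHolderOn
  simp only [iSup_le_iff, Set.mem_prod, Prod.forall, Set.mem_Iic, and_imp]
  have key : ∀ (s : Set.Icc (0 : ℝ) T) (x : ℝ) (s' : Set.Icc (0 : ℝ) T) (x' : ℝ),
      (s, x) ≠ (s', x') → (ENNReal.ofReal (|f s' x' - f s x|
        / (|(s' : ℝ) - s| ^ (β / 2) + |x' - x| ^ β)) ≤ ENNReal.ofReal M ↔
      |f s' x' - f s x| ≤ M * (|(s' : ℝ) - s| ^ (β / 2) + |x' - x| ^ β)) := by
    intro s x s' x' hne
    rw [ENNReal.ofReal_le_ofReal_iff hM, div_le_iff₀]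
    have h1 : 0 ≤ |(s' : ℝ) - s| ^ (β / 2) := by positivity
    have h2 : 0 ≤ |x' - x| ^ β := by positivity
    by_cases hs : s = s'
    · have hx : x ≠ x' := fun h => hne (by rw [hs, h])
      have := Real.rpow_pos_of_pos (abs_pos.2 (sub_ne_zero.2 hx.symm)) β
      linarith
    · have hs' : (s' : ℝ) ≠ s := fun h => hs (Subtype.ext h.symm)
      have := Real.rpow_pos_of_pos (abs_pos.2 (sub_ne_zero.2 hs')) (β / 2)
      linarith
  constructor
  · intro H s hs x hx s' hs' x' hx' hne
    exact (key s x s' x' hne).1 (H s x hs hx s' x' hs' hx' hne)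
  · intro H s x hs hx s' x' hs' hx' hne
    exact (key s x s' x' hne).2 (H s hs x hx s' hs' x' hx' hne)

theorem le_ofReal_div_of_ofReal_mul_le {X : ℝ≥0∞} {c N : ℝ} (hc : 0 < c)
    (h : ENNReal.ofReal c * X ≤ ENNReal.ofReal N) : X ≤ ENNReal.ofReal (N / c) := by
  rw [ENNReal.ofReal_div_of_pos hc, ENNReal.le_div_iff_mul_le, mul_comm]
  · exact h
  · left; simpa using hc
  · left; exact ENNReal.ofReal_ne_top

/-! ### `Θ` in terms of pointwise weighted bounds -/

/-- Parabolic Hölder bounds with weights for one function on `[0,T] × ℝ`. -/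
structure WeightedBd {T : ℝ} (β θ lam : ℝ) (f : Set.Icc (0 : ℝ) T → ℝ → ℝ) (N : ℝ) : Prop where
  sup : ∀ a, 1 ≤ a → ∀ t, ∀ x ∈ Set.Icc (-a) a, |f t x| ≤ N * weightE θ lam a t
  hol : ∀ a, 1 ≤ a → ∀ s t, s ≤ t → ∀ x ∈ Set.Icc (-a) a, ∀ y ∈ Set.Icc (-a) a,
    |f t y - f s x| ≤ N * weightE θ lam a t * a ^ (β / 2)
      * (|(t : ℝ) - s| ^ (β / 2) + |y - x| ^ β)

/-- Weighted bounds for a remainder. -/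
def WeightedRem {T : ℝ} (β χ θ lam : ℝ) (R : Set.Icc (0 : ℝ) T → ℝ → ℝ → ℝ) (N : ℝ) : Prop :=
  ∀ a, 1 ≤ a → ∀ t : Set.Icc (0 : ℝ) T, 0 < (t : ℝ) → ∀ x ∈ Set.Icc (-a) a,
    ∀ y ∈ Set.Icc (-a) a, |R t x y| ≤
      N * weightE θ lam a t * (a ^ χ * (a ^ (β / 2) + (t : ℝ) ^ (-(β / 2)))) * |y - x| ^ (2 * β)

theorem weightE_pos (θ lam a t : ℝ) : 0 < weightE θ lam a t := Real.exp_pos _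

theorem weightE_mono {θ lam a s t : ℝ} (hθ : 0 ≤ θ) (hlam : 0 ≤ lam) (ha : 0 ≤ a) (hst : s ≤ t) :
    weightE θ lam a s ≤ weightE θ lam a t := by
  unfold weightE
  gcongr

theorem weightQInv_pos {β χ a t : ℝ} (ha : 1 ≤ a) (ht : 0 < t) : 0 < weightQInv β χ a t := by
  have ha' : 0 < a := by linarith
  unfold weightQInv
  rw [if_neg ht.ne']
  positivity

theorem weightedBd_of_dblNorm_le {T β θ lam N : ℝ} {f : Set.Icc (0 : ℝ) T → ℝ → ℝ} (hN : 0 ≤ N)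
    (h : ∀ t a, 1 ≤ a → dblNorm β f t a ≤ ENNReal.ofReal (N * weightE θ lam a t)) :
    WeightedBd β θ lam f N := by
  have h0 : ∀ a (t : ℝ), 0 ≤ N * weightE θ lam a t := fun a t => mul_nonneg hN (weightE_pos _ _ _ _).le
  constructor
  · intro a ha t x hx
    exact (supNormOn_le_iff (h0 a t)).1 (le_trans le_self_add (h t a ha)) t le_rfl x hx
  · intro a ha s t hst x hx y hy
    have ha0 : 0 < a := by linarith
    have h1 := le_ofReal_div_of_ofReal_mul_le (Real.rpow_pos_of_pos ha0 _)
      (le_trans le_add_self (h t a ha))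
    rw [Real.rpow_neg ha0.le, div_inv_eq_mul] at h1
    by_cases hne : (s, x) = (t, y)
    · obtain ⟨rfl, rfl⟩ := Prod.mk.inj hne
      have := h0 a s
      simp only [sub_self, abs_zero]
      positivity
    · exact (parHolderOn_le_iff (mul_nonneg (h0 a t) (by positivity))).1 h1 s hst x hx t le_rfl y hy hne

/-- The norm at time `t` sees all earlier times, so the bounds, weighted at the later of their two
times, are transferred to `t` by monotonicity of the weight. The factor `2` counts the supremum and
the Hölder part. -/
theorem dblNorm_le_of_weightedBd {T β θ lam N : ℝ} {f : Set.Icc (0 : ℝ) T → ℝ → ℝ} (hN : 0 ≤ N)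
    (hθ : 0 ≤ θ) (hlam : 0 ≤ lam)
    (h : WeightedBd β θ lam f N) (t : Set.Icc (0 : ℝ) T) {a : ℝ} (ha : 1 ≤ a) :
    dblNorm β f t a ≤ ENNReal.ofReal (2 * N * weightE θ lam a t) := by
  have h0 : 0 ≤ N * weightE θ lam a t := mul_nonneg hN (weightE_pos _ _ _ _).le
  have ha0 : 0 < a := by linarith
  have hE : ∀ s : Set.Icc (0 : ℝ) T, s ≤ t → weightE θ lam a s ≤ weightE θ lam a t :=
    fun s hs => weightE_mono hθ hlam ha0.le hs
  have h1 : supNormOn f t a ≤ ENNReal.ofReal (N * weightE θ lam a t) :=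
    (supNormOn_le_iff h0).2 fun s hs x hx => (h.sup a ha s x hx).trans
      (mul_le_mul_of_nonneg_left (hE s hs) hN)
  have h2 : parHolderOn β f t a ≤ ENNReal.ofReal (N * weightE θ lam a t * a ^ (β / 2)) := by
    refine (parHolderOn_le_iff (by positivity)).2 fun s hs x hx s' hs' x' hx' _ => ?_
    rcases le_total s s' with hss | hss
    · refine (h.hol a ha s s' hss x hx x' hx').trans ?_
      gcongr
      exact hE s' hs'
    · rw [abs_sub_comm, abs_sub_comm (s' : ℝ), abs_sub_comm x']
      refine (h.hol a ha s' s hss x' hx' x hx).trans ?_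
      gcongr
      exact hE s hs
  unfold dblNorm
  calc _ ≤ ENNReal.ofReal (N * weightE θ lam a t) + ENNReal.ofReal (a ^ (-(β / 2)))
        * ENNReal.ofReal (N * weightE θ lam a t * a ^ (β / 2)) := by gcongr
    _ = _ := by
        rw [← ENNReal.ofReal_mul (by positivity), ← ENNReal.ofReal_add h0 (by positivity),
          Real.rpow_neg ha0.le]
        congr 1
        have : a ^ (β / 2) ≠ 0 := by positivity
        field_simp
        ring

section
variable {T α β χ θ lam : ℝ} {W : ℝ → ℝ} {V : CPair T} {N : ℝ}

theorem terms_le_of_Theta_le (hN : Theta α β χ θ lam W V ≤ ENNReal.ofReal N)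
    (t : Set.Icc (0 : ℝ) T) {a : ℝ} (ha : 1 ≤ a) :
    dblNorm β V.1 t a
      + ENNReal.ofReal (lam ^ (-((α - β) / 4))) * dblNorm β V.2 t a
      + ENNReal.ofReal (lam ^ (-((α - β) / 4))) * ENNReal.ofReal (weightQInv β χ a t)
          * incrNorm (remainder W V t) (2 * β) a ≤ ENNReal.ofReal (N * weightE θ lam a t) := by
  have h1 : thetaAt α β χ θ lam W V t a ≤ ENNReal.ofReal N :=
    le_trans (le_iSup_of_le t (le_iSup₂_of_le
      (f := fun (a : ℝ) (_ : 1 ≤ a) => thetaAt α β χ θ lam W V t a) a ha le_rfl)) hN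
  have := le_ofReal_div_of_ofReal_mul_le (inv_pos.2 (weightE_pos θ lam a t)) h1
  rwa [div_inv_eq_mul] at this

theorem weightedBd_fst (hN0 : 0 ≤ N)
    (hN : Theta α β χ θ lam W V ≤ ENNReal.ofReal N) : WeightedBd β θ lam V.1 N :=
  weightedBd_of_dblNorm_le hN0 fun t _ ha =>
    le_trans (le_trans le_self_add le_self_add) (terms_le_of_Theta_le hN t ha)

/-- The factor `λ^(-γ)` in `Θ` moves to the other side: the derivative, and likewise the remainder,
may be larger than `v` by `λ^γ`. The time integration has to win this loss back. -/
theorem weightedBd_snd (hlam : 0 < lam) (hN0 : 0 ≤ N)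
    (hN : Theta α β χ θ lam W V ≤ ENNReal.ofReal N) :
    WeightedBd β θ lam V.2 (N * lam ^ ((α - β) / 4)) := by
  refine weightedBd_of_dblNorm_le (by positivity) fun t a ha => ?_
  have h1 := le_ofReal_div_of_ofReal_mul_le (Real.rpow_pos_of_pos hlam _)
    (le_trans (le_trans le_add_self le_self_add) (terms_le_of_Theta_le hN t ha))
  rw [Real.rpow_neg hlam.le, div_inv_eq_mul] at h1
  convert h1 using 2
  ring

theorem weightedRem_of_Theta_le (hlam : 0 < lam) (hN0 : 0 ≤ N)
    (hN : Theta α β χ θ lam W V ≤ ENNReal.ofReal N) :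
    WeightedRem β χ θ lam (remainder W V) (N * lam ^ ((α - β) / 4)) := by
  intro a ha t ht x hx y hy
  have ha0 : 0 < a := by linarith
  have h1 := le_trans le_add_self (terms_le_of_Theta_le hN t ha)
  rw [mul_assoc] at h1
  have h2 := le_ofReal_div_of_ofReal_mul_le (weightQInv_pos (β := β) (χ := χ) ha ht)
    (le_ofReal_div_of_ofReal_mul_le (Real.rpow_pos_of_pos hlam _) h1)
  rw [Real.rpow_neg hlam.le, div_inv_eq_mul, weightQInv, if_neg ht.ne', div_inv_eq_mul] at h2
  have hE := weightE_pos θ lam a t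
  by_cases hne : x = y
  · subst hne
    simp only [remainder, sub_self, mul_zero, abs_zero]
    positivity
  · refine ((incrNorm_le_iff (by positivity)).1 h2 x hx y hy hne).trans (le_of_eq ?_)
    ring

theorem Theta_le_of_bounds (hθ : 0 ≤ θ) (hlam : 0 < lam) (hN0 : 0 ≤ N)
    (h1 : WeightedBd β θ lam V.1 N) (h2 : WeightedBd β θ lam V.2 (N * lam ^ ((α - β) / 4)))
    (h3 : WeightedRem β χ θ lam (remainder W V) (N * lam ^ ((α - β) / 4))) :
    Theta α β χ θ lam W V ≤ ENNReal.ofReal (5 * N) := by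
  unfold Theta
  refine iSup_le fun t => iSup₂_le fun a ha => ?_
  have ha0 : 0 < a := by linarith
  have hE := weightE_pos θ lam a t
  set L := lam ^ ((α - β) / 4) with hL
  have hL0 : 0 < L := Real.rpow_pos_of_pos hlam _
  have hLi : lam ^ (-((α - β) / 4)) = L⁻¹ := Real.rpow_neg hlam.le _
  have b1 := dblNorm_le_of_weightedBd hN0 hθ hlam.le h1 t ha
  have b2 := dblNorm_le_of_weightedBd (by positivity) hθ hlam.le h2 t ha
  have b3 : ENNReal.ofReal (weightQInv β χ a t) * incrNorm (remainder W V t) (2 * β) a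
      ≤ ENNReal.ofReal (N * L * weightE θ lam a t) := by
    rcases t.2.1.eq_or_lt with ht | ht
    -- At time `0` the weight is `0`, which annihilates the remainder norm even where that norm is
    -- infinite.
    · simp [weightQInv, ← ht]
    · have hq : 0 < a ^ χ * (a ^ (β / 2) + (t : ℝ) ^ (-(β / 2))) := by positivity
      have : incrNorm (remainder W V t) (2 * β) a ≤ ENNReal.ofReal
          (N * L * weightE θ lam a t * (a ^ χ * (a ^ (β / 2) + (t : ℝ) ^ (-(β / 2))))) :=
        (incrNorm_le_iff (by positivity)).2 fun x hx y hy _ => h3 a ha t ht x hx y hy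
      refine (mul_le_mul_right this _).trans (le_of_eq ?_)
      rw [← ENNReal.ofReal_mul (weightQInv_pos ha ht).le, weightQInv, if_neg ht.ne']
      congr 1
      field_simp
  unfold thetaAt
  rw [hLi, mul_assoc (ENNReal.ofReal L⁻¹)]
  calc _ ≤ ENNReal.ofReal (weightE θ lam a t)⁻¹ * (ENNReal.ofReal (2 * N * weightE θ lam a t)
        + ENNReal.ofReal L⁻¹ * ENNReal.ofReal (2 * (N * L) * weightE θ lam a t)
        + ENNReal.ofReal L⁻¹ * ENNReal.ofReal (N * L * weightE θ lam a t)) := by gcongr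
    _ = _ := by
        rw [← ENNReal.ofReal_mul (by positivity), ← ENNReal.ofReal_mul (by positivity),
          ← ENNReal.ofReal_add (by positivity) (by positivity),
          ← ENNReal.ofReal_add (by positivity) (by positivity),
          ← ENNReal.ofReal_mul (by positivity)]
        congr 1
        field_simp
        ring

end

/-! ### Bounds on the path -/

/-- Hölder bounds with growth for a path and its second level. -/
structure PathBd (α χ : ℝ) (W : ℝ → ℝ) (K : ℝ) : Prop where
  nonneg : 0 ≤ K
  one : ∀ a, 1 ≤ a → ∀ x ∈ Set.Icc (-a) a, ∀ y ∈ Set.Icc (-a) a,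
    |roughOne W x y| ≤ K * a ^ χ * |y - x| ^ α
  two : ∀ a, 1 ≤ a → ∀ x ∈ Set.Icc (-a) a, ∀ y ∈ Set.Icc (-a) a,
    |roughTwo W x y| ≤ K * a ^ (2 * χ) * |y - x| ^ (2 * α)

theorem incr_le_of_div_le {F : ℝ → ℝ → ℝ} {r a c K : ℝ} (hc : 0 < c) (hK : 0 ≤ K)
    (hF : ∀ x, F x x = 0) (h : incrNorm F r a / ENNReal.ofReal c ≤ ENNReal.ofReal K) :
    ∀ x ∈ Set.Icc (-a) a, ∀ y ∈ Set.Icc (-a) a, |F x y| ≤ K * c * |y - x| ^ r := by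
  intro x hx y hy
  rw [ENNReal.div_le_iff (by simpa using hc) ENNReal.ofReal_ne_top,
    ← ENNReal.ofReal_mul hK] at h
  by_cases hne : x = y
  · subst hne
    rw [hF, abs_zero]
    positivity
  · exact (incrNorm_le_iff (by positivity)).1 h x hx y hy hne

theorem pathBd_of_kappa {α χ : ℝ} {W : ℝ → ℝ} (h : kappa α χ W < ∞) :
    PathBd α χ W (kappa α χ W).toReal := by
  have hk : ∀ a, 1 ≤ a → incrNorm (roughOne W) α a / ENNReal.ofReal (a ^ χ)
      + incrNorm (roughTwo W) (2 * α) a / ENNReal.ofReal (a ^ (2 * χ))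
      ≤ ENNReal.ofReal (kappa α χ W).toReal := by
    intro a ha
    rw [ENNReal.ofReal_toReal h.ne]
    exact le_iSup₂_of_le (f := fun (a : ℝ) (_ : 1 ≤ a) =>
      incrNorm (roughOne W) α a / ENNReal.ofReal (a ^ χ)
      + incrNorm (roughTwo W) (2 * α) a / ENNReal.ofReal (a ^ (2 * χ))) a ha le_rfl
  refine ⟨ENNReal.toReal_nonneg, fun a ha => ?_, fun a ha => ?_⟩
  · exact incr_le_of_div_le (Real.rpow_pos_of_pos (by linarith) _) ENNReal.toReal_nonneg
      (fun x => by simp [roughOne]) (le_trans le_self_add (hk a ha))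
  · exact incr_le_of_div_le (Real.rpow_pos_of_pos (by linarith) _) ENNReal.toReal_nonneg
      (fun x => by simp [roughTwo]) (le_trans le_add_self (hk a ha))

theorem PathBd.continuous {α χ K : ℝ} {W : ℝ → ℝ} (h : PathBd α χ W K) (hα : 0 < α) :
    Continuous W := by
  rw [continuous_iff_continuousAt]
  intro x
  set a := |x| + 1
  have ha : 1 ≤ a := by simp [a]
  have ht : Filter.Tendsto (fun y => K * a ^ χ * |y - x| ^ α) (nhds x) (nhds 0) := by
    have : ContinuousAt (fun y => K * a ^ χ * |y - x| ^ α) x := by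
      have : Continuous (fun y => K * a ^ χ * |y - x| ^ α) :=
        continuous_const.mul ((continuous_id.sub continuous_const).abs.rpow_const
          fun _ => Or.inr hα.le)
      exact this.continuousAt
    simpa [ContinuousAt, Real.zero_rpow hα.ne'] using this
  rw [ContinuousAt, tendsto_iff_dist_tendsto_zero]
  refine squeeze_zero' (Filter.Eventually.of_forall fun _ => dist_nonneg) ?_ ht
  filter_upwards [Metric.ball_mem_nhds x one_pos] with y hy
  rw [Metric.mem_ball, Real.dist_eq] at hy
  rw [Real.dist_eq]
  have hx : x ∈ Set.Icc (-a) a := by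
    constructor <;> simp only [a] <;> linarith [neg_abs_le x, le_abs_self x]
  have hy : y ∈ Set.Icc (-a) a := by
    rw [abs_lt] at hy
    constructor <;> simp only [a] <;> linarith [neg_abs_le x, le_abs_self x]
  exact h.one a ha x hx y hy

/-! ### Definiteness and completeness -/

theorem mem_Icc_abs_add_one (x : ℝ) : x ∈ Set.Icc (-(|x| + 1)) (|x| + 1) :=
  ⟨by linarith [neg_abs_le x], by linarith [le_abs_self x]⟩

theorem eq_zero_of_Theta_eq_zero {T α β χ θ lam : ℝ} {W : ℝ → ℝ} {V : CPair T}
    (hlam : 0 < lam) (h : Theta α β χ θ lam W V = 0) : V = 0 := by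
  have h' : Theta α β χ θ lam W V ≤ ENNReal.ofReal 0 := by rw [h, ENNReal.ofReal_zero]
  refine Prod.ext (funext₂ fun t x => ?_) (funext₂ fun t x => ?_)
  · have := (weightedBd_fst le_rfl h').sup (|x| + 1) (by simp) t x (mem_Icc_abs_add_one x)
    simpa using this
  · have := (weightedBd_snd hlam le_rfl h').sup (|x| + 1) (by simp) t x (mem_Icc_abs_add_one x)
    simpa using this

theorem lowerSemicontinuous_const_mul {X : Type*} [TopologicalSpace X] {f : X → ℝ≥0∞}
    (hf : LowerSemicontinuous f) (c : ℝ) :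
    LowerSemicontinuous fun x => ENNReal.ofReal c * f x :=
  (ENNReal.continuous_const_mul ENNReal.ofReal_ne_top).comp_lowerSemicontinuous hf
    fun _ _ h => mul_le_mul_right h _

/-- Each quotient inside `Θ` depends continuously on finitely many values of the pair; suprema, sums
and nonnegative multiples keep lower semicontinuity. The sublevel sets are thus closed under
pointwise limits. -/
theorem lowerSemicontinuous_Theta {T : ℝ} (α β χ θ lam : ℝ) (W : ℝ → ℝ) :
    LowerSemicontinuous (fun V : CPair T => Theta α β χ θ lam W V) := by
  have ev1 : ∀ (s : Set.Icc (0 : ℝ) T) (x : ℝ), Continuous fun V : CPair T => V.1 s x :=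
    fun s x => (continuous_apply x).comp ((continuous_apply s).comp continuous_fst)
  have ev2 : ∀ (s : Set.Icc (0 : ℝ) T) (x : ℝ), Continuous fun V : CPair T => V.2 s x :=
    fun s x => (continuous_apply x).comp ((continuous_apply s).comp continuous_snd)
  have dbl : ∀ (t : Set.Icc (0 : ℝ) T) (a : ℝ) (g : CPair T → Set.Icc (0 : ℝ) T → ℝ → ℝ),
      (∀ s x, Continuous fun V => g V s x) →
      LowerSemicontinuous fun V : CPair T => dblNorm β (g V) t a := by
    intro t a g hg
    refine LowerSemicontinuous.add ?_ (lowerSemicontinuous_const_mul ?_ _)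
    · refine lowerSemicontinuous_biSup fun s _ => lowerSemicontinuous_biSup fun x _ => ?_
      exact (ENNReal.continuous_ofReal.comp (hg s x).abs).lowerSemicontinuous
    · refine lowerSemicontinuous_biSup fun p _ => lowerSemicontinuous_biSup fun q _ =>
        lowerSemicontinuous_iSup fun _ => ?_
      exact (ENNReal.continuous_ofReal.comp
        (((hg q.1 q.2).sub (hg p.1 p.2)).abs.div_const _)).lowerSemicontinuous
  unfold Theta
  refine lowerSemicontinuous_iSup fun t => lowerSemicontinuous_biSup fun a _ => ?_
  unfold thetaAt
  refine lowerSemicontinuous_const_mul (LowerSemicontinuous.add (LowerSemicontinuous.add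
    (dbl t a _ ev1) (lowerSemicontinuous_const_mul (dbl t a _ ev2) _)) ?_) _
  simp only [mul_assoc]
  refine lowerSemicontinuous_const_mul (lowerSemicontinuous_const_mul ?_ _) _
  refine lowerSemicontinuous_biSup fun x _ => lowerSemicontinuous_biSup fun y _ =>
    lowerSemicontinuous_iSup fun _ => ?_
  refine (ENNReal.continuous_ofReal.comp (Continuous.div_const (Continuous.abs ?_) _)).lowerSemicontinuous
  exact ((ev1 t y).sub (ev1 t x)).sub ((ev2 t x).mul continuous_const)

theorem exists_limit_of_Theta_cauchy {T α β χ θ lam : ℝ} {W : ℝ → ℝ} (hlam : 0 < lam)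
    (u : ℕ → spaceB T α β χ θ lam W)
    (hu : ∀ ε : ℝ≥0∞, 0 < ε → ∃ N, ∀ m ≥ N, ∀ n ≥ N,
      Theta α β χ θ lam W ((u m : CPair T) - (u n : CPair T)) ≤ ε) :
    ∃ V : spaceB T α β χ θ lam W, Filter.Tendsto
      (fun n => Theta α β χ θ lam W ((u n : CPair T) - (V : CPair T))) Filter.atTop (nhds 0) := by
  have small : ∀ (x : ℝ) (t : Set.Icc (0 : ℝ) T), ∀ ε > 0, ∃ N, ∀ m ≥ N, ∀ n ≥ N,
      |(u m : CPair T).1 t x - (u n : CPair T).1 t x| < ε ∧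
      |(u m : CPair T).2 t x - (u n : CPair T).2 t x| < ε := by
    intro x t ε hε
    have hE := weightE_pos θ lam (|x| + 1) t
    have hL : 0 < lam ^ ((α - β) / 4) := Real.rpow_pos_of_pos hlam _
    -- A `Θ`-distance of at most `δ` bounds the two components at `(t, x)` by `δ E` and `δ E λ^γ`;
    -- both are below `ε` for this `δ`.
    set δ := ε / (2 * weightE θ lam (|x| + 1) t * (1 + lam ^ ((α - β) / 4))) with hδ
    have hδ0 : 0 < δ := by positivity
    have hδe : δ * weightE θ lam (|x| + 1) t * (1 + lam ^ ((α - β) / 4)) = ε / 2 := by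
      rw [hδ]; field_simp
    obtain ⟨N, hN⟩ := hu (ENNReal.ofReal δ) (by simpa using hδ0)
    refine ⟨N, fun m hm n hn => ?_⟩
    have h1 := (weightedBd_fst hδ0.le (hN m hm n hn)).sup (|x| + 1) (by simp) t x
      (mem_Icc_abs_add_one x)
    have h2 := (weightedBd_snd hlam hδ0.le (hN m hm n hn)).sup (|x| + 1) (by simp) t x
      (mem_Icc_abs_add_one x)
    simp only [Prod.fst_sub, Prod.snd_sub, Pi.sub_apply] at h1 h2
    have := mul_pos (mul_pos hδ0 hE) hL
    have := mul_pos hδ0 hE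
    constructor
    · refine h1.trans_lt ?_; nlinarith
    · refine h2.trans_lt ?_; nlinarith
  have c1 : ∀ t x, ∃ l, Filter.Tendsto (fun n => (u n : CPair T).1 t x) Filter.atTop (nhds l) := by
    refine fun t x => cauchySeq_tendsto_of_complete (Metric.cauchySeq_iff.2 fun ε hε => ?_)
    obtain ⟨N, hN⟩ := small x t ε hε
    exact ⟨N, fun m hm n hn => (hN m hm n hn).1⟩
  have c2 : ∀ t x, ∃ l, Filter.Tendsto (fun n => (u n : CPair T).2 t x) Filter.atTop (nhds l) := by
    refine fun t x => cauchySeq_tendsto_of_complete (Metric.cauchySeq_iff.2 fun ε hε => ?_)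
    obtain ⟨N, hN⟩ := small x t ε hε
    exact ⟨N, fun m hm n hn => (hN m hm n hn).2⟩
  choose l1 hl1 using c1
  choose l2 hl2 using c2
  set V : CPair T := (l1, l2) with hV
  have hlim : Filter.Tendsto (fun n => (u n : CPair T)) Filter.atTop (nhds V) :=
    Filter.Tendsto.prodMk_nhds (tendsto_pi_nhds.2 fun t => tendsto_pi_nhds.2 (hl1 t))
      (tendsto_pi_nhds.2 fun t => tendsto_pi_nhds.2 (hl2 t))
  have hbound : ∀ ε : ℝ≥0∞, 0 < ε → ∃ N, ∀ n ≥ N,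
      Theta α β χ θ lam W ((u n : CPair T) - V) ≤ ε := by
    intro ε hε
    obtain ⟨N, hN⟩ := hu ε hε
    refine ⟨N, fun n hn => ?_⟩
    -- For fixed `n` the bound on `u n - u m` survives the pointwise limit `m → ∞`.
    have hcl := (lowerSemicontinuous_Theta (T := T) α β χ θ lam W).isClosed_preimage ε
    refine hcl.mem_of_tendsto (tendsto_const_nhds.sub hlim) ?_
    filter_upwards [Filter.eventually_ge_atTop N] with m hm
    exact hN n hn m hm
  have hVm : V ∈ spaceB T α β χ θ lam W := by
    obtain ⟨N, hN⟩ := hbound 1 one_pos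
    have h1 : (u N : CPair T) - V ∈ spaceB T α β χ θ lam W :=
      lt_of_le_of_lt (hN N le_rfl) ENNReal.one_lt_top
    have := (spaceB T α β χ θ lam W).sub_mem (u N).2 h1
    simpa using this
  refine ⟨⟨V, hVm⟩, ENNReal.tendsto_atTop_zero.2 fun ε hε => ?_⟩
  exact hbound ε hε

/-! ### The rough integral -/

/-- The germ of the rough integral. -/
def germ (W v v' : ℝ → ℝ) (x y : ℝ) : ℝ := v x * roughOne W x y + v' x * roughTwo W x y

theorem germ_self (W v v' : ℝ → ℝ) (z : ℝ) : germ W v v' z z = 0 := by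
  simp [germ, roughOne, roughTwo]

/-- Chen's relation `W²(x,y) = W²(x,u) + W²(u,y) + W¹(x,u) W¹(u,y)`: its cross term turns the
increment of `v` into the remainder. -/
theorem germ_defect (W v v' : ℝ → ℝ) (x u y : ℝ) :
    germ W v v' x y - germ W v v' x u - germ W v v' u y =
      -((v u - v x - v' x * (W u - W x)) * roughOne W u y) - (v' u - v' x) * roughTwo W u y := by
  simp only [germ, roughOne, roughTwo]; ring

/-- `(v, v')` is controlled by `W` on `[p, q]`. -/
structure ControlledOn (α β : ℝ) (W v v' : ℝ → ℝ) (p q R H K₁ K₂ : ℝ) : Prop where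
  R_nonneg : 0 ≤ R
  H_nonneg : 0 ≤ H
  K₁_nonneg : 0 ≤ K₁
  K₂_nonneg : 0 ≤ K₂
  rem : ∀ x ∈ Set.Icc p q, ∀ y ∈ Set.Icc p q,
    |v y - v x - v' x * (W y - W x)| ≤ R * |y - x| ^ (2 * β)
  der : ∀ x ∈ Set.Icc p q, ∀ y ∈ Set.Icc p q, |v' y - v' x| ≤ H * |y - x| ^ β
  one : ∀ x ∈ Set.Icc p q, ∀ y ∈ Set.Icc p q, |roughOne W x y| ≤ K₁ * |y - x| ^ α
  two : ∀ x ∈ Set.Icc p q, ∀ y ∈ Set.Icc p q, |roughTwo W x y| ≤ K₂ * |y - x| ^ (2 * α)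

section
variable {α β : ℝ} {W v v' : ℝ → ℝ} {p q R H K₁ K₂ : ℝ}

/-- The remainder against `W¹` has order `2β + α`. The derivative increment against `W²` has the
higher order `β + 2α`, whose excess `α - β` goes into the length of the interval. No order of the
three points is assumed, so that the triple `x, y, x` is allowed; it is needed to reverse
orientation. -/
theorem ControlledOn.defect_le (h : ControlledOn α β W v v' p q R H K₁ K₂) (hβ : 0 < β)
    (hβα : β < α) {x u y L : ℝ} (hx : x ∈ Set.Icc p q) (hu : u ∈ Set.Icc p q)
    (hy : y ∈ Set.Icc p q) (h1 : |u - x| ≤ L) (h2 : |y - u| ≤ L) (hL : L ≤ q - p) :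
    |germ W v v' x y - germ W v v' x u - germ W v v' u y|
      ≤ (R * K₁ + H * K₂ * (q - p) ^ (α - β)) * L ^ (2 * β + α) := by
  have hL0 : 0 ≤ L := (abs_nonneg _).trans h1
  have := h.R_nonneg
  have := h.H_nonneg
  have := h.K₁_nonneg
  have := h.K₂_nonneg
  rw [germ_defect]
  have e1 : |(v u - v x - v' x * (W u - W x)) * roughOne W u y|
      ≤ R * K₁ * L ^ (2 * β + α) := by
    rw [abs_mul, Real.rpow_add_of_nonneg hL0 (by linarith) (by linarith)]
    calc _ ≤ (R * |u - x| ^ (2 * β)) * (K₁ * |y - u| ^ α) :=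
          mul_le_mul (h.rem x hx u hu) (h.one u hu y hy) (abs_nonneg _) (by positivity)
      _ ≤ (R * L ^ (2 * β)) * (K₁ * L ^ α) := by gcongr; linarith
      _ = _ := by ring
  have e2 : |(v' u - v' x) * roughTwo W u y|
      ≤ H * K₂ * (q - p) ^ (α - β) * L ^ (2 * β + α) := by
    rw [abs_mul]
    calc _ ≤ (H * |u - x| ^ β) * (K₂ * |y - u| ^ (2 * α)) :=
          mul_le_mul (h.der x hx u hu) (h.two u hu y hy) (abs_nonneg _) (by positivity)
      _ ≤ (H * L ^ β) * (K₂ * L ^ (2 * α)) := by gcongr; linarith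
      _ = H * K₂ * (L ^ β * L ^ (2 * α)) := by ring
      _ = H * K₂ * (L ^ (α - β) * L ^ (2 * β + α)) := by
          rw [← Real.rpow_add_of_nonneg hL0 (by linarith) (by linarith),
            ← Real.rpow_add_of_nonneg hL0 (by linarith) (by linarith)]
          ring_nf
      _ ≤ H * K₂ * ((q - p) ^ (α - β) * L ^ (2 * β + α)) := by gcongr
      _ = _ := by ring
  calc _ ≤ |(v u - v x - v' x * (W u - W x)) * roughOne W u y|
        + |(v' u - v' x) * roughTwo W u y| := by
        rw [← abs_neg ((v u - v x - v' x * (W u - W x)) * roughOne W u y)]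
        exact abs_sub _ _
    _ ≤ _ := by rw [add_mul]; exact add_le_add e1 e2

theorem ControlledOn.almostAdditive (h : ControlledOn α β W v v' p q R H K₁ K₂) (hβ : 1 / 3 < β)
    (hβα : β < α) (hpq : p ≤ q) : AlmostAdditive (germ W v v') p q
      (R * K₁ + H * K₂ * (q - p) ^ (α - β)) (2 * β + α) where
  -- This is where `β > 1/3` makes sewing possible.
  one_lt := by linarith
  nonneg := by
    have := h.R_nonneg
    have := h.H_nonneg
    have := h.K₁_nonneg
    have := h.K₂_nonneg
    have : 0 ≤ q - p := by linarith
    positivity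
  diag := germ_self W v v'
  defect x u y hx hxu huy hy := by
    refine h.defect_le (by linarith) hβα ⟨hx, by linarith⟩ ⟨by linarith, by linarith⟩
      ⟨by linarith, hy⟩ ?_ ?_ (by linarith)
    · rw [abs_of_nonneg (by linarith)]; linarith
    · rw [abs_of_nonneg (by linarith)]; linarith

theorem ControlledOn.exists_roughIntegral (hβ : 1 / 3 < β) (hβα : β < α) (x y : ℝ)
    (h : ControlledOn α β W v v' (min x y) (max x y) R H K₁ K₂) :
    ∃ I, HasRoughIntegral W v v' x y I ∧ |I - germ W v v' x y| ≤ (sewConst (2 * β + α) + 1)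
      * (R * K₁ + H * K₂ * |y - x| ^ (α - β)) * |y - x| ^ (2 * β + α) := by
  have hmm : max x y - min x y = |y - x| := by rw [max_sub_min_eq_abs]
  have hA := h.almostAdditive hβ hβα min_le_max
  have hpos : 0 ≤ (R * K₁ + H * K₂ * |y - x| ^ (α - β)) * |y - x| ^ (2 * β + α) := by
    have := hA.nonneg
    rw [hmm] at this
    positivity
  obtain ⟨I, hI, hb⟩ := hA.exists_sewLimit min_le_max
  rw [hmm] at hb
  rcases le_or_gt x y with hxy | hxy
  · rw [min_eq_left hxy, max_eq_right hxy] at hI hb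
    refine ⟨I, Or.inl ⟨hxy, hI⟩, hb.trans ?_⟩
    nlinarith
  -- The germ is not antisymmetric, but `germ x y + germ y x` is, up to sign, the defect of the
  -- triple `x, y, x`. This accounts for the `+ 1` next to the sewing constant.
  · have hd := h.defect_le (x := x) (u := y) (y := x) (L := |y - x|) (by linarith) hβα
      ⟨min_le_left _ _, le_max_left _ _⟩ ⟨min_le_right _ _, le_max_right _ _⟩
      ⟨min_le_left _ _, le_max_left _ _⟩ le_rfl (by rw [abs_sub_comm]) (by rw [hmm])
    rw [hmm, germ_self] at hd
    rw [min_eq_right hxy.le, max_eq_left hxy.le] at hI hb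
    refine ⟨-I, Or.inr ⟨hxy, by rwa [neg_neg]⟩, ?_⟩
    rw [abs_le] at *
    constructor <;> nlinarith [hd.1, hd.2, hb.1, hb.2]

end

/-! ### Uniqueness, additivity and linearity of the rough integral -/

section
variable {W v v' : ℝ → ℝ}

theorem HasRoughIntegral.unique {x y I J : ℝ} (hI : HasRoughIntegral W v v' x y I)
    (hJ : HasRoughIntegral W v v' x y J) : I = J := by
  rcases hI with ⟨h, hI⟩ | ⟨h, hI⟩ <;> rcases hJ with ⟨h', hJ⟩ | ⟨h', hJ⟩
  · exact IsSewLimit.unique (A := germ W v v') hI hJ h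
  · linarith
  · linarith
  · exact neg_injective (IsSewLimit.unique (A := germ W v v') hI hJ h.le)

theorem HasRoughIntegral.eq {x y I : ℝ} (hI : HasRoughIntegral W v v' x y I) :
    roughIntegral W v v' x y = I := by
  have hex : ∃ I, HasRoughIntegral W v v' x y I := ⟨I, hI⟩
  rw [roughIntegral, dif_pos hex]
  exact hex.choose_spec.unique hI

/-- All rough integrals of `(v, v')` exist. -/
def RoughIntegrable (W v v' : ℝ → ℝ) : Prop := ∀ x y, ∃ I, HasRoughIntegral W v v' x y I

theorem RoughIntegrable.has (h : RoughIntegrable W v v') (x y : ℝ) :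
    HasRoughIntegral W v v' x y (roughIntegral W v v' x y) := by
  obtain ⟨I, hI⟩ := h x y
  rwa [hI.eq]

theorem RoughIntegrable.isSewLimit (h : RoughIntegrable W v v') {x y : ℝ} (hxy : x ≤ y) :
    IsSewLimit (germ W v v') x y (roughIntegral W v v' x y) := by
  rcases h.has x y with ⟨_, h⟩ | ⟨h', _⟩
  · exact h
  · linarith

theorem RoughIntegrable.antisymm (h : RoughIntegrable W v v') (x y : ℝ) :
    roughIntegral W v v' y x = -roughIntegral W v v' x y := by
  have key : ∀ a b, a < b → roughIntegral W v v' b a = -roughIntegral W v v' a b := by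
    intro a b hab
    rcases h.has b a with ⟨h', _⟩ | ⟨_, h'⟩
    · linarith
    · have := IsSewLimit.unique (A := germ W v v') h' (h.isSewLimit hab.le) hab.le
      linarith
  rcases lt_trichotomy x y with hxy | rfl | hxy
  · exact key x y hxy
  -- On the degenerate interval additivity reads `I = I + I`.
  · have := (h.isSewLimit le_rfl).add (h.isSewLimit le_rfl) (h.isSewLimit (le_refl x)) le_rfl le_rfl
    linarith
  · rw [key y x hxy, neg_neg]

theorem RoughIntegrable.chain (h : RoughIntegrable W v v') (x y z : ℝ) :
    roughIntegral W v v' x z = roughIntegral W v v' x y + roughIntegral W v v' y z := by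
  have key : ∀ a b c, a ≤ b → b ≤ c →
      roughIntegral W v v' a c = roughIntegral W v v' a b + roughIntegral W v v' b c :=
    fun a b c hab hbc => (h.isSewLimit hab).add (h.isSewLimit hbc) (h.isSewLimit (hab.trans hbc))
      hab hbc
  have a1 := h.antisymm x y
  have a2 := h.antisymm y z
  have a3 := h.antisymm x z
  rcases le_total x y with h1 | h1 <;> rcases le_total y z with h2 | h2 <;>
    rcases le_total x z with h3 | h3
  · exact key _ _ _ h1 h2
  · linarith [key _ _ _ h1 h2, key _ _ _ h2 h3, key _ _ _ h3 h1]
  · linarith [key _ _ _ h3 h2]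
  · linarith [key _ _ _ h3 h1]
  · linarith [key _ _ _ h1 h3]
  · linarith [key _ _ _ h2 h3]
  · linarith [key _ _ _ h1 h3, key _ _ _ h3 h2, key _ _ _ h2 h1]
  · linarith [key _ _ _ h2 h1]

/-- The rough integral is the limit of the Riemann sums over uniform partitions, in both
orientations. -/
def unifSum (W v v' : ℝ → ℝ) (n : ℕ) (x y : ℝ) : ℝ :=
  SignType.sign (y - x) * ∑ i ∈ Finset.range (n + 1),
    germ W v v' (unifPart (min x y) (max x y) n i) (unifPart (min x y) (max x y) n (i + 1))

/-- An explicit approximating sequence that is linear in `(v, v')` and measurable in the endpoint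
and in parameters when the data are continuous. Linearity and measurability of the rough integral
follow by passing to the limit. -/
theorem RoughIntegrable.tendsto_unifSum (h : RoughIntegrable W v v') (x y : ℝ) :
    Filter.Tendsto (fun n => unifSum W v v' n x y) Filter.atTop
      (nhds (roughIntegral W v v' x y)) := by
  unfold unifSum
  rcases lt_trichotomy x y with hxy | rfl | hxy
  · simp only [min_eq_left hxy.le, max_eq_right hxy.le, sign_pos (sub_pos.2 hxy), SignType.coe_one,
      one_mul]
    exact (h.isSewLimit hxy.le).tendsto_unif hxy.le
  · have := h.antisymm x x
    have : roughIntegral W v v' x x = 0 := by linarith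
    simp [this]
  · simp only [min_eq_right hxy.le, max_eq_left hxy.le, sign_neg (sub_neg.2 hxy),
      SignType.coe_neg_one, neg_one_mul]
    rw [h.antisymm y x]
    exact ((h.isSewLimit hxy.le).tendsto_unif hxy.le).neg

theorem RoughIntegrable.integral_add {w w' : ℝ → ℝ} (h : RoughIntegrable W v v')
    (h' : RoughIntegrable W w w') (h'' : RoughIntegrable W (v + w) (v' + w')) (x y : ℝ) :
    roughIntegral W (v + w) (v' + w') x y
      = roughIntegral W v v' x y + roughIntegral W w w' x y := by
  refine tendsto_nhds_unique (h''.tendsto_unifSum x y) ?_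
  refine ((h.tendsto_unifSum x y).add (h'.tendsto_unifSum x y)).congr fun n => ?_
  simp only [unifSum, ← mul_add, ← Finset.sum_add_distrib]
  congr 1
  refine Finset.sum_congr rfl fun i _ => ?_
  simp only [germ, Pi.add_apply]
  ring

theorem RoughIntegrable.integral_smul (h : RoughIntegrable W v v') (c : ℝ)
    (h'' : RoughIntegrable W (c • v) (c • v')) (x y : ℝ) :
    roughIntegral W (c • v) (c • v') x y = c * roughIntegral W v v' x y := by
  refine tendsto_nhds_unique (h''.tendsto_unifSum x y) ?_
  refine ((h.tendsto_unifSum x y).const_mul c).congr fun n => ?_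
  simp only [unifSum]
  rw [mul_left_comm, Finset.mul_sum]
  congr 1
  refine Finset.sum_congr rfl fun i _ => ?_
  simp only [germ, Pi.smul_apply, smul_eq_mul]
  ring

end

/-! ### Weighted bounds on the rough integral -/

theorem add_abs_le_mul_exp {a : ℝ} (ha : 1 ≤ a) (z : ℝ) : a + |z| ≤ a * Real.exp |z| := by
  have h1 := Real.add_one_le_exp |z|
  have := abs_nonneg z
  nlinarith

theorem rpow_add_abs_le {a r : ℝ} (ha : 1 ≤ a) (hr : 0 ≤ r) (hr1 : r ≤ 1) (z : ℝ) :
    (a + |z|) ^ r ≤ a ^ r * Real.exp |z| := by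
  have := abs_nonneg z
  calc (a + |z|) ^ r ≤ (a * Real.exp |z|) ^ r := by
        gcongr
        exact add_abs_le_mul_exp ha z
    _ = a ^ r * Real.exp (|z| * r) := by
        rw [Real.mul_rpow (by linarith) (Real.exp_pos _).le, Real.exp_mul]
    _ ≤ a ^ r * Real.exp |z| := by
        gcongr
        nlinarith

theorem weightE_add_abs_le {θ lam a s T : ℝ} (hθ : 0 ≤ θ) (hsT : s ≤ T) (z : ℝ) :
    weightE θ lam (a + |z|) s ≤ weightE θ lam a s * Real.exp (θ * (1 + T) * |z|) := by
  unfold weightE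
  rw [← Real.exp_add]
  apply Real.exp_le_exp.2
  have : θ * |z| * s ≤ θ * |z| * T := by gcongr
  nlinarith

/-- Exponential rate that dominates all the weights. -/
def growthRate (θ T : ℝ) : ℝ := θ * (1 + T) + 3

section
variable {T α β χ θ lam K N N' : ℝ} {W : ℝ → ℝ} {V : CPair T}

theorem mem_Icc_add_abs {a x : ℝ} (hx : x ∈ Set.Icc (-a) a) (y : ℝ) :
    x ∈ Set.Icc (-(a + |y - x|)) (a + |y - x|) ∧ y ∈ Set.Icc (-(a + |y - x|)) (a + |y - x|) := by
  have h1 := neg_abs_le (y - x)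
  have h2 := le_abs_self (y - x)
  have h3 := abs_nonneg (y - x)
  exact ⟨⟨by linarith [hx.1], by linarith [hx.2]⟩, ⟨by linarith [hx.1], by linarith [hx.2]⟩⟩

theorem PathBd.one_le_exp (hW : PathBd α χ W K) (hχ0 : 0 ≤ χ) (hχ1 : χ ≤ 1) {a x : ℝ}
    (ha : 1 ≤ a) (hx : x ∈ Set.Icc (-a) a) (y : ℝ) :
    |roughOne W x y| ≤ K * a ^ χ * |y - x| ^ α * Real.exp |y - x| := by
  have h := hW.one (a + |y - x|) (by linarith [abs_nonneg (y - x)]) x (mem_Icc_add_abs hx y).1 y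
    (mem_Icc_add_abs hx y).2
  have := hW.nonneg
  calc _ ≤ _ := h
    _ ≤ K * (a ^ χ * Real.exp |y - x|) * |y - x| ^ α := by
        gcongr
        exact rpow_add_abs_le ha hχ0 hχ1 _
    _ = _ := by ring

set_option maxHeartbeats 400000 in
/-- Existence and bounds for the rough integral on the whole line. -/
theorem exists_roughIntegral_bound (hβ : 1 / 3 < β) (hβα : β < α) (hα : α < 1 / 2) (hχ0 : 0 ≤ χ)
    (hχβ : χ < β / 2) (hθ : 0 ≤ θ) (hN' : 0 ≤ N')
    (hW : PathBd α χ W K)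
    (h2 : WeightedBd β θ lam V.2 N') (h3 : WeightedRem β χ θ lam (remainder W V) N')
    (t : Set.Icc (0 : ℝ) T) (ht : 0 < (t : ℝ)) {a x : ℝ} (ha : 1 ≤ a) (hx : x ∈ Set.Icc (-a) a)
    (y : ℝ) :
    ∃ I, HasRoughIntegral W (V.1 t) (V.2 t) x y I ∧
      |I - V.1 t x * roughOne W x y| ≤ 2 * (sewConst (2 * β + α) + 1) * (N' * K)
        * weightE θ lam a t * (a ^ (2 * χ) * |y - x| ^ (2 * α)
          + a ^ (2 * χ) * (a ^ (β / 2) + (t : ℝ) ^ (-(β / 2))) * |y - x| ^ (2 * β + α))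
        * Real.exp (growthRate θ T * |y - x|) := by
  set z := |y - x| with hz
  have hz0 : 0 ≤ z := abs_nonneg _
  -- The window `[-a', a']` contains `x` and `y`. All weights are then brought back from `a'` to `a`
  -- at the price of a factor exponential in `z`, which the Gaussian will absorb.
  set a' := a + z with ha'
  have ha'1 : 1 ≤ a' := by linarith
  have ha0 : 0 < a := by linarith
  have hK := hW.nonneg
  have hE := weightE_pos θ lam a t
  have hE' := weightE_pos θ lam a' t
  have ht0 : 0 ≤ (t : ℝ) := ht.le
  obtain ⟨hxa, hya⟩ := mem_Icc_add_abs hx y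
  have hsub : Set.Icc (min x y) (max x y) ⊆ Set.Icc (-a') a' :=
    Set.Icc_subset_Icc (le_min hxa.1 hya.1) (max_le hxa.2 hya.2)
  have hctrl : ControlledOn α β W (V.1 t) (V.2 t) (min x y) (max x y)
      (N' * weightE θ lam a' t * (a' ^ χ * (a' ^ (β / 2) + (t : ℝ) ^ (-(β / 2)))))
      (N' * weightE θ lam a' t * a' ^ (β / 2)) (K * a' ^ χ) (K * a' ^ (2 * χ)) := by
    refine ⟨by positivity, by positivity, by positivity, by positivity, ?_, ?_, ?_, ?_⟩
    · exact fun x hx y hy => h3 a' ha'1 t ht x (hsub hx) y (hsub hy)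
    · intro x hx y hy
      have := h2.hol a' ha'1 t t le_rfl x (hsub hx) y (hsub hy)
      rwa [sub_self, abs_zero, Real.zero_rpow (by linarith), zero_add] at this
    · exact fun x hx y hy => hW.one a' ha'1 x (hsub hx) y (hsub hy)
    · exact fun x hx y hy => hW.two a' ha'1 x (hsub hx) y (hsub hy)
  obtain ⟨I, hI, hb⟩ := hctrl.exists_roughIntegral hβ hβα x y
  refine ⟨I, hI, ?_⟩
  have hC := sewConst_pos (ζ := 2 * β + α) (by linarith)
  set C := sewConst (2 * β + α) with hCdef
  set e := Real.exp z with he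
  have he1 : 1 ≤ e := Real.one_le_exp hz0
  set S := (t : ℝ) ^ (-(β / 2)) with hS
  have hS0 : 0 ≤ S := by positivity
  have p1 : a' ^ (2 * χ) ≤ a ^ (2 * χ) * e := by
    have := rpow_add_abs_le (r := 2 * χ) ha (by linarith) (by linarith) z
    rwa [abs_of_nonneg hz0] at this
  have p2 : a' ^ (β / 2) ≤ a ^ (β / 2) * e := by
    have := rpow_add_abs_le (r := β / 2) ha (by linarith) (by linarith) z
    rwa [abs_of_nonneg hz0] at this
  have p3 : weightE θ lam a' t ≤ weightE θ lam a t * Real.exp (θ * (1 + T) * z) := by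
    have := weightE_add_abs_le (θ := θ) (lam := lam) (a := a) hθ t.2.2 z
    rwa [abs_of_nonneg hz0] at this
  have p4 : 1 + z ^ (α - β) ≤ 2 * e := by
    have h1 : z ^ (α - β) ≤ 1 + z := by
      rcases le_total z 1 with hz1 | hz1
      · linarith [Real.rpow_le_one hz0 hz1 (by linarith : 0 ≤ α - β)]
      · have := Real.rpow_le_rpow_of_exponent_le hz1 (by linarith : α - β ≤ 1)
        rw [Real.rpow_one] at this
        linarith
    have := Real.add_one_le_exp z
    linarith
  -- The three extra exponentials in `growthRate` serve `a' ^ (2 * χ)`, `a' ^ (β / 2)` and the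
  -- length factor `z ^ (α - β)`.
  have hexp : Real.exp (growthRate θ T * z) = Real.exp (θ * (1 + T) * z) * e * e * e := by
    rw [he, ← Real.exp_add, ← Real.exp_add, ← Real.exp_add, growthRate]; ring_nf
  set X := Real.exp (θ * (1 + T) * z) with hX
  have hX1 : 1 ≤ X := by
    refine Real.one_le_exp ?_
    have : 0 ≤ T := ht0.trans t.2.2
    positivity
  set E := weightE θ lam a t with hEdef
  have hM : N' * weightE θ lam a' t * (a' ^ χ * (a' ^ (β / 2) + S)) * (K * a' ^ χ)
      + N' * weightE θ lam a' t * a' ^ (β / 2) * (K * a' ^ (2 * χ)) * z ^ (α - β)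
      ≤ 2 * (N' * K) * E * (a ^ (2 * χ) * (a ^ (β / 2) + S)) * (X * e * e * e) := by
    have hsq : a' ^ χ * a' ^ χ = a' ^ (2 * χ) := by
      rw [← Real.rpow_add (by linarith)]; ring_nf
    calc _ = N' * K * weightE θ lam a' t * a' ^ (2 * χ)
          * (a' ^ (β / 2) + S + a' ^ (β / 2) * z ^ (α - β)) := by rw [← hsq]; ring
      _ ≤ N' * K * weightE θ lam a' t * a' ^ (2 * χ)
          * ((a' ^ (β / 2) + S) * (1 + z ^ (α - β))) := by
          gcongr
          have : 0 ≤ S * z ^ (α - β) := by positivity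
          nlinarith
      _ ≤ N' * K * (E * X) * (a ^ (2 * χ) * e) * ((a ^ (β / 2) * e + S * e) * (2 * e)) := by
          gcongr
          nlinarith
      _ = _ := by ring
  have hG : |V.2 t x * roughTwo W x y| ≤ N' * K * E * (a ^ (2 * χ) * z ^ (2 * α)) * (X * e * e * e) := by
    rw [abs_mul]
    calc _ ≤ (N' * E) * (K * a' ^ (2 * χ) * z ^ (2 * α)) :=
          mul_le_mul (h2.sup a ha t x hx) (hW.two a' ha'1 x hxa y hya) (abs_nonneg _) (by positivity)
      _ ≤ (N' * E) * (K * (a ^ (2 * χ) * e) * z ^ (2 * α)) := by gcongr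
      _ = N' * K * E * (a ^ (2 * χ) * z ^ (2 * α)) * e := by ring
      _ ≤ N' * K * E * (a ^ (2 * χ) * z ^ (2 * α)) * (X * e * e * e) := by
          gcongr
          have h1 : 1 ≤ X * e * e := one_le_mul_of_one_le_of_one_le
            (one_le_mul_of_one_le_of_one_le hX1 he1) he1
          nlinarith
  clear_value C e S X E
  rw [hexp]
  have hsplit : |I - V.1 t x * roughOne W x y|
      ≤ |I - germ W (V.1 t) (V.2 t) x y| + |V.2 t x * roughTwo W x y| := by
    have : I - V.1 t x * roughOne W x y
      = (I - germ W (V.1 t) (V.2 t) x y) + V.2 t x * roughTwo W x y := by simp only [germ]; ring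
    rw [this]
    exact abs_add_le _ _
  refine hsplit.trans ?_
  have hb' : |I - germ W (V.1 t) (V.2 t) x y| ≤ (C + 1)
      * (2 * (N' * K) * E * (a ^ (2 * χ) * (a ^ (β / 2) + S)) * (X * e * e * e))
      * z ^ (2 * β + α) := by
    refine hb.trans ?_
    gcongr
  have hGpos : 0 ≤ N' * K * E * (a ^ (2 * χ) * z ^ (2 * α)) * (X * e * e * e) := by positivity
  have hG' : |V.2 t x * roughTwo W x y|
      ≤ 2 * (C + 1) * (N' * K * E * (a ^ (2 * χ) * z ^ (2 * α)) * (X * e * e * e)) :=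
    hG.trans (le_mul_of_one_le_left hGpos (by linarith))
  refine (add_le_add hb' hG').trans (le_of_eq ?_)
  ring

end

/-! ### The heat kernel and its derivatives -/

/-- The second space derivative of the heat kernel. -/
def heatKernelXX (σ τ z : ℝ) : ℝ := (z ^ 2 / (σ ^ 2 * τ) ^ 2 - 1 / (σ ^ 2 * τ)) * heatKernel σ τ z

theorem heatKernel_nonneg (σ τ z : ℝ) : 0 ≤ heatKernel σ τ z := by
  unfold heatKernel; positivity

/-- A default value of division by zero, but for `σ > 0` and `z ≠ 0` also the true limit as `τ`
decreases to `0`; the integration in time relies on this. -/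
theorem heatKernel_zero (σ z : ℝ) : heatKernel σ 0 z = 0 := by simp [heatKernel]

theorem hasDerivAt_heatKernel (σ τ z : ℝ) :
    HasDerivAt (heatKernel σ τ) (-(z / (σ ^ 2 * τ)) * heatKernel σ τ z) z := by
  have h1 : HasDerivAt (fun x : ℝ => -(x ^ 2) / (2 * σ ^ 2 * τ)) (-(z / (σ ^ 2 * τ))) z := by
    refine (((hasDerivAt_pow 2 z).neg).div_const (2 * σ ^ 2 * τ)).congr_deriv ?_
    rw [mul_assoc, neg_div, ← mul_div_mul_left z _ (two_ne_zero (α := ℝ))]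
    simp
  refine ((h1.exp).const_mul (1 / Real.sqrt (2 * Real.pi * σ ^ 2 * τ))).congr_deriv ?_
  unfold heatKernel
  ring

theorem hasDerivAt_heatKernelX (σ τ z : ℝ) :
    HasDerivAt (fun x => -(x / (σ ^ 2 * τ)) * heatKernel σ τ x) (heatKernelXX σ τ z) z := by
  have h1 : HasDerivAt (fun x : ℝ => -(x / (σ ^ 2 * τ))) (-(1 / (σ ^ 2 * τ))) z :=
    ((hasDerivAt_id z).div_const _).neg
  refine (h1.mul (hasDerivAt_heatKernel σ τ z)).congr_deriv ?_
  unfold heatKernelXX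
  rw [← div_pow]
  ring

theorem hasDerivAt_heatKernelXX (σ τ z : ℝ) :
    HasDerivAt (heatKernelXX σ τ) ((2 * z / (σ ^ 2 * τ) ^ 2
      - (z ^ 2 / (σ ^ 2 * τ) ^ 2 - 1 / (σ ^ 2 * τ)) * (z / (σ ^ 2 * τ))) * heatKernel σ τ z) z := by
  have h1 : HasDerivAt (fun x : ℝ => x ^ 2 / (σ ^ 2 * τ) ^ 2 - 1 / (σ ^ 2 * τ))
      (2 * z / (σ ^ 2 * τ) ^ 2) z := by
    have := ((hasDerivAt_pow 2 z).div_const ((σ ^ 2 * τ) ^ 2)).sub_const (1 / (σ ^ 2 * τ))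
    simpa using this
  refine (h1.mul (hasDerivAt_heatKernel σ τ z)).congr_deriv ?_
  ring

theorem iteratedDeriv_two_heatKernel (σ τ : ℝ) :
    iteratedDeriv 2 (heatKernel σ τ) = heatKernelXX σ τ := by
  rw [iteratedDeriv_succ, iteratedDeriv_one]
  have : deriv (heatKernel σ τ) = fun x => -(x / (σ ^ 2 * τ)) * heatKernel σ τ x :=
    funext fun x => (hasDerivAt_heatKernel σ τ x).deriv
  rw [this]
  exact funext fun x => (hasDerivAt_heatKernelX σ τ x).deriv

/-- The heat equation, source of the factor `2/σ²` in the Gubinelli derivative. -/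
theorem hasDerivAt_heatKernel_time {σ τ : ℝ} (hσ : 0 < σ) (hτ : 0 < τ) (z : ℝ) :
    HasDerivAt (fun τ => heatKernel σ τ z) (σ ^ 2 / 2 * heatKernelXX σ τ z) τ := by
  have hp := Real.pi_pos
  have hA : 0 < 2 * Real.pi * σ ^ 2 * τ := by positivity
  have h1 : HasDerivAt (fun τ => 2 * Real.pi * σ ^ 2 * τ) (2 * Real.pi * σ ^ 2) τ := by
    simpa using (hasDerivAt_id τ).const_mul (2 * Real.pi * σ ^ 2)
  have h2 := (h1.sqrt hA.ne').inv (Real.sqrt_pos.2 hA).ne'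
  have h3 : HasDerivAt (fun τ => -(z ^ 2) / (2 * σ ^ 2 * τ)) (z ^ 2 / (2 * σ ^ 2 * τ ^ 2)) τ := by
    have h4 : HasDerivAt (fun τ => 2 * σ ^ 2 * τ) (2 * σ ^ 2) τ := by
      simpa using (hasDerivAt_id τ).const_mul (2 * σ ^ 2)
    refine ((h4.inv (by positivity)).const_mul (-(z ^ 2))).congr_deriv ?_
    field_simp
  have h5 := h2.mul h3.exp
  have e : (fun τ => heatKernel σ τ z) = fun τ => (Real.sqrt (2 * Real.pi * σ ^ 2 * τ))⁻¹
      * Real.exp (-(z ^ 2) / (2 * σ ^ 2 * τ)) := by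
    funext τ; rw [heatKernel, one_div]
  rw [e]
  refine h5.congr_deriv ?_
  rw [heatKernelXX, heatKernel, Real.sq_sqrt hA.le, Pi.inv_apply]
  field_simp
  ring

theorem hasDerivAt_heatKernelXX_time {σ τ : ℝ} (hσ : 0 < σ) (hτ : 0 < τ) (z : ℝ) :
    HasDerivAt (fun τ => heatKernelXX σ τ z)
      (((1 / (σ ^ 2 * τ) - 2 * (z ^ 2 / (σ ^ 2 * τ) ^ 2)) / τ
        + σ ^ 2 / 2 * (z ^ 2 / (σ ^ 2 * τ) ^ 2 - 1 / (σ ^ 2 * τ)) ^ 2) * heatKernel σ τ z) τ := by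
  have h1 : HasDerivAt (fun τ => σ ^ 2 * τ) (σ ^ 2) τ := by
    simpa using (hasDerivAt_id τ).const_mul (σ ^ 2)
  have hne : σ ^ 2 * τ ≠ 0 := by positivity
  have h2 := (((h1.pow 2).inv (pow_ne_zero 2 hne)).const_mul (z ^ 2)).sub (h1.inv hne)
  have h3 : HasDerivAt (fun τ => z ^ 2 / (σ ^ 2 * τ) ^ 2 - 1 / (σ ^ 2 * τ))
      ((1 / (σ ^ 2 * τ) - 2 * (z ^ 2 / (σ ^ 2 * τ) ^ 2)) / τ) τ := by
    simp only [div_eq_mul_inv, one_mul] at h2 ⊢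
    refine HasDerivAt.congr_deriv h2 ?_
    simp only [Pi.pow_apply]
    field_simp
    ring
  have h4 := h3.mul (hasDerivAt_heatKernel_time hσ hτ z)
  refine HasDerivAt.congr_deriv h4 ?_
  unfold heatKernelXX
  ring

theorem continuous_heatKernel (σ τ : ℝ) : Continuous (heatKernel σ τ) :=
  continuous_iff_continuousAt.2 fun z => (hasDerivAt_heatKernel σ τ z).continuousAt

theorem continuous_heatKernelXX (σ τ : ℝ) : Continuous (heatKernelXX σ τ) :=
  continuous_iff_continuousAt.2 fun z => (hasDerivAt_heatKernelXX σ τ z).continuousAt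

theorem measurable_heatKernelXX (σ : ℝ) : Measurable fun p : ℝ × ℝ => heatKernelXX σ p.1 p.2 := by
  unfold heatKernelXX heatKernel
  fun_prop

/-! Parabolic scaling. -/

theorem heatKernel_scale {u : ℝ} (hu : 0 < u) (σ τ z : ℝ) :
    heatKernel σ (u ^ 2 * τ) (u * z) = u⁻¹ * heatKernel σ τ z := by
  unfold heatKernel
  have h1 : Real.sqrt (2 * Real.pi * σ ^ 2 * (u ^ 2 * τ))
      = u * Real.sqrt (2 * Real.pi * σ ^ 2 * τ) := by
    rw [show 2 * Real.pi * σ ^ 2 * (u ^ 2 * τ) = u ^ 2 * (2 * Real.pi * σ ^ 2 * τ) by ring,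
      Real.sqrt_mul (by positivity), Real.sqrt_sq hu.le]
  have h2 : -((u * z) ^ 2) / (2 * σ ^ 2 * (u ^ 2 * τ)) = -(z ^ 2) / (2 * σ ^ 2 * τ) := by
    rw [show -((u * z) ^ 2) = u ^ 2 * (-(z ^ 2)) by ring,
      show 2 * σ ^ 2 * (u ^ 2 * τ) = u ^ 2 * (2 * σ ^ 2 * τ) by ring,
      mul_div_mul_left _ _ (by positivity)]
  rw [h1, h2, one_div, one_div, mul_inv]
  ring

theorem heatKernelXX_scale {u : ℝ} (hu : 0 < u) (σ τ z : ℝ) :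
    heatKernelXX σ (u ^ 2 * τ) (u * z) = (u ^ 3)⁻¹ * heatKernelXX σ τ z := by
  unfold heatKernelXX
  rw [heatKernel_scale hu]
  have h1 : (u * z) ^ 2 / (σ ^ 2 * (u ^ 2 * τ)) ^ 2 = (u ^ 2)⁻¹ * (z ^ 2 / (σ ^ 2 * τ) ^ 2) := by
    rw [show (u * z) ^ 2 = u ^ 2 * z ^ 2 by ring,
      show (σ ^ 2 * (u ^ 2 * τ)) ^ 2 = u ^ 2 * (u ^ 2 * (σ ^ 2 * τ) ^ 2) by ring,
      mul_div_mul_left _ _ (by positivity), ← div_div, div_eq_mul_inv, div_eq_mul_inv,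
      div_eq_mul_inv]
    ring
  have h2 : 1 / (σ ^ 2 * (u ^ 2 * τ)) = (u ^ 2)⁻¹ * (1 / (σ ^ 2 * τ)) := by
    rw [show σ ^ 2 * (u ^ 2 * τ) = u ^ 2 * (σ ^ 2 * τ) by ring, ← div_div, one_div, div_eq_mul_inv,
      one_div]
  rw [h1, h2]
  field_simp

/-! Gaussian bounds at unit scale. -/

/-- The rate in the Gaussian bounds. -/
def gaussRate (σ : ℝ) : ℝ := 1 / (8 * σ ^ 2)

theorem gaussRate_pos {σ : ℝ} (hσ : 0 < σ) : 0 < gaussRate σ := by unfold gaussRate; positivity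

theorem one_add_sq_le_exp {c q : ℝ} (hc : 0 < c) (hq : 0 ≤ q) :
    (1 + q) ^ 2 ≤ (1 + 2 / c) ^ 2 * Real.exp (c * q) := by
  have h1 : 1 + q ≤ (1 + 2 / c) * Real.exp (c * q / 2) := by
    have := Real.add_one_le_exp (c * q / 2)
    calc 1 + q ≤ (1 + 2 / c) * (c * q / 2 + 1) := by
          have : (1 + 2 / c) * (c * q / 2 + 1) = 1 + q + c * q / 2 + 2 / c := by field_simp; ring
          rw [this]; have : 0 ≤ c * q / 2 + 2 / c := by positivity
          linarith
      _ ≤ _ := by gcongr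
  calc (1 + q) ^ 2 ≤ ((1 + 2 / c) * Real.exp (c * q / 2)) ^ 2 := by gcongr
    _ = _ := by rw [mul_pow, ← Real.exp_nat_mul]; congr 2; push_cast; ring

/-- The constant in `heatKernel_unit_le`. -/
def gaussConst (σ : ℝ) : ℝ := 1 / Real.sqrt (2 * Real.pi * σ ^ 2) * (1 + 2 / gaussRate σ) ^ 2

theorem gaussConst_pos {σ : ℝ} (hσ : 0 < σ) : 0 < gaussConst σ := by
  have := gaussRate_pos hσ
  have := Real.pi_pos
  unfold gaussConst; positivity

/-- With `b = gaussRate σ` the kernel decays like `exp(-4bz²/τ)`, hence at rate at least `m b`; one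
`b` is spent on the polynomial. The value `m = 2` leaves the final rate, and `m = 3` keeps one more
`b` in reserve for a shift in space. -/
theorem heatKernel_unit_le {σ τ m : ℝ} (hσ : 0 < σ) (hτ : 1 ≤ τ) (hm : m * τ ≤ 4) (z : ℝ) :
    (1 + z ^ 2) ^ 2 * heatKernel σ τ z
      ≤ gaussConst σ * Real.exp (-((m - 1) * gaussRate σ * z ^ 2)) := by
  have hb := gaussRate_pos hσ
  have hτ0 : 0 < τ := by linarith
  have hp := Real.pi_pos
  have h1 := one_add_sq_le_exp hb (sq_nonneg z)
  have h2 : heatKernel σ τ z ≤ 1 / Real.sqrt (2 * Real.pi * σ ^ 2)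
      * Real.exp (-(m * gaussRate σ * z ^ 2)) := by
    have hs : 0 < 2 * Real.pi * σ ^ 2 := by positivity
    unfold heatKernel
    refine mul_le_mul (one_div_le_one_div_of_le (Real.sqrt_pos.2 hs)
      (Real.sqrt_le_sqrt (le_mul_of_one_le_right hs.le hτ))) (Real.exp_le_exp.2 ?_)
      (Real.exp_pos _).le (by positivity)
    · rw [neg_div, neg_le_neg_iff, gaussRate, le_div_iff₀ (by positivity)]
      have : m * (1 / (8 * σ ^ 2)) * z ^ 2 * (2 * σ ^ 2 * τ) = (m * τ) / 4 * z ^ 2 := by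
        field_simp; ring
      rw [this]
      nlinarith [sq_nonneg z]
  calc _ ≤ ((1 + 2 / gaussRate σ) ^ 2 * Real.exp (gaussRate σ * z ^ 2))
        * (1 / Real.sqrt (2 * Real.pi * σ ^ 2) * Real.exp (-(m * gaussRate σ * z ^ 2))) := by
        have := heatKernel_nonneg σ τ z
        gcongr
    _ = gaussConst σ * (Real.exp (gaussRate σ * z ^ 2) * Real.exp (-(m * gaussRate σ * z ^ 2))) := by
        unfold gaussConst; ring
    _ = _ := by rw [← Real.exp_add]; ring_nf

theorem abs_mul_heatKernel_le {σ τ m P C : ℝ} (hσ : 0 < σ) (hτ : 1 ≤ τ) (hm : m * τ ≤ 4) (z : ℝ)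
    (hC : 0 ≤ C) (hP : |P| ≤ C * (1 + z ^ 2) ^ 2) :
    |P * heatKernel σ τ z| ≤ C * gaussConst σ * Real.exp (-((m - 1) * gaussRate σ * z ^ 2)) := by
  have h := heatKernel_unit_le hσ hτ hm z
  rw [abs_mul, abs_of_nonneg (heatKernel_nonneg _ _ _)]
  calc _ ≤ C * (1 + z ^ 2) ^ 2 * heatKernel σ τ z := by
        have := heatKernel_nonneg σ τ z
        gcongr
    _ = C * ((1 + z ^ 2) ^ 2 * heatKernel σ τ z) := by ring
    _ ≤ _ := by rw [mul_assoc]; gcongr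

/-- From `2(z+s)² + 2s² - z² = (z+2s)²`: half the rate pays for a bounded shift. -/
theorem shift_gauss_le {b s z : ℝ} (hb : 0 < b) (hs : |s| ≤ 1) :
    Real.exp (-(2 * b * (z + s) ^ 2)) ≤ Real.exp (2 * b) * Real.exp (-(b * z ^ 2)) := by
  rw [← Real.exp_add]
  apply Real.exp_le_exp.2
  have : s ^ 2 ≤ 1 := by rw [← sq_abs]; nlinarith [abs_nonneg s]
  nlinarith [sq_nonneg (z + 2 * s)]

/-- Gaussian bounds for the heat kernel and its second derivative, together with bounds on
their space and time increments, at unit scale. -/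
theorem heatKernel_unit_bounds {σ : ℝ} (hσ : 0 < σ) : ∃ C, 0 < C ∧
    (∀ z, |heatKernelXX σ 1 z| ≤ C * Real.exp (-(gaussRate σ * z ^ 2))) ∧
    (∀ z h, |h| ≤ 1 → |heatKernelXX σ 1 (z + h) - heatKernelXX σ 1 z|
      ≤ C * |h| * Real.exp (-(gaussRate σ * z ^ 2))) ∧
    (∀ z δ, 0 ≤ δ → δ ≤ 1 → |heatKernelXX σ (1 + δ) z - heatKernelXX σ 1 z|
      ≤ C * δ * Real.exp (-(gaussRate σ * z ^ 2))) ∧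
    (∀ z, |heatKernel σ 1 z| ≤ C * Real.exp (-(gaussRate σ * z ^ 2))) ∧
    (∀ z h, |h| ≤ 1 → |heatKernel σ 1 (z + h) - heatKernel σ 1 z|
      ≤ C * |h| * Real.exp (-(gaussRate σ * z ^ 2))) := by
  have hb := gaussRate_pos hσ
  have hG := gaussConst_pos hσ
  set b := gaussRate σ with hbdef
  set w := 1 / σ ^ 2 with hw
  have hw0 : 0 < w := by positivity
  -- One constant for which `C0 (1 + z²)²` dominates every prefactor of the kernel met below.
  set C0 := (1 + w) ^ 4 * (3 + σ ^ 2) with hC0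
  have hC00 : 0 < C0 := by positivity
  have habs : ∀ z : ℝ, |z| ≤ 1 + z ^ 2 := fun z => by
    rw [abs_le]; constructor <;> nlinarith [sq_nonneg (z - 1), sq_nonneg (z + 1)]
  have pw : ∀ v : ℝ, 0 ≤ v → v ≤ w → ∀ z : ℝ, |z ^ 2 * v ^ 2 - v| ≤ (1 + w) ^ 2 * (1 + z ^ 2) := by
    intro v hv hvw z
    have h0 := sq_nonneg z
    have h1 : z ^ 2 * v ^ 2 ≤ z ^ 2 * w ^ 2 := by gcongr
    have h2 : 0 ≤ z ^ 2 * v ^ 2 := by positivity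
    rw [abs_le]
    constructor <;> nlinarith
  have hpos4 : (1 + w) ^ 2 ≤ (1 + w) ^ 4 := pow_le_pow_right₀ (by linarith) (by norm_num)
  have hone4 : 1 ≤ (1 + w) ^ 4 := one_le_pow₀ (by linarith)
  have hpz : ∀ z : ℝ, 1 + z ^ 2 ≤ (1 + z ^ 2) ^ 2 := fun z => by nlinarith [sq_nonneg z]
  have hdiv : ∀ τ z : ℝ, z ^ 2 / (σ ^ 2 * τ) ^ 2 - 1 / (σ ^ 2 * τ)
      = z ^ 2 * (1 / (σ ^ 2 * τ)) ^ 2 - 1 / (σ ^ 2 * τ) := fun τ z => by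
    rw [one_div_pow, mul_one_div]
  have kle : ∀ z, |heatKernelXX σ 1 z| ≤ C0 * gaussConst σ * Real.exp (-(b * z ^ 2)) := by
    intro z
    have := abs_mul_heatKernel_le (τ := 1) (m := 2) (C := C0)
      (P := z ^ 2 / (σ ^ 2 * 1) ^ 2 - 1 / (σ ^ 2 * 1)) hσ le_rfl (by norm_num) z hC00.le ?_
    · refine this.trans (le_of_eq ?_)
      rw [← hbdef]; norm_num
    · rw [hdiv, mul_one]
      calc _ ≤ (1 + w) ^ 2 * (1 + z ^ 2) := pw w hw0.le le_rfl z
        _ ≤ (1 + w) ^ 4 * (1 + z ^ 2) ^ 2 := by gcongr; exact hpz z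
        _ ≤ _ := by
          rw [hC0]; gcongr
          have : 0 < σ ^ 2 := by positivity
          nlinarith
  have pder : ∀ z, |-(z / (σ ^ 2 * 1)) * heatKernel σ 1 z|
      ≤ C0 * gaussConst σ * Real.exp (-(2 * b * z ^ 2)) := by
    intro z
    have := abs_mul_heatKernel_le (τ := 1) (m := 3) (C := C0)
      (P := -(z / (σ ^ 2 * 1))) hσ le_rfl (by norm_num) z hC00.le ?_
    · convert this using 3; ring
    · rw [abs_neg, mul_one, div_eq_mul_one_div, abs_mul, abs_of_pos hw0]
      calc _ ≤ (1 + z ^ 2) * (1 + w) ^ 2 := by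
            gcongr
            · exact habs z
            · nlinarith
        _ ≤ (1 + z ^ 2) ^ 2 * (1 + w) ^ 4 := by gcongr; exact hpz z
        _ = (1 + w) ^ 4 * 1 * (1 + z ^ 2) ^ 2 := by ring
        _ ≤ _ := by rw [hC0]; gcongr; have : 0 < σ ^ 2 := by positivity
                    linarith
  have kder : ∀ z, |(2 * z / (σ ^ 2 * 1) ^ 2
      - (z ^ 2 / (σ ^ 2 * 1) ^ 2 - 1 / (σ ^ 2 * 1)) * (z / (σ ^ 2 * 1))) * heatKernel σ 1 z|
      ≤ C0 * gaussConst σ * Real.exp (-(2 * b * z ^ 2)) := by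
    intro z
    have := abs_mul_heatKernel_le (τ := 1) (m := 3) (C := C0)
      (P := 2 * z / (σ ^ 2 * 1) ^ 2
      - (z ^ 2 / (σ ^ 2 * 1) ^ 2 - 1 / (σ ^ 2 * 1)) * (z / (σ ^ 2 * 1))) hσ le_rfl (by norm_num) z
      hC00.le ?_
    · convert this using 3; ring
    · rw [hdiv, mul_one]
      have e1 : 2 * z / (σ ^ 2) ^ 2 = 2 * z * w ^ 2 := by rw [hw, one_div_pow, mul_one_div]
      have e2 : z / σ ^ 2 = z * w := by rw [hw, mul_one_div]
      rw [e1, e2]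
      have p1 := pw w hw0.le le_rfl z
      have a1 : |2 * z * w ^ 2| ≤ 2 * ((1 + w) ^ 4 * (1 + z ^ 2) ^ 2) := by
        rw [abs_mul, abs_mul, abs_of_pos (pow_pos hw0 2), abs_two]
        calc 2 * |z| * w ^ 2 ≤ 2 * (1 + z ^ 2) * (1 + w) ^ 2 := by
              gcongr
              · exact habs z
              · linarith
          _ ≤ 2 * (1 + z ^ 2) ^ 2 * (1 + w) ^ 4 := by gcongr; exact hpz z
          _ = _ := by ring
      have a2 : |(z ^ 2 * w ^ 2 - w) * (z * w)| ≤ (1 + w) ^ 4 * (1 + z ^ 2) ^ 2 := by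
        rw [abs_mul, abs_mul z, abs_of_pos hw0]
        calc _ ≤ ((1 + w) ^ 2 * (1 + z ^ 2)) * ((1 + z ^ 2) * (1 + w) ^ 2) := by
              gcongr
              · exact habs z
              · nlinarith
          _ = _ := by ring
      calc _ ≤ _ := abs_sub _ _
        _ ≤ 2 * ((1 + w) ^ 4 * (1 + z ^ 2) ^ 2) + (1 + w) ^ 4 * (1 + z ^ 2) ^ 2 := add_le_add a1 a2
        _ = (1 + w) ^ 4 * 3 * (1 + z ^ 2) ^ 2 := by ring
        _ ≤ _ := by rw [hC0]; gcongr; have : 0 < σ ^ 2 := by positivity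
                    linarith
  -- The range `τ ≤ 2` is exactly what `m * τ ≤ 4` allows for `m = 2`.
  have ktime : ∀ τ, 1 ≤ τ → τ ≤ 2 → ∀ z, |((1 / (σ ^ 2 * τ) - 2 * (z ^ 2 / (σ ^ 2 * τ) ^ 2)) / τ
        + σ ^ 2 / 2 * (z ^ 2 / (σ ^ 2 * τ) ^ 2 - 1 / (σ ^ 2 * τ)) ^ 2) * heatKernel σ τ z|
      ≤ C0 * gaussConst σ * Real.exp (-(b * z ^ 2)) := by
    intro τ hτ hτ2 z
    have hτ0 : 0 < τ := by linarith
    have := abs_mul_heatKernel_le (τ := τ) (m := 2) (C := C0)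
      (P := (1 / (σ ^ 2 * τ) - 2 * (z ^ 2 / (σ ^ 2 * τ) ^ 2)) / τ
        + σ ^ 2 / 2 * (z ^ 2 / (σ ^ 2 * τ) ^ 2 - 1 / (σ ^ 2 * τ)) ^ 2) hσ hτ (by linarith) z
      hC00.le ?_
    · convert this using 3; ring
    · rw [hdiv]
      have e1 : z ^ 2 / (σ ^ 2 * τ) ^ 2 = z ^ 2 * (1 / (σ ^ 2 * τ)) ^ 2 := by
        rw [one_div_pow, mul_one_div]
      rw [e1]
      have hv0 : 0 ≤ 1 / (σ ^ 2 * τ) := by positivity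
      have hvw : 1 / (σ ^ 2 * τ) ≤ w := by
        rw [hw]; gcongr
        have : 0 < σ ^ 2 := by positivity
        nlinarith
      set v := 1 / (σ ^ 2 * τ) with hv
      have p1 := pw v hv0 hvw z
      have a1 : |(v - 2 * (z ^ 2 * v ^ 2)) / τ| ≤ 2 * ((1 + w) ^ 4 * (1 + z ^ 2) ^ 2) := by
        rw [abs_div, abs_of_pos hτ0, div_le_iff₀ hτ0]
        have q1 : |v - 2 * (z ^ 2 * v ^ 2)| ≤ 2 * ((1 + w) ^ 2 * (1 + z ^ 2)) := by
          have h1 : z ^ 2 * v ^ 2 ≤ z ^ 2 * w ^ 2 := by gcongr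
          have h2 : 0 ≤ z ^ 2 * v ^ 2 := by positivity
          have h3 := sq_nonneg z
          have h4 : 0 ≤ w * z ^ 2 := by positivity
          rw [abs_le]
          constructor <;> nlinarith
        calc _ ≤ 2 * ((1 + w) ^ 2 * (1 + z ^ 2)) := q1
          _ ≤ 2 * ((1 + w) ^ 4 * (1 + z ^ 2) ^ 2) * 1 := by
              rw [mul_one]; gcongr; exact hpz z
          _ ≤ _ := by gcongr
      have a2 : |σ ^ 2 / 2 * (z ^ 2 * v ^ 2 - v) ^ 2| ≤ σ ^ 2 * ((1 + w) ^ 4 * (1 + z ^ 2) ^ 2) := by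
        rw [abs_mul, abs_of_pos (show 0 < σ ^ 2 / 2 by positivity), abs_pow]
        calc _ ≤ σ ^ 2 / 2 * ((1 + w) ^ 2 * (1 + z ^ 2)) ^ 2 := by gcongr
          _ = σ ^ 2 / 2 * ((1 + w) ^ 4 * (1 + z ^ 2) ^ 2) := by ring
          _ ≤ _ := by gcongr; linarith [show 0 < σ ^ 2 by positivity]
      calc _ ≤ _ := abs_add_le _ _
        _ ≤ _ := add_le_add a1 a2
        _ = (1 + w) ^ 4 * (2 + σ ^ 2) * (1 + z ^ 2) ^ 2 := by ring
        _ ≤ _ := by rw [hC0]; gcongr; norm_num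
  -- Mean value inequality over shifts in `[-1, 1]`; the derivative has rate `2b`, so that rate `b`
  -- remains after recentring at `z`.
  have shift : ∀ f f' : ℝ → ℝ, (∀ z, HasDerivAt f (f' z) z) →
      (∀ z, |f' z| ≤ C0 * gaussConst σ * Real.exp (-(2 * b * z ^ 2))) → ∀ z h, |h| ≤ 1 →
      |f (z + h) - f z| ≤ C0 * gaussConst σ * Real.exp (2 * b) * |h| * Real.exp (-(b * z ^ 2)) := by
    intro f f' hf hf' z h hh
    have hd : ∀ s ∈ Set.Icc (-1 : ℝ) 1, HasDerivWithinAt (fun s => f (z + s)) (f' (z + s))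
        (Set.Icc (-1 : ℝ) 1) s := fun s _ => by
      have := (hf (z + s)).comp_const_add z s
      exact this.hasDerivWithinAt
    have hbd : ∀ s ∈ Set.Icc (-1 : ℝ) 1, ‖f' (z + s)‖
        ≤ C0 * gaussConst σ * (Real.exp (2 * b) * Real.exp (-(b * z ^ 2))) := fun s hs => by
      rw [Real.norm_eq_abs]
      refine (hf' _).trans ?_
      gcongr
      exact shift_gauss_le hb (abs_le.2 hs)
    have := Convex.norm_image_sub_le_of_norm_hasDerivWithin_le hd hbd (convex_Icc _ _)
      (show (0 : ℝ) ∈ Set.Icc (-1 : ℝ) 1 by norm_num) (abs_le.1 hh)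
    simp only [Real.norm_eq_abs, add_zero, sub_zero] at this
    refine this.trans (le_of_eq ?_)
    ring
  have hex : 1 ≤ Real.exp (2 * b) := Real.one_le_exp (by positivity)
  have hle : C0 * gaussConst σ ≤ C0 * gaussConst σ * Real.exp (2 * b) :=
    le_mul_of_one_le_right (by positivity) hex
  refine ⟨C0 * gaussConst σ * Real.exp (2 * b), by positivity, ?_, ?_, ?_, ?_, ?_⟩
  · exact fun z => (kle z).trans (by gcongr)
  · exact shift _ _ (hasDerivAt_heatKernelXX σ 1) kder
  · intro z δ h0 h1
    have := Convex.norm_image_sub_le_of_norm_hasDerivWithin_le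
      (f := fun τ => heatKernelXX σ τ z) (s := Set.Icc (1 : ℝ) 2)
      (C := C0 * gaussConst σ * Real.exp (-(b * z ^ 2)))
      (fun τ hτ => (hasDerivAt_heatKernelXX_time hσ (by linarith [hτ.1]) z).hasDerivWithinAt)
      (fun τ hτ => ktime τ hτ.1 hτ.2 z) (convex_Icc _ _) (x := 1) (y := 1 + δ)
      ⟨le_rfl, by norm_num⟩ ⟨by linarith, by linarith⟩
    simp only [Real.norm_eq_abs, add_sub_cancel_left, abs_of_nonneg h0] at this
    refine this.trans ?_
    calc _ = C0 * gaussConst σ * (δ * Real.exp (-(b * z ^ 2))) := by ring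
      _ ≤ C0 * gaussConst σ * Real.exp (2 * b) * (δ * Real.exp (-(b * z ^ 2))) := by gcongr
      _ = _ := by ring
  · intro z
    have := abs_mul_heatKernel_le (τ := 1) (m := 2) (C := C0) (P := 1) hσ le_rfl (by norm_num) z
      hC00.le ?_
    · rw [one_mul] at this
      refine this.trans ?_
      calc _ = C0 * gaussConst σ * Real.exp (-(b * z ^ 2)) := by rw [← hbdef]; norm_num
        _ ≤ _ := by gcongr
    · rw [abs_one, hC0]
      have h1 : 1 ≤ (1 + z ^ 2) ^ 2 := by nlinarith [sq_nonneg z]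
      have h2 : 1 ≤ 3 + σ ^ 2 := by nlinarith
      exact one_le_mul_of_one_le_of_one_le (one_le_mul_of_one_le_of_one_le hone4 h2) h1
  · exact shift _ _ (hasDerivAt_heatKernel σ 1) pder

/-- The Gaussian `(τ√τ)⁻¹ exp(-b z²/τ)` with the rate of the bounds on the heat kernel. -/
def gaussEnv (σ τ z : ℝ) : ℝ := (τ * Real.sqrt τ)⁻¹ * Real.exp (-(gaussRate σ * (z ^ 2 / τ)))

theorem gaussEnv_nonneg {σ τ : ℝ} (hτ : 0 ≤ τ) (z : ℝ) : 0 ≤ gaussEnv σ τ z := by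
  unfold gaussEnv; positivity

/-- Parabolic scaling by `u = √τ` reduces everything to `τ = 1`; the conditions `|h| ≤ √τ` and `δ ≤
τ` become the unit ranges there. -/
theorem heatKernel_bounds {σ : ℝ} (hσ : 0 < σ) : ∃ C, 0 < C ∧ ∀ τ, 0 < τ →
    (∀ z, |heatKernelXX σ τ z| ≤ C * gaussEnv σ τ z) ∧
    (∀ z h, |h| ≤ Real.sqrt τ → |heatKernelXX σ τ (z + h) - heatKernelXX σ τ z|
      ≤ C * (|h| / Real.sqrt τ) * gaussEnv σ τ z) ∧
    (∀ z δ, 0 ≤ δ → δ ≤ τ → |heatKernelXX σ (τ + δ) z - heatKernelXX σ τ z|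
      ≤ C * (δ / τ) * gaussEnv σ τ z) ∧
    (∀ z, |heatKernel σ τ z| ≤ C * τ * gaussEnv σ τ z) ∧
    (∀ z h, |h| ≤ Real.sqrt τ → |heatKernel σ τ (z + h) - heatKernel σ τ z|
      ≤ C * (|h| / Real.sqrt τ) * τ * gaussEnv σ τ z) := by
  obtain ⟨C, hC, h1, h2, h3, h4, h5⟩ := heatKernel_unit_bounds hσ
  refine ⟨C, hC, fun τ hτ => ?_⟩
  set u := Real.sqrt τ with hu
  have hu0 : 0 < u := Real.sqrt_pos.2 hτ
  have hu2 : u ^ 2 = τ := Real.sq_sqrt hτ.le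
  have hz : ∀ z, u * (z / u) = z := fun z => by field_simp
  have eX : ∀ δ z, heatKernelXX σ (τ + δ) z
      = (u ^ 3)⁻¹ * heatKernelXX σ (1 + δ / τ) (z / u) := fun δ z => by
    rw [← heatKernelXX_scale hu0, hz, hu2]
    congr 1
    field_simp
  have eX0 : ∀ z, heatKernelXX σ τ z = (u ^ 3)⁻¹ * heatKernelXX σ 1 (z / u) := fun z => by
    rw [← heatKernelXX_scale hu0, hz, hu2, mul_one]
  have eP : ∀ z, heatKernel σ τ z = u⁻¹ * heatKernel σ 1 (z / u) := fun z => by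
    rw [← heatKernel_scale hu0, hz, hu2, mul_one]
  have eG : ∀ z, gaussEnv σ τ z = (u ^ 3)⁻¹ * Real.exp (-(gaussRate σ * (z / u) ^ 2)) := fun z => by
    rw [gaussEnv, ← hu, div_pow, hu2]
    congr 2
    rw [← hu2]; ring
  have eG' : ∀ z, τ * gaussEnv σ τ z = u⁻¹ * Real.exp (-(gaussRate σ * (z / u) ^ 2)) := fun z => by
    rw [eG, ← hu2]
    field_simp
  have hu3 : 0 < (u ^ 3)⁻¹ := by positivity
  have hui : 0 < u⁻¹ := by positivity
  have hh : ∀ h, |h| ≤ u → |h / u| ≤ 1 := fun h hle => by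
    rw [abs_div, abs_of_pos hu0, div_le_one hu0]; exact hle
  have hau : ∀ h, |h / u| = |h| / u := fun h => by rw [abs_div, abs_of_pos hu0]
  refine ⟨fun z => ?_, fun z h hle => ?_, fun z δ h0 hδ => ?_, fun z => ?_, fun z h hle => ?_⟩
  · rw [eX0, eG, abs_mul, abs_of_pos hu3, mul_left_comm]
    exact mul_le_mul_of_nonneg_left (h1 _) hu3.le
  · rw [eX0, eX0, eG, ← mul_sub, abs_mul, abs_of_pos hu3, mul_left_comm, ← hau, add_div]
    exact mul_le_mul_of_nonneg_left (h2 _ _ (hh h hle)) hu3.le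
  · rw [eX, eX0, eG, ← mul_sub, abs_mul, abs_of_pos hu3, mul_left_comm]
    exact mul_le_mul_of_nonneg_left (h3 _ _ (by positivity) ((div_le_one hτ).2 hδ)) hu3.le
  · rw [mul_assoc, eP, eG', abs_mul, abs_of_pos hui, mul_left_comm]
    exact mul_le_mul_of_nonneg_left (h4 _) hui.le
  · rw [mul_assoc, eP, eP, eG', ← mul_sub, abs_mul, abs_of_pos hui, mul_left_comm, ← hau, add_div]
    exact mul_le_mul_of_nonneg_left (h5 _ _ (hh h hle)) hui.le

/-! ### Moments -/

/-- In the variable `q = z²/τ`, a quarter of the Gaussian absorbs `q^(r/2)` and another quarter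
absorbs `exp(c|z|)`, by completing the square and `τ ≤ T`. Half of it is left to integrate. -/
theorem rpow_mul_exp_mul_gauss_le {b c T : ℝ} (hb : 0 < b) (hT : 0 < T) : ∃ C, 0 < C ∧
    ∀ r : ℝ, 0 ≤ r → r ≤ 2 → ∀ τ, 0 < τ → τ ≤ T → ∀ z : ℝ,
      |z| ^ r * Real.exp (c * |z|) * Real.exp (-(b * (z ^ 2 / τ)))
        ≤ C * τ ^ (r / 2) * Real.exp (-(b / 2 / τ) * z ^ 2) := by
  refine ⟨(1 + 2 / (b / 4)) ^ 2 * Real.exp (c ^ 2 * T / b), by positivity, ?_⟩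
  intro r hr hr2 τ hτ hτT z
  set q := z ^ 2 / τ with hq
  have hq0 : 0 ≤ q := by positivity
  have hzq : z ^ 2 = τ * q := by rw [hq]; field_simp
  have e1 : |z| ^ r = τ ^ (r / 2) * q ^ (r / 2) := by
    rw [← Real.mul_rpow hτ.le hq0, ← hzq, ← sq_abs, ← Real.rpow_natCast, ← Real.rpow_mul (abs_nonneg _)]
    congr 1
    push_cast; ring
  have e2 : q ^ (r / 2) ≤ (1 + 2 / (b / 4)) ^ 2 * Real.exp (b / 4 * q) := by
    refine le_trans ?_ (one_add_sq_le_exp (by positivity : 0 < b / 4) hq0)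
    rcases le_total q 1 with h1 | h1
    · have := Real.rpow_le_one hq0 h1 (by linarith : 0 ≤ r / 2)
      nlinarith
    · have := Real.rpow_le_rpow_of_exponent_le h1 (by linarith : r / 2 ≤ 1)
      rw [Real.rpow_one] at this
      nlinarith
  have e3 : c * |z| ≤ b / 4 * q + c ^ 2 * T / b := by
    have h1 : z ^ 2 ≤ T * q := by rw [hzq]; gcongr
    have h2 : c * |z| ≤ b / (4 * T) * z ^ 2 + c ^ 2 * T / b := by
      rw [← sq_abs z]
      have : b / (4 * T) * |z| ^ 2 + c ^ 2 * T / b - c * |z|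
          = (b * |z| - 2 * c * T) ^ 2 / (4 * T * b) := by field_simp; ring
      have h3 : 0 ≤ (b * |z| - 2 * c * T) ^ 2 / (4 * T * b) := by positivity
      linarith
    have h3 : b / (4 * T) * z ^ 2 ≤ b / (4 * T) * (T * q) := by gcongr
    have h4 : b / (4 * T) * (T * q) = b / 4 * q := by field_simp
    linarith
  have e4 : Real.exp (c * |z|) ≤ Real.exp (b / 4 * q) * Real.exp (c ^ 2 * T / b) := by
    rw [← Real.exp_add]; exact Real.exp_le_exp.2 e3
  have e5 : Real.exp (-(b / 2 / τ) * z ^ 2) = Real.exp (b / 4 * q) * Real.exp (b / 4 * q)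
      * Real.exp (-(b * q)) := by
    rw [← Real.exp_add, ← Real.exp_add, hzq]; congr 1; field_simp; ring
  rw [e1, e5]
  calc _ ≤ τ ^ (r / 2) * ((1 + 2 / (b / 4)) ^ 2 * Real.exp (b / 4 * q))
        * (Real.exp (b / 4 * q) * Real.exp (c ^ 2 * T / b)) * Real.exp (-(b * q)) := by gcongr
    _ = _ := by ring

/-- The growth of the integrands: a sum of three powers with an exponential weight. -/
def growth (α β c M₁ M₂ M₃ z : ℝ) : ℝ :=
  (M₁ * |z| ^ α + M₂ * |z| ^ (2 * α) + M₃ * |z| ^ (2 * β + α)) * Real.exp (c * |z|)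

/-- The decay in time that corresponds to `growth`. -/
def decay (α β M₁ M₂ M₃ τ : ℝ) : ℝ :=
  M₁ * τ ^ (-1 + α / 2) + M₂ * τ ^ (-1 + α) + M₃ * τ ^ (-1 + (β + α / 2))

theorem decay_nonneg {α β M₁ M₂ M₃ τ : ℝ} (h1 : 0 ≤ M₁) (h2 : 0 ≤ M₂) (h3 : 0 ≤ M₃) (hτ : 0 ≤ τ) :
    0 ≤ decay α β M₁ M₂ M₃ τ := by unfold decay; positivity

/-- The envelope contributes `τ^(-3/2)`, the integral of the Gaussian `τ^(1/2)`, and `|z|^r`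
contributes `τ^(r/2)`: together the exponents `-1 + r/2` of `decay`. -/
theorem integral_conv_le {α β σ c T : ℝ} (hα : 0 < α) (hα1 : α ≤ 1) (hβ : 0 < β)
    (hβα : 2 * β + α ≤ 2) (hσ : 0 < σ) (hT : 0 < T) :
    ∃ C, 0 < C ∧ ∀ τ, 0 < τ → τ ≤ T → ∀ (k F : ℝ → ℝ) (x m M₁ M₂ M₃ : ℝ), 0 ≤ m → 0 ≤ M₁ →
      0 ≤ M₂ → 0 ≤ M₃ → Continuous k → AEStronglyMeasurable F volume →
      (∀ z, |k z| ≤ m * gaussEnv σ τ z) → (∀ y, |F y| ≤ growth α β c M₁ M₂ M₃ (y - x)) →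
      Integrable (fun y => k (x - y) * F y) ∧
        ∫ y, |k (x - y) * F y| ≤ C * m * decay α β M₁ M₂ M₃ τ := by
  have hb := gaussRate_pos hσ
  set b := gaussRate σ with hbdef
  obtain ⟨C, hC, H⟩ := rpow_mul_exp_mul_gauss_le (c := c) hb hT
  refine ⟨C * Real.sqrt (2 * Real.pi / b), by have := Real.pi_pos; positivity, ?_⟩
  intro τ hτ hτT k F x m M₁ M₂ M₃ hm h1 h2 h3 hk hF hkb hFb
  set A := M₁ * τ ^ (α / 2) + M₂ * τ ^ (2 * α / 2) + M₃ * τ ^ ((2 * β + α) / 2) with hA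
  have hbτ : 0 < b / 2 / τ := by positivity
  have hgint : Integrable (fun y => m * (τ * Real.sqrt τ)⁻¹ * (C * A)
      * Real.exp (-(b / 2 / τ) * (y - x) ^ 2)) :=
    ((integrable_exp_neg_mul_sq hbτ).comp_sub_right x).const_mul _
  have hbd : ∀ y, |k (x - y) * F y| ≤ m * (τ * Real.sqrt τ)⁻¹ * (C * A)
      * Real.exp (-(b / 2 / τ) * (y - x) ^ 2) := by
    intro y
    rw [abs_mul]
    calc _ ≤ (m * gaussEnv σ τ (x - y)) * growth α β c M₁ M₂ M₃ (y - x) :=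
          mul_le_mul (hkb _) (hFb y) (abs_nonneg _) (mul_nonneg hm (gaussEnv_nonneg hτ.le _))
      _ = m * (τ * Real.sqrt τ)⁻¹ * (M₁ * (|y - x| ^ α * Real.exp (c * |y - x|)
            * Real.exp (-(b * ((y - x) ^ 2 / τ))))
          + M₂ * (|y - x| ^ (2 * α) * Real.exp (c * |y - x|)
            * Real.exp (-(b * ((y - x) ^ 2 / τ))))
          + M₃ * (|y - x| ^ (2 * β + α) * Real.exp (c * |y - x|)
            * Real.exp (-(b * ((y - x) ^ 2 / τ))))) := by
          rw [gaussEnv, growth, show (x - y) ^ 2 = (y - x) ^ 2 by ring]; ring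
      _ ≤ m * (τ * Real.sqrt τ)⁻¹ *
          (M₁ * (C * τ ^ (α / 2) * Real.exp (-(b / 2 / τ) * (y - x) ^ 2))
          + M₂ * (C * τ ^ (2 * α / 2) * Real.exp (-(b / 2 / τ) * (y - x) ^ 2))
          + M₃ * (C * τ ^ ((2 * β + α) / 2) * Real.exp (-(b / 2 / τ) * (y - x) ^ 2))) := by
          refine mul_le_mul_of_nonneg_left (add_le_add (add_le_add
            (mul_le_mul_of_nonneg_left (H _ hα.le (by linarith) τ hτ hτT _) h1)
            (mul_le_mul_of_nonneg_left (H _ (by linarith) (by linarith) τ hτ hτT _) h2))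
            (mul_le_mul_of_nonneg_left (H _ (by linarith) hβα τ hτ hτT _) h3)) (by positivity)
      _ = _ := by rw [hA]; ring
  have hmeas : AEStronglyMeasurable (fun y => k (x - y) * F y) volume :=
    (hk.comp (continuous_const.sub continuous_id)).aestronglyMeasurable.mul hF
  have hint : Integrable (fun y => k (x - y) * F y) :=
    hgint.mono' hmeas (Filter.Eventually.of_forall fun y => by rw [Real.norm_eq_abs]; exact hbd y)
  refine ⟨hint, ?_⟩
  calc ∫ y, |k (x - y) * F y| ≤ ∫ y, m * (τ * Real.sqrt τ)⁻¹ * (C * A)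
        * Real.exp (-(b / 2 / τ) * (y - x) ^ 2) := integral_mono hint.abs hgint hbd
    _ = m * (τ * Real.sqrt τ)⁻¹ * (C * A) * Real.sqrt (Real.pi / (b / 2 / τ)) := by
        rw [integral_const_mul, integral_sub_right_eq_self (fun y => Real.exp (-(b / 2 / τ) * y ^ 2)),
          integral_gaussian]
    _ = C * Real.sqrt (2 * Real.pi / b) * m * (τ⁻¹ * A) := by
        have : Real.pi / (b / 2 / τ) = 2 * Real.pi / b * τ := by field_simp
        have hs : 0 < Real.sqrt τ := Real.sqrt_pos.2 hτ
        rw [this, Real.sqrt_mul (by have := Real.pi_pos; positivity)]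
        field_simp
    _ = _ := by
        congr 1
        rw [hA, decay, Real.rpow_add hτ, Real.rpow_add hτ, Real.rpow_add hτ, Real.rpow_neg_one]
        rw [show 2 * α / 2 = α by ring, show (2 * β + α) / 2 = β + α / 2 by ring]
        ring

/-! ### Exact integrals of the heat kernel -/

theorem integrable_heatKernel {σ τ : ℝ} (hσ : 0 < σ) (hτ : 0 < τ) :
    Integrable (heatKernel σ τ) := by
  have : 0 < 1 / (2 * σ ^ 2 * τ) := by positivity
  refine ((integrable_exp_neg_mul_sq this).const_mul
    (1 / Real.sqrt (2 * Real.pi * σ ^ 2 * τ))).congr (Filter.Eventually.of_forall fun z => ?_)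
  simp only [heatKernel]
  congr 2
  ring

theorem integral_heatKernel {σ τ : ℝ} (hσ : 0 < σ) (hτ : 0 < τ) :
    ∫ z, heatKernel σ τ z = 1 := by
  have hp := Real.pi_pos
  have e : ∀ z, heatKernel σ τ z = 1 / Real.sqrt (2 * Real.pi * σ ^ 2 * τ)
      * Real.exp (-(1 / (2 * σ ^ 2 * τ)) * z ^ 2) := fun z => by
    simp only [heatKernel]; congr 2; ring
  simp_rw [e]
  rw [integral_const_mul, integral_gaussian]
  have : Real.pi / (1 / (2 * σ ^ 2 * τ)) = 2 * Real.pi * σ ^ 2 * τ := by field_simp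
  rw [this, one_div, inv_mul_cancel₀ (Real.sqrt_pos.2 (by positivity)).ne']

theorem integrable_of_le_gaussEnv {σ τ m : ℝ} (hσ : 0 < σ) (hτ : 0 < τ) {k : ℝ → ℝ}
    (hk : Continuous k) (h : ∀ z, |k z| ≤ m * gaussEnv σ τ z) : Integrable k := by
  have hb := gaussRate_pos hσ
  have : 0 < gaussRate σ / τ := by positivity
  refine ((integrable_exp_neg_mul_sq this).const_mul (m * (τ * Real.sqrt τ)⁻¹)).mono'
    hk.aestronglyMeasurable (Filter.Eventually.of_forall fun z => ?_)
  rw [Real.norm_eq_abs]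
  refine (h z).trans (le_of_eq ?_)
  rw [gaussEnv, ← mul_assoc]
  congr 2
  ring

theorem integrable_heatKernelXX {σ τ : ℝ} (hσ : 0 < σ) (hτ : 0 < τ) :
    Integrable (heatKernelXX σ τ) := by
  obtain ⟨C, _, h⟩ := heatKernel_bounds hσ
  exact integrable_of_le_gaussEnv hσ hτ (continuous_heatKernelXX σ τ) (h τ hτ).1

theorem integral_heatKernelXX {σ τ : ℝ} (hσ : 0 < σ) (hτ : 0 < τ) :
    ∫ z, heatKernelXX σ τ z = 0 := by
  refine integral_eq_zero_of_hasDerivAt_of_integrable (hasDerivAt_heatKernelX σ τ)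
    (integrable_heatKernelXX hσ hτ) ?_
  obtain ⟨C, hC, h⟩ := heatKernel_bounds hσ
  have hb : 0 < 1 / (2 * σ ^ 2 * τ) := by positivity
  have := (integrable_mul_exp_neg_mul_sq hb).const_mul
    (-(1 / (σ ^ 2 * τ)) * (1 / Real.sqrt (2 * Real.pi * σ ^ 2 * τ)))
  refine this.congr (Filter.Eventually.of_forall fun z => ?_)
  simp only [heatKernel]
  rw [show -(z ^ 2) / (2 * σ ^ 2 * τ) = -(1 / (2 * σ ^ 2 * τ)) * z ^ 2 by ring]
  ring

theorem integral_heatKernelXX_sub {σ τ : ℝ} (hσ : 0 < σ) (hτ : 0 < τ) (x : ℝ) :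
    ∫ y, heatKernelXX σ τ (x - y) = 0 := by
  rw [integral_sub_left_eq_self (heatKernelXX σ τ) volume x, integral_heatKernelXX hσ hτ]

/-- Off the diagonal `exp(-q) ≤ 1/q` removes one power of the singularity in `τ`, enough for
integrability of `∂²p` and for `p_τ → 0` at `τ = 0`. -/
theorem gaussEnv_le {σ τ z : ℝ} (hσ : 0 < σ) (hτ : 0 < τ) (hz : z ≠ 0) :
    τ * gaussEnv σ τ z ≤ (gaussRate σ * z ^ 2)⁻¹ * Real.sqrt τ := by
  have hb := gaussRate_pos hσ
  have hz2 : 0 < z ^ 2 := by positivity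
  have hs : 0 < Real.sqrt τ := Real.sqrt_pos.2 hτ
  have hss : Real.sqrt τ * Real.sqrt τ = τ := Real.mul_self_sqrt hτ.le
  set q := gaussRate σ * (z ^ 2 / τ) with hq
  have hq0 : 0 < q := by positivity
  have h1 : Real.exp (-q) ≤ q⁻¹ := by
    rw [Real.exp_neg]
    gcongr
    linarith [Real.add_one_le_exp q]
  calc τ * gaussEnv σ τ z ≤ τ * ((τ * Real.sqrt τ)⁻¹ * q⁻¹) := by
        unfold gaussEnv; gcongr
    _ = _ := by
        rw [hq]
        field_simp
        rw [sq, hss]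

/-- By the heat equation the integrand is an exact time derivative. The endpoint `τ = 0` contributes
nothing: for `z ≠ 0` the kernel extends continuously by its default value `0`. -/
theorem integral_time_heatKernelXX {σ t z : ℝ} (hσ : 0 < σ) (ht : 0 ≤ t) (hz : z ≠ 0) :
    ∫ τ in (0 : ℝ)..t, heatKernelXX σ τ z = 2 / σ ^ 2 * heatKernel σ t z := by
  obtain ⟨C, hC, hk⟩ := heatKernel_bounds hσ
  have hb := gaussRate_pos hσ
  set D := C * (gaussRate σ * z ^ 2)⁻¹ with hD
  have hD0 : 0 ≤ D := by positivity
  have p1 : ∀ τ, 0 < τ → |heatKernel σ τ z| ≤ D * Real.sqrt τ := fun τ hτ => by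
    refine ((hk τ hτ).2.2.2.1 z).trans ?_
    rw [mul_assoc, hD, mul_assoc]
    exact mul_le_mul_of_nonneg_left (gaussEnv_le hσ hτ hz) hC.le
  have p2 : ∀ τ, 0 < τ → |heatKernelXX σ τ z| ≤ D * τ ^ (-(1 / 2) : ℝ) := fun τ hτ => by
    refine ((hk τ hτ).1 z).trans ?_
    rw [hD, mul_assoc]
    gcongr
    have := gaussEnv_le hσ hτ hz
    have h2 : τ * ((gaussRate σ * z ^ 2)⁻¹ * τ ^ (-(1 / 2) : ℝ))
        = (gaussRate σ * z ^ 2)⁻¹ * Real.sqrt τ := by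
      rw [Real.sqrt_eq_rpow, mul_left_comm]
      congr 1
      nth_rewrite 1 [← Real.rpow_one τ]
      rw [← Real.rpow_add hτ]; norm_num
    rw [← h2] at this
    exact le_of_mul_le_mul_left this hτ
  have hcont : ContinuousOn (fun τ => heatKernel σ τ z) (Set.Icc 0 t) := by
    intro τ hτ
    rcases hτ.1.eq_or_lt with h0 | h0
    · subst h0
      have hlim : Filter.Tendsto (fun τ => D * Real.sqrt τ) (nhdsWithin 0 (Set.Icc 0 t)) (nhds 0) := by
        have : ContinuousAt (fun τ => D * Real.sqrt τ) 0 :=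
          (continuous_const.mul Real.continuous_sqrt).continuousAt
        have h := this.tendsto
        simp only [Real.sqrt_zero, mul_zero] at h
        exact h.mono_left nhdsWithin_le_nhds
      rw [ContinuousWithinAt, heatKernel_zero]
      refine squeeze_zero_norm' ?_ hlim
      filter_upwards [self_mem_nhdsWithin] with τ hτ'
      rw [Real.norm_eq_abs]
      rcases hτ'.1.eq_or_lt with h | h
      · rw [← h, heatKernel_zero]; simp
      · exact p1 τ h
    · exact (hasDerivAt_heatKernel_time hσ h0 z).continuousAt.continuousWithinAt
  have hmeas : Measurable fun τ => heatKernelXX σ τ z :=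
    (measurable_heatKernelXX σ).comp (measurable_id.prodMk measurable_const)
  have hint : IntervalIntegrable (fun τ => heatKernelXX σ τ z) volume 0 t := by
    rw [intervalIntegrable_iff_integrableOn_Ioc_of_le ht]
    have h1 : IntegrableOn (fun τ : ℝ => D * τ ^ (-(1 / 2) : ℝ)) (Set.Ioc 0 t) volume := by
      rw [← intervalIntegrable_iff_integrableOn_Ioc_of_le ht]
      exact (intervalIntegral.intervalIntegrable_rpow' (by norm_num)).const_mul D
    refine h1.mono' hmeas.aestronglyMeasurable ?_
    filter_upwards [ae_restrict_mem measurableSet_Ioc] with τ hτ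
    rw [Real.norm_eq_abs]
    exact p2 τ hτ.1
  have := intervalIntegral.integral_eq_sub_of_hasDerivAt_of_le ht hcont
    (fun τ hτ => hasDerivAt_heatKernel_time hσ hτ.1 z) (hint.const_mul (σ ^ 2 / 2))
  rw [intervalIntegral.integral_const_mul, heatKernel_zero, sub_zero] at this
  rw [← this]
  field_simp

/-! ### Averages of two-point functions against the second derivative of the heat kernel -/

theorem heatConv_bounds {α β σ c T : ℝ} (hα : 0 < α) (hα1 : α ≤ 1) (hβ : 0 < β)
    (hβα : 2 * β + α ≤ 2) (hσ : 0 < σ) (hT : 0 < T) :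
    ∃ C, 0 < C ∧ ∀ τ, 0 < τ → τ ≤ T → ∀ (F : ℝ → ℝ) (x M₁ M₂ M₃ : ℝ), 0 ≤ M₁ →
      0 ≤ M₂ → 0 ≤ M₃ → AEStronglyMeasurable F volume →
      (∀ y, |F y| ≤ growth α β c M₁ M₂ M₃ (y - x)) →
      (Integrable (fun y => heatKernelXX σ τ (x - y) * F y) ∧
        ∫ y, |heatKernelXX σ τ (x - y) * F y| ≤ C * decay α β M₁ M₂ M₃ τ) ∧
      (∀ h, |h| ≤ Real.sqrt τ → Integrable (fun y => heatKernelXX σ τ (x + h - y) * F y) ∧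
        |∫ y, (heatKernelXX σ τ (x + h - y) - heatKernelXX σ τ (x - y)) * F y|
          ≤ C * (|h| / Real.sqrt τ) * decay α β M₁ M₂ M₃ τ) ∧
      (∀ δ, 0 ≤ δ → δ ≤ τ →
        |∫ y, (heatKernelXX σ (τ + δ) (x - y) - heatKernelXX σ τ (x - y)) * F y|
          ≤ C * (δ / τ) * decay α β M₁ M₂ M₃ τ) ∧
      (Integrable (fun y => heatKernel σ τ (x - y) * F y) ∧
        |∫ y, heatKernel σ τ (x - y) * F y| ≤ C * τ * decay α β M₁ M₂ M₃ τ) ∧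
      (∀ h, |h| ≤ Real.sqrt τ → Integrable (fun y => heatKernel σ τ (x + h - y) * F y) ∧
        |∫ y, (heatKernel σ τ (x + h - y) - heatKernel σ τ (x - y)) * F y|
          ≤ C * (|h| / Real.sqrt τ) * τ * decay α β M₁ M₂ M₃ τ) := by
  obtain ⟨Ck, hCk, hk⟩ := heatKernel_bounds hσ
  obtain ⟨Cc, hCc, hc⟩ := integral_conv_le (c := c) hα hα1 hβ hβα hσ hT
  refine ⟨Cc * Ck, by positivity, ?_⟩
  intro τ hτ hτT F x M₁ M₂ M₃ h1 h2 h3 hF hFb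
  obtain ⟨k1, k2, k3, k4, k5⟩ := hk τ hτ
  have hs : 0 < Real.sqrt τ := Real.sqrt_pos.2 hτ
  have main : ∀ (k : ℝ → ℝ) (m : ℝ), 0 ≤ m → Continuous k → (∀ z, |k z| ≤ m * gaussEnv σ τ z) →
      Integrable (fun y => k (x - y) * F y) ∧
        ∫ y, |k (x - y) * F y| ≤ Cc * m * decay α β M₁ M₂ M₃ τ :=
    fun k m hm hkc hkb => hc τ hτ hτT k F x m M₁ M₂ M₃ hm h1 h2 h3 hkc hF hkb hFb
  have cX := continuous_heatKernelXX σ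
  have cP := continuous_heatKernel σ
  have m1 := main _ Ck hCk.le (cX τ) k1
  have m4 := main _ (Ck * τ) (by positivity) (cP τ) k4
  refine ⟨⟨m1.1, m1.2.trans (le_of_eq (by ring))⟩, fun h hh => ?_, fun δ h0 hδ => ?_,
    ⟨m4.1, (abs_integral_le_integral_abs).trans (m4.2.trans (le_of_eq (by ring)))⟩, fun h hh => ?_⟩
  · have m2 := main (fun z => heatKernelXX σ τ (z + h) - heatKernelXX σ τ z) (Ck * (|h| / Real.sqrt τ))
      (by positivity) (((cX τ).comp (continuous_id.add continuous_const)).sub (cX τ))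
      fun z => k2 z h hh
    have e : ∀ y, x - y + h = x + h - y := fun y => by ring
    simp only [e] at m2
    refine ⟨(m2.1.add m1.1).congr (Filter.Eventually.of_forall fun y => ?_), ?_⟩
    · simp only [Pi.add_apply]; ring
    · exact (abs_integral_le_integral_abs).trans (m2.2.trans (le_of_eq (by ring)))
  · have m3 := main (fun z => heatKernelXX σ (τ + δ) z - heatKernelXX σ τ z) (Ck * (δ / τ))
      (by positivity) ((cX _).sub (cX τ)) fun z => k3 z δ h0 hδ
    exact (abs_integral_le_integral_abs).trans (m3.2.trans (le_of_eq (by ring)))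
  · have m5 := main (fun z => heatKernel σ τ (z + h) - heatKernel σ τ z) (Ck * (|h| / Real.sqrt τ) * τ)
      (by positivity) (((cP τ).comp (continuous_id.add continuous_const)).sub (cP τ))
      fun z => k5 z h hh
    have e : ∀ y, x - y + h = x + h - y := fun y => by ring
    simp only [e] at m5
    refine ⟨(m5.1.add m4.1).congr (Filter.Eventually.of_forall fun y => ?_), ?_⟩
    · simp only [Pi.add_apply]; ring
    · exact (abs_integral_le_integral_abs).trans (m5.2.trans (le_of_eq (by ring)))

/-! ### Heat averages of additive two-point functions -/

/-- An additive two-point function with measurable slices. -/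
structure AdditiveGerm (F : ℝ → ℝ → ℝ) : Prop where
  chain : ∀ x y z, F x z = F x y + F y z
  meas : ∀ x, AEStronglyMeasurable (F x) volume

/-- The average `∫ ∂²p_τ(x - y) F(x, y) dy`. -/
def heatAvg (σ τ : ℝ) (F : ℝ → ℝ → ℝ) (x : ℝ) : ℝ := ∫ y, heatKernelXX σ τ (x - y) * F x y

/-- Since `∂²p_τ` integrates to zero, the constant `F(x', x)` can be dropped. The base point of `F`
is thereby frozen at `x`, and increments of the average become increments of the kernel. -/
theorem AdditiveGerm.heatAvg_eq {F : ℝ → ℝ → ℝ} (hF : AdditiveGerm F) {σ τ : ℝ} (hσ : 0 < σ)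
    (hτ : 0 < τ) {x x' : ℝ} (hint : Integrable fun y => heatKernelXX σ τ (x' - y) * F x y) :
    heatAvg σ τ F x' = ∫ y, heatKernelXX σ τ (x' - y) * F x y := by
  unfold heatAvg
  have e : ∀ y, heatKernelXX σ τ (x' - y) * F x' y
      = heatKernelXX σ τ (x' - y) * F x' x + heatKernelXX σ τ (x' - y) * F x y := fun y => by
    rw [hF.chain x' x y]; ring
  simp_rw [e]
  rw [integral_add (((integrable_heatKernelXX hσ hτ).comp_sub_left x').mul_const _) hint,
    integral_mul_const, integral_heatKernelXX_sub hσ hτ, zero_mul, zero_add]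

theorem le_rpow_of_le_one {q η : ℝ} (hq : 0 ≤ q) (hq1 : q ≤ 1) (hη1 : η ≤ 1) :
    q ≤ q ^ η := by
  rcases hq.eq_or_lt with rfl | h
  · exact Real.rpow_nonneg le_rfl _
  · nth_rewrite 1 [← Real.rpow_one q]
    exact Real.rpow_le_rpow_of_exponent_ge h hq1 hη1

theorem decay_antitone {α β M₁ M₂ M₃ τ τ' : ℝ} (h1 : 0 ≤ M₁) (h2 : 0 ≤ M₂) (h3 : 0 ≤ M₃)
    (hα : α ≤ 1) (hβα : β + α / 2 ≤ 1) (hτ : 0 < τ) (hττ : τ ≤ τ') :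
    decay α β M₁ M₂ M₃ τ' ≤ decay α β M₁ M₂ M₃ τ := by
  unfold decay
  have := Real.rpow_le_rpow_of_nonpos hτ hττ (show -1 + α / 2 ≤ 0 by linarith)
  have := Real.rpow_le_rpow_of_nonpos hτ hττ (show -1 + α ≤ 0 by linarith)
  have := Real.rpow_le_rpow_of_nonpos hτ hττ (show -1 + (β + α / 2) ≤ 0 by linarith)
  gcongr

/-- Size, space increments and time increments of averages of additive two-point functions. -/
theorem heatAvg_bounds {α β σ c T : ℝ} (hα : 0 < α) (hα1 : α ≤ 1) (hβ : 0 < β)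
    (hβα : 2 * β + α ≤ 2) (hσ : 0 < σ) (hT : 0 < T) :
    ∃ C, 0 < C ∧ ∀ τ, 0 < τ → τ ≤ T → ∀ (F : ℝ → ℝ → ℝ), AdditiveGerm F → ∀ (M₁ M₂ M₃ : ℝ), 0 ≤ M₁ →
      0 ≤ M₂ → 0 ≤ M₃ → ∀ x, (∀ y, |F x y| ≤ growth α β c M₁ M₂ M₃ (y - x)) →
      (|heatAvg σ τ F x| ≤ C * decay α β M₁ M₂ M₃ τ) ∧
      (∀ x', (∀ y, |F x' y| ≤ growth α β c M₁ M₂ M₃ (y - x')) → ∀ η : ℝ, 0 ≤ η → η ≤ 1 →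
        |heatAvg σ τ F x' - heatAvg σ τ F x|
          ≤ C * decay α β M₁ M₂ M₃ τ * (|x' - x| / Real.sqrt τ) ^ η) ∧
      (∀ δ, 0 ≤ δ → τ + δ ≤ T → ∀ η : ℝ, 0 ≤ η → η ≤ 1 →
        |heatAvg σ (τ + δ) F x - heatAvg σ τ F x|
          ≤ C * decay α β M₁ M₂ M₃ τ * (δ / τ) ^ η) ∧
      (∀ x' G v v' H M, AdditiveGerm G → 0 ≤ M → 0 ≤ H →
        (∀ y, |G x y| ≤ growth α β c M 0 0 (y - x)) →
        (∀ y, |G x' y| ≤ growth α β c M 0 0 (y - x')) →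
        (∀ y, |F x y - v * G x y| ≤ growth α β c 0 M₂ M₃ (y - x)) →
        (∀ y, |F x' y - v' * G x' y| ≤ growth α β c 0 M₂ M₃ (y - x')) →
        |v' - v| ≤ H * |x' - x| ^ β → 2 * β ≤ 1 →
        |heatAvg σ τ F x' - heatAvg σ τ F x - v * (heatAvg σ τ G x' - heatAvg σ τ G x)|
          ≤ C * decay α β 0 M₂ M₃ τ * (|x' - x| / Real.sqrt τ) ^ (2 * β)
            + C * (H * |x' - x| ^ β * (M * τ ^ (-1 + α / 2)) * (|x' - x| / Real.sqrt τ) ^ β)) := by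
  obtain ⟨C, hC, hb⟩ := heatConv_bounds (c := c) hα hα1 hβ hβα hσ hT
  refine ⟨2 * C, by positivity, ?_⟩
  intro τ hτ hτT F hF M₁ M₂ M₃ h1 h2 h3 x hx
  have hs : 0 < Real.sqrt τ := Real.sqrt_pos.2 hτ
  have hd := decay_nonneg (α := α) (β := β) h1 h2 h3 hτ.le
  have bX := hb τ hτ hτT (F x) x M₁ M₂ M₃ h1 h2 h3 (hF.meas x) hx
  have sz : ∀ τ, 0 < τ → τ ≤ T → ∀ F : ℝ → ℝ → ℝ, AdditiveGerm F → ∀ (M₁ M₂ M₃ : ℝ), 0 ≤ M₁ →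
      0 ≤ M₂ → 0 ≤ M₃ → ∀ x, (∀ y, |F x y| ≤ growth α β c M₁ M₂ M₃ (y - x)) →
      |heatAvg σ τ F x| ≤ C * decay α β M₁ M₂ M₃ τ := fun τ hτ hτT F hF M₁ M₂ M₃ h1 h2 h3 x hx =>
    (abs_integral_le_integral_abs).trans
      (hb τ hτ hτT (F x) x M₁ M₂ M₃ h1 h2 h3 (hF.meas x) hx).1.2
  have sF := sz τ hτ hτT F hF M₁ M₂ M₃ h1 h2 h3 x hx
  -- Beyond distance `√τ` the ratio is at least `1`, so the size of the two averages is already a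
  -- sufficient bound; below it, the ratio is at most its `η`-th power.
  have far : ∀ x' η : ℝ, 0 ≤ η → ¬ |x' - x| ≤ Real.sqrt τ → 1 ≤ (|x' - x| / Real.sqrt τ) ^ η :=
    fun x' η hη hh => Real.one_le_rpow ((one_le_div hs).2 (not_le.1 hh).le) hη
  have near : ∀ x' η : ℝ, η ≤ 1 → |x' - x| ≤ Real.sqrt τ →
      |x' - x| / Real.sqrt τ ≤ (|x' - x| / Real.sqrt τ) ^ η :=
    fun x' η hη hh => le_rpow_of_le_one (by positivity) ((div_le_one hs).2 hh) hη
  have diffEq : ∀ F : ℝ → ℝ → ℝ, AdditiveGerm F → ∀ (M₁ M₂ M₃ : ℝ), 0 ≤ M₁ →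
      0 ≤ M₂ → 0 ≤ M₃ → (∀ y, |F x y| ≤ growth α β c M₁ M₂ M₃ (y - x)) →
      ∀ x', |x' - x| ≤ Real.sqrt τ →
      Integrable (fun y => (heatKernelXX σ τ (x' - y) - heatKernelXX σ τ (x - y)) * F x y) ∧
      heatAvg σ τ F x' - heatAvg σ τ F x
        = ∫ y, (heatKernelXX σ τ (x' - y) - heatKernelXX σ τ (x - y)) * F x y := by
    intro F hF M₁ M₂ M₃ h1 h2 h3 hx x' hh
    have b := hb τ hτ hτT (F x) x M₁ M₂ M₃ h1 h2 h3 (hF.meas x) hx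
    have i2 := (b.2.1 (x' - x) hh).1
    rw [add_sub_cancel] at i2
    have e := integral_sub i2 b.1.1
    have i := i2.sub b.1.1
    simp only [← sub_mul] at e
    refine ⟨i.congr (Filter.Eventually.of_forall fun y => ?_), ?_⟩
    · simp only [Pi.sub_apply]; ring
    · rw [e, hF.heatAvg_eq hσ hτ i2, heatAvg]
  refine ⟨sF.trans (by nlinarith), ?_, ?_, ?_⟩
  · intro x' hx' η hη0 hη1
    by_cases hh : |x' - x| ≤ Real.sqrt τ
    · rw [(diffEq F hF M₁ M₂ M₃ h1 h2 h3 hx x' hh).2]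
      have b := (bX.2.1 (x' - x) hh).2
      rw [add_sub_cancel] at b
      refine b.trans ?_
      have hn := near x' η hη1 hh
      have hq0 : 0 ≤ (|x' - x| / Real.sqrt τ) ^ η := by positivity
      calc C * (|x' - x| / Real.sqrt τ) * decay α β M₁ M₂ M₃ τ
          ≤ C * (|x' - x| / Real.sqrt τ) ^ η * decay α β M₁ M₂ M₃ τ := by gcongr
        _ = C * decay α β M₁ M₂ M₃ τ * (|x' - x| / Real.sqrt τ) ^ η := by ring
        _ ≤ _ := by gcongr; linarith
    · have hf := far x' η hη0 hh
      have s' := sz τ hτ hτT F hF M₁ M₂ M₃ h1 h2 h3 x' hx'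
      calc _ ≤ |heatAvg σ τ F x'| + |heatAvg σ τ F x| := abs_sub _ _
        _ ≤ 2 * C * decay α β M₁ M₂ M₃ τ * 1 := by linarith
        _ ≤ _ := by gcongr
  · intro δ h0 hδT η hη0 hη1
    by_cases hh : δ ≤ τ
    · have b := bX.2.2.1 δ h0 hh
      have i2 := (hb (τ + δ) (by linarith) hδT (F x) x M₁ M₂ M₃ h1 h2 h3 (hF.meas x) hx).1.1
      have e := integral_sub i2 bX.1.1
      simp only [← sub_mul] at e
      rw [e] at b
      refine b.trans ?_
      have hn : δ / τ ≤ (δ / τ) ^ η := le_rpow_of_le_one (by positivity) ((div_le_one hτ).2 hh) hη1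
      calc C * (δ / τ) * decay α β M₁ M₂ M₃ τ
          ≤ C * (δ / τ) ^ η * decay α β M₁ M₂ M₃ τ := by gcongr
        _ = C * decay α β M₁ M₂ M₃ τ * (δ / τ) ^ η := by ring
        _ ≤ _ := by gcongr; linarith
    · have hf : 1 ≤ (δ / τ) ^ η := Real.one_le_rpow ((one_le_div hτ).2 (not_le.1 hh).le) hη0
      have s' := sz (τ + δ) (by linarith) hδT F hF M₁ M₂ M₃ h1 h2 h3 x hx
      have ha : decay α β M₁ M₂ M₃ (τ + δ) ≤ decay α β M₁ M₂ M₃ τ :=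
        decay_antitone h1 h2 h3 hα1 (by linarith) hτ (by linarith)
      have s'' : |heatAvg σ (τ + δ) F x| ≤ C * decay α β M₁ M₂ M₃ τ := s'.trans (by gcongr)
      calc _ ≤ |heatAvg σ (τ + δ) F x| + |heatAvg σ τ F x| := abs_sub _ _
        _ ≤ 2 * C * decay α β M₁ M₂ M₃ τ * 1 := by linarith
        _ ≤ _ := by gcongr
  · intro x' G v v' H M hG hM hH hGx hGx' hJ hJ' hv h2β
    have hd' := decay_nonneg (α := α) (β := β) le_rfl h2 h3 hτ.le
    have hterm : 0 ≤ 2 * C * (H * |x' - x| ^ β * (M * τ ^ (-1 + α / 2))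
        * (|x' - x| / Real.sqrt τ) ^ β) := by positivity
    have mJ : ∀ x v, AEStronglyMeasurable (fun y => F x y - v * G x y) volume :=
      fun x v => (hF.meas x).sub ((hG.meas x).const_mul v)
    have bJ := hb τ hτ hτT _ x 0 M₂ M₃ le_rfl h2 h3 (mJ x v) hJ
    by_cases hh : |x' - x| ≤ Real.sqrt τ
    · obtain ⟨iF, eF⟩ := diffEq F hF M₁ M₂ M₃ h1 h2 h3 hx x' hh
      obtain ⟨iG, eG⟩ := diffEq G hG M 0 0 hM le_rfl le_rfl hGx x' hh
      rw [eF, eG, ← integral_const_mul, ← integral_sub iF (iG.const_mul v)]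
      have b := (bJ.2.1 (x' - x) hh).2
      rw [add_sub_cancel] at b
      have e : ∀ y, (heatKernelXX σ τ (x' - y) - heatKernelXX σ τ (x - y)) * F x y
          - v * ((heatKernelXX σ τ (x' - y) - heatKernelXX σ τ (x - y)) * G x y)
          = (heatKernelXX σ τ (x' - y) - heatKernelXX σ τ (x - y)) * (F x y - v * G x y) :=
        fun y => by ring
      simp_rw [e]
      refine b.trans ?_
      have hn := near x' (2 * β) h2β hh
      calc C * (|x' - x| / Real.sqrt τ) * decay α β 0 M₂ M₃ τ
          ≤ C * (|x' - x| / Real.sqrt τ) ^ (2 * β) * decay α β 0 M₂ M₃ τ := by gcongr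
        _ = C * decay α β 0 M₂ M₃ τ * (|x' - x| / Real.sqrt τ) ^ (2 * β) := by ring
        _ ≤ 2 * C * decay α β 0 M₂ M₃ τ * (|x' - x| / Real.sqrt τ) ^ (2 * β) := by
            gcongr; linarith
        _ ≤ _ := le_add_of_nonneg_right hterm
    · have hf := far x' (2 * β) (by linarith) hh
      have hf' := far x' β hβ.le hh
      have bJ' := hb τ hτ hτT _ x' 0 M₂ M₃ le_rfl h2 h3 (mJ x' v') hJ'
      have bG := hb τ hτ hτT _ x M 0 0 hM le_rfl le_rfl (hG.meas x) hGx
      have bG' := hb τ hτ hτT _ x' M 0 0 hM le_rfl le_rfl (hG.meas x') hGx'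
      -- For distant points each average is expanded with its own coefficient, `v` or `v'`. The
      -- mismatch `(v' - v) heatAvg G x'` gives the last term of the estimate.
      have split : ∀ x v, Integrable (fun y => heatKernelXX σ τ (x - y) * (F x y - v * G x y)) →
          Integrable (fun y => heatKernelXX σ τ (x - y) * G x y) →
          heatAvg σ τ F x = (∫ y, heatKernelXX σ τ (x - y) * (F x y - v * G x y))
            + v * heatAvg σ τ G x := by
        intro x v i1 i2
        rw [heatAvg, heatAvg, ← integral_const_mul, ← integral_add i1 (i2.const_mul v)]
        refine integral_congr_ae (Filter.Eventually.of_forall fun y => ?_)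
        simp only; ring
      rw [split x v bJ.1.1 bG.1.1, split x' v' bJ'.1.1 bG'.1.1]
      have n1 := (abs_integral_le_integral_abs).trans bJ.1.2
      have n1' := (abs_integral_le_integral_abs).trans bJ'.1.2
      have nG : |heatAvg σ τ G x'| ≤ C * (M * τ ^ (-1 + α / 2)) := by
        have := (abs_integral_le_integral_abs).trans bG'.1.2
        unfold heatAvg
        simpa [decay] using this
      set A := ∫ y, heatKernelXX σ τ (x - y) * (F x y - v * G x y)
      set A' := ∫ y, heatKernelXX σ τ (x' - y) * (F x' y - v' * G x' y)
      have e : A' + v' * heatAvg σ τ G x' - (A + v * heatAvg σ τ G x)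
          - v * (heatAvg σ τ G x' - heatAvg σ τ G x) = (A' - A) + (v' - v) * heatAvg σ τ G x' := by
        ring
      rw [e]
      calc _ ≤ |A' - A| + |(v' - v) * heatAvg σ τ G x'| := abs_add_le _ _
        _ ≤ (|A'| + |A|) + (H * |x' - x| ^ β) * (C * (M * τ ^ (-1 + α / 2))) := by
            rw [abs_mul]
            exact add_le_add (abs_sub _ _) (mul_le_mul hv nG (abs_nonneg _) (by positivity))
        _ ≤ 2 * C * decay α β 0 M₂ M₃ τ * 1
            + 2 * C * (H * |x' - x| ^ β * (M * τ ^ (-1 + α / 2)) * 1) := by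
            have : 0 ≤ C * (H * |x' - x| ^ β * (M * τ ^ (-1 + α / 2))) := by positivity
            nlinarith
        _ ≤ _ := by gcongr

/-! ### Integration of the weights in time -/

/-- A function of the two parts `s`, `τ` of a time interval, integrable at both ends. -/
def endSing (ε s τ : ℝ) : ℝ := s ^ (-1 + ε) + τ ^ (-1 + ε)

theorem endSing_nonneg {ε s τ : ℝ} (hs : 0 ≤ s) (hτ : 0 ≤ τ) : 0 ≤ endSing ε s τ := by
  unfold endSing; positivity

theorem exp_neg_le_rpow_neg {x η : ℝ} (hx : 0 < x) (h0 : 0 ≤ η) (h1 : η ≤ 1) :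
    Real.exp (-x) ≤ x ^ (-η) := by
  rw [Real.exp_neg, Real.rpow_neg hx.le]
  have h2 : x ^ η ≤ Real.exp x := by
    have := Real.add_one_le_exp x
    rcases le_total x 1 with h | h
    · have := Real.rpow_le_one hx.le h h0
      linarith
    · have h3 := Real.rpow_le_rpow_of_exponent_le h h1
      rw [Real.rpow_one] at h3
      linarith
  have := Real.rpow_pos_of_pos hx η
  gcongr

theorem rpow_le_one_add {x T κ : ℝ} (hx : 0 ≤ x) (hxT : x ≤ T) (h0 : 0 ≤ κ) (h1 : κ ≤ 1) :
    x ^ κ ≤ 1 + T := by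
  rcases le_total x 1 with h | h
  · have := Real.rpow_le_one hx h h0
    linarith
  · have h3 := Real.rpow_le_rpow_of_exponent_le h h1
    rw [Real.rpow_one] at h3
    linarith

/-- Both exponents are nonpositive, so replacing `s` and `τ` by the smaller of them only increases
the product. What remains is one power with exponent at least `-1 + ε`. -/
theorem rpow_mul_rpow_le_endSing {s τ T q r ε : ℝ} (hs : 0 < s) (hτ : 0 < τ) (hsT : s ≤ T)
    (hτT : τ ≤ T) (hq : 0 ≤ q) (hr : r ≤ 1) (hε : 0 < ε) (h : ε ≤ r - q) :
    s ^ (-q) * τ ^ (-1 + r) ≤ (1 + T) * endSing ε s τ := by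
  have key : ∀ x, 0 < x → x ≤ T → x ^ (-q) * x ^ (-1 + r) ≤ (1 + T) * x ^ (-1 + ε) := by
    intro x hx hxT
    have e : x ^ (-q) * x ^ (-1 + r) = x ^ (r - q - ε) * x ^ (-1 + ε) := by
      rw [← Real.rpow_add hx, ← Real.rpow_add hx]; ring_nf
    rw [e]
    gcongr
    exact rpow_le_one_add hx.le hxT (by linarith) (by linarith)
  have hT : 0 < T := by linarith
  have ps := Real.rpow_pos_of_pos hs (-1 + ε)
  have pτ := Real.rpow_pos_of_pos hτ (-1 + ε)
  unfold endSing
  rcases le_total τ s with h1 | h1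
  · calc s ^ (-q) * τ ^ (-1 + r) ≤ τ ^ (-q) * τ ^ (-1 + r) := by
          gcongr ?_ * _
          exact Real.rpow_le_rpow_of_nonpos hτ h1 (by linarith)
      _ ≤ _ := key τ hτ hτT
      _ ≤ _ := by gcongr; linarith
  · calc s ^ (-q) * τ ^ (-1 + r) ≤ s ^ (-q) * s ^ (-1 + r) := by
          gcongr _ * ?_
          exact Real.rpow_le_rpow_of_nonpos hs h1 (by linarith)
      _ ≤ _ := key s hs hsT
      _ ≤ _ := by gcongr; linarith

theorem weightE_eq_mul_exp (θ lam a s τ : ℝ) :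
    weightE θ lam a s
      = weightE θ lam a (s + τ) * (Real.exp (-(lam * τ)) * Real.exp (-(θ * a * τ))) := by
  unfold weightE
  rw [← Real.exp_add, ← Real.exp_add]
  ring_nf

/-- The exchange of powers: `exp(-λτ)` yields `λ^(-η₁)` for `η₁` powers of `τ`, and `exp(-θaτ)`
yields `a^(-η₂)` for `η₂` powers. The growth of the weight in `θat` exists for the second exchange.
The condition on `ε` says that the remaining singularities are integrable at both ends. -/
theorem weight_monomial_le {θ lam a s τ T p l q r η₁ η₂ p' ε : ℝ} (hθ : 1 ≤ θ) (hlam : 1 ≤ lam)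
    (ha : 1 ≤ a) (hs : 0 < s) (hτ : 0 < τ) (hsT : s ≤ T) (hτT : τ ≤ T) (hq : 0 ≤ q) (hε : 0 < ε)
    (h₁ : 0 ≤ η₁) (h₁' : η₁ ≤ 1) (h₂ : 0 ≤ η₂) (h₂' : η₂ ≤ 1) (hr : r - η₁ - η₂ ≤ 1)
    (hrε : ε ≤ r - η₁ - η₂ - q) (hp : p - η₂ ≤ p') :
    weightE θ lam a s * (a ^ p * lam ^ l * s ^ (-q) * τ ^ (-1 + r))
      ≤ weightE θ lam a (s + τ) * (a ^ p' * lam ^ (l - η₁)) * ((1 + T) * endSing ε s τ) := by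
  have ha0 : 0 < a := by linarith
  have hl0 : 0 < lam := by linarith
  have e1 : Real.exp (-(lam * τ)) ≤ lam ^ (-η₁) * τ ^ (-η₁) := by
    rw [← Real.mul_rpow hl0.le hτ.le]
    exact exp_neg_le_rpow_neg (by positivity) h₁ h₁'
  have e2 : Real.exp (-(θ * a * τ)) ≤ a ^ (-η₂) * τ ^ (-η₂) := by
    rw [← Real.mul_rpow ha0.le hτ.le]
    refine le_trans (Real.exp_le_exp.2 ?_) (exp_neg_le_rpow_neg (by positivity) h₂ h₂')
    have : a * τ ≤ θ * (a * τ) := le_mul_of_one_le_left (by positivity) hθ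
    linarith
  have hE := weightE_pos θ lam a (s + τ)
  have e3 := rpow_mul_rpow_le_endSing (r := r - η₁ - η₂) hs hτ hsT hτT hq hr hε hrε
  have e4 : a ^ p * a ^ (-η₂) ≤ a ^ p' := by
    rw [← Real.rpow_add ha0]
    exact Real.rpow_le_rpow_of_exponent_le ha (by linarith)
  have e5 : τ ^ (-1 + r) * τ ^ (-η₁) * τ ^ (-η₂) = τ ^ (-1 + (r - η₁ - η₂)) := by
    rw [← Real.rpow_add hτ, ← Real.rpow_add hτ]; ring_nf
  have e6 : lam ^ (l - η₁) = lam ^ l * lam ^ (-η₁) := by rw [← Real.rpow_add hl0]; ring_nf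
  have e3' : 0 ≤ s ^ (-q) * τ ^ (-1 + (r - η₁ - η₂)) := by positivity
  rw [weightE_eq_mul_exp θ lam a s τ]
  calc _ ≤ weightE θ lam a (s + τ) * ((lam ^ (-η₁) * τ ^ (-η₁)) * (a ^ (-η₂) * τ ^ (-η₂)))
        * (a ^ p * lam ^ l * s ^ (-q) * τ ^ (-1 + r)) := by gcongr
    _ = weightE θ lam a (s + τ) * ((a ^ p * a ^ (-η₂)) * (lam ^ l * lam ^ (-η₁)))
        * (s ^ (-q) * (τ ^ (-1 + r) * τ ^ (-η₁) * τ ^ (-η₂))) := by ring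
    _ ≤ _ := by
        rw [e5, ← e6]
        gcongr

/-! ### Balance of exponents in the weighted bounds -/

/-- The coefficient of the remainder in the bound on the rough integral. -/
def remCoeff (β χ a s : ℝ) : ℝ := a ^ (2 * χ) * (a ^ (β / 2) + s ^ (-(β / 2)))

/-- The exponent of the singularities at the ends of the time interval. -/
def endExp (α β χ : ℝ) : ℝ := min ((α - β) / 4) (β / 2 - χ)

section
variable {α β χ θ lam a s τ T : ℝ}

theorem endExp_pos (hβα : β < α) (hχβ : χ < β / 2) : 0 < endExp α β χ :=
  lt_min (by linarith) (by linarith)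

theorem decay_rem_eq (m ρ : ℝ) (hτ : 0 < τ) :
    decay α β (m * a ^ χ) (lam ^ ((α - β) / 4) * a ^ (2 * χ))
        (lam ^ ((α - β) / 4) * remCoeff β χ a s) τ * τ ^ (-ρ)
      = m * (a ^ χ * τ ^ (-1 + (α / 2 - ρ)))
        + lam ^ ((α - β) / 4) * a ^ (2 * χ) * τ ^ (-1 + (α - ρ))
        + lam ^ ((α - β) / 4) * remCoeff β χ a s * τ ^ (-1 + (β + α / 2 - ρ)) := by
  have e : ∀ r, τ ^ (-1 + (r - ρ)) = τ ^ (-1 + r) * τ ^ (-ρ) := fun r => by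
    rw [← Real.rpow_add hτ]; ring_nf
  rw [e, e, e, decay]
  ring

variable (hβ : 1 / 3 < β) (hβα : β < α) (hα : α < 1 / 2) (hχ0 : 0 < χ) (hχβ : χ < β / 2)
  (hθ : 1 ≤ θ) (hlam : 1 ≤ lam) (ha : 1 ≤ a) (hs : 0 < s) (hτ : 0 < τ) (hsT : s ≤ T) (hτT : τ ≤ T)

theorem remCoeff_mul (x y : ℝ) (ha : 0 < a) :
    x * remCoeff β χ a s * y = a ^ (2 * χ + β / 2) * x * s ^ (-(0 : ℝ)) * y
      + a ^ (2 * χ) * x * s ^ (-(β / 2)) * y := by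
  rw [remCoeff, neg_zero, Real.rpow_zero, Real.rpow_add ha]; ring

include hβ hβα hα hχ0 hχβ hθ hlam ha hs hτ hsT hτT

/-- There are four monomials, since the remainder coefficient has a regular part and a part
`s^(-β/2)`. To end with `λ^(-γ)`, where `γ = (α-β)/4`, one takes `η₁ = γ` for the first-level term
and `η₁ = 2γ` for those that carry `λ^γ`; `η₂` removes all growth in `a`. The remainder terms leave
`β - 2χ`, positive because `χ < β/2`. -/
theorem weighted_decay_sup_le :
    weightE θ lam a s * decay α β (a ^ χ) (lam ^ ((α - β) / 4) * a ^ (2 * χ))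
        (lam ^ ((α - β) / 4) * remCoeff β χ a s) τ
      ≤ weightE θ lam a (s + τ) * lam ^ (-((α - β) / 4))
        * (4 * (1 + T) * endSing (endExp α β χ) s τ) := by
  have hε := endExp_pos (α := α) (β := β) (χ := χ) hβα hχβ
  have hε1 : endExp α β χ ≤ (α - β) / 4 := min_le_left _ _
  have hε2 : endExp α β χ ≤ β / 2 - χ := min_le_right _ _
  have e := decay_rem_eq (α := α) (β := β) (χ := χ) (lam := lam) (a := a) (s := s) 1 0 hτ
  rw [neg_zero, Real.rpow_zero, mul_one, one_mul, one_mul, sub_zero, sub_zero, sub_zero,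
    remCoeff_mul _ _ (by linarith)] at e
  have t1 := weight_monomial_le (p := χ) (l := 0) (q := 0) (r := α / 2) (η₁ := (α - β) / 4)
    (η₂ := χ) (p' := 0) hθ hlam ha hs hτ hsT hτT le_rfl hε (by linarith) (by linarith)
    (by linarith) (by linarith) (by linarith) (by linarith) (by linarith)
  have t2 := weight_monomial_le (p := 2 * χ) (l := (α - β) / 4) (q := 0) (r := α)
    (η₁ := (α - β) / 2) (η₂ := 2 * χ) (p' := 0) hθ hlam ha hs hτ hsT hτT le_rfl hε (by linarith)
    (by linarith) (by linarith) (by linarith) (by linarith) (by linarith) (by linarith)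
  have t3 := weight_monomial_le (p := 2 * χ + β / 2) (l := (α - β) / 4) (q := 0) (r := β + α / 2)
    (η₁ := (α - β) / 2) (η₂ := 2 * χ + β / 2) (p' := 0) hθ hlam ha hs hτ hsT hτT le_rfl hε
    (by linarith) (by linarith) (by linarith) (by linarith) (by linarith) (by linarith)
    (by linarith)
  have t4 := weight_monomial_le (p := 2 * χ) (l := (α - β) / 4) (q := β / 2) (r := β + α / 2)
    (η₁ := (α - β) / 2) (η₂ := 2 * χ) (p' := 0) hθ hlam ha hs hτ hsT hτT (by linarith) hε
    (by linarith) (by linarith) (by linarith) (by linarith) (by linarith) (by linarith)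
    (by linarith)
  rw [show (α - β) / 4 - (α - β) / 2 = -((α - β) / 4) by ring] at t2 t3 t4
  rw [zero_sub] at t1
  simp only [neg_zero, Real.rpow_zero, mul_one, one_mul] at t1 t2 t3 t4 e
  rw [e]
  calc _ = _ := by ring
    _ ≤ _ := add_le_add (add_le_add t1 t2) (add_le_add t3 t4)
    _ = _ := by ring

/-- The Hölder increment costs `τ^(-β/2)`, but `a^(β/2)` may now remain, so less is spent on `η₂`.
The first monomial leaves exactly `γ` and the last exactly `β/2 - χ`, the two entries of `endExp`.
-/
theorem weighted_decay_hol_le :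
    weightE θ lam a s * (decay α β (a ^ χ) (lam ^ ((α - β) / 4) * a ^ (2 * χ))
        (lam ^ ((α - β) / 4) * remCoeff β χ a s) τ * τ ^ (-(β / 2)))
      ≤ weightE θ lam a (s + τ) * (lam ^ (-((α - β) / 4)) * a ^ (β / 2))
        * (4 * (1 + T) * endSing (endExp α β χ) s τ) := by
  have hε := endExp_pos (α := α) (β := β) (χ := χ) hβα hχβ
  have hε1 : endExp α β χ ≤ (α - β) / 4 := min_le_left _ _
  have hε2 : endExp α β χ ≤ β / 2 - χ := min_le_right _ _
  have e := decay_rem_eq (α := α) (β := β) (χ := χ) (lam := lam) (a := a) (s := s) 1 (β / 2) hτ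
  rw [remCoeff_mul _ _ (by linarith)] at e
  have t1 := weight_monomial_le (p := χ) (l := 0) (q := 0) (r := α / 2 - β / 2)
    (η₁ := (α - β) / 4) (η₂ := 0) (p' := β / 2) hθ hlam ha hs hτ hsT hτT le_rfl hε (by linarith)
    (by linarith) (by linarith) (by linarith) (by linarith) (by linarith) (by linarith)
  have t2 := weight_monomial_le (p := 2 * χ) (l := (α - β) / 4) (q := 0) (r := α - β / 2)
    (η₁ := (α - β) / 2) (η₂ := χ) (p' := β / 2) hθ hlam ha hs hτ hsT hτT le_rfl hε (by linarith)
    (by linarith) (by linarith) (by linarith) (by linarith) (by linarith) (by linarith)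
  have t3 := weight_monomial_le (p := 2 * χ + β / 2) (l := (α - β) / 4) (q := 0)
    (r := β + α / 2 - β / 2)
    (η₁ := (α - β) / 2) (η₂ := 2 * χ) (p' := β / 2) hθ hlam ha hs hτ hsT hτT le_rfl hε
    (by linarith) (by linarith) (by linarith) (by linarith) (by linarith) (by linarith)
    (by linarith)
  have t4 := weight_monomial_le (p := 2 * χ) (l := (α - β) / 4) (q := β / 2)
    (r := β + α / 2 - β / 2)
    (η₁ := (α - β) / 2) (η₂ := χ) (p' := β / 2) hθ hlam ha hs hτ hsT hτT (by linarith) hε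
    (by linarith) (by linarith) (by linarith) (by linarith) (by linarith) (by linarith)
    (by linarith)
  rw [show (α - β) / 4 - (α - β) / 2 = -((α - β) / 4) by ring] at t2 t3 t4
  rw [zero_sub] at t1
  simp only [neg_zero, Real.rpow_zero, mul_one, one_mul] at t1 t2 t3 t4 e
  rw [e]
  calc _ = _ := by ring
    _ ≤ _ := add_le_add (add_le_add t1 t2) (add_le_add t3 t4)
    _ = _ := by ring

/-- The remainder enters `Θ` with `λ^(-γ)`, so it suffices to cancel `λ^γ`. The first level is
absent: `τ^(-1+α/2-β)` would not be integrable. The monomial with `s^(-β/2)` leaves exactly `γ`. -/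
theorem weighted_decay_rem_le :
    weightE θ lam a s * (decay α β 0 (lam ^ ((α - β) / 4) * a ^ (2 * χ))
        (lam ^ ((α - β) / 4) * remCoeff β χ a s) τ * τ ^ (-β))
      ≤ weightE θ lam a (s + τ) * a ^ (χ + β / 2)
        * (3 * (1 + T) * endSing (endExp α β χ) s τ) := by
  have hε := endExp_pos (α := α) (β := β) (χ := χ) hβα hχβ
  have hε1 : endExp α β χ ≤ (α - β) / 4 := min_le_left _ _
  have hε2 : endExp α β χ ≤ β / 2 - χ := min_le_right _ _
  have e := decay_rem_eq (α := α) (β := β) (χ := χ) (lam := lam) (a := a) (s := s) 0 β hτ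
  rw [remCoeff_mul _ _ (by linarith)] at e
  have t2 := weight_monomial_le (p := 2 * χ) (l := (α - β) / 4) (q := 0) (r := α - β)
    (η₁ := (α - β) / 4) (η₂ := 0) (p' := χ + β / 2) hθ hlam ha hs hτ hsT hτT le_rfl hε
    (by linarith) (by linarith) (by linarith) (by linarith) (by linarith) (by linarith)
    (by linarith)
  have t3 := weight_monomial_le (p := 2 * χ + β / 2) (l := (α - β) / 4) (q := 0)
    (r := β + α / 2 - β)
    (η₁ := (α - β) / 4) (η₂ := χ) (p' := χ + β / 2) hθ hlam ha hs hτ hsT hτT le_rfl hε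
    (by linarith) (by linarith) (by linarith) (by linarith) (by linarith) (by linarith)
    (by linarith)
  have t4 := weight_monomial_le (p := 2 * χ) (l := (α - β) / 4) (q := β / 2)
    (r := β + α / 2 - β)
    (η₁ := (α - β) / 4) (η₂ := 0) (p' := χ + β / 2) hθ hlam ha hs hτ hsT hτT (by linarith) hε
    (by linarith) (by linarith) (by linarith) (by linarith) (by linarith) (by linarith)
    (by linarith)
  rw [sub_self] at t2 t3 t4
  simp only [neg_zero, Real.rpow_zero, mul_one, zero_mul, zero_add] at t2 t3 t4 e
  rw [e]
  calc _ = _ := by ring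
    _ ≤ _ := add_le_add t2 (add_le_add t3 t4)
    _ = _ := by ring

omit hχ0 in
theorem weighted_decay_extra_le :
    weightE θ lam a s * τ ^ (-1 + (α / 2 - β / 2))
      ≤ weightE θ lam a (s + τ) * ((1 + T) * endSing (endExp α β χ) s τ) := by
  have hε := endExp_pos (α := α) (β := β) (χ := χ) hβα hχβ
  have hε1 : endExp α β χ ≤ (α - β) / 4 := min_le_left _ _
  have t2 := weight_monomial_le (p := 0) (l := 0) (q := 0) (r := α / 2 - β / 2)
    (η₁ := 0) (η₂ := 0) (p' := 0) hθ hlam ha hs hτ hsT hτT le_rfl hε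
    (by linarith) (by linarith) (by linarith) (by linarith) (by linarith) (by linarith)
    (by linarith)
  simpa using t2

end

theorem intervalIntegrable_endSing {ε t : ℝ} (hε : 0 < ε) :
    IntervalIntegrable (fun s => endSing ε s (t - s)) volume 0 t := by
  unfold endSing
  refine (intervalIntegral.intervalIntegrable_rpow' (by linarith)).add ?_
  have := (intervalIntegral.intervalIntegrable_rpow' (a := 0) (b := t) (r := -1 + ε)
    (by linarith)).comp_sub_left t
  simpa using this.symm

theorem integral_endSing_le {ε t T : ℝ} (hε : 0 < ε) (hε1 : ε ≤ 1) (ht : 0 ≤ t) (htT : t ≤ T) :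
    ∫ s in (0 : ℝ)..t, endSing ε s (t - s) ≤ 2 * (1 + T) / ε := by
  have i1 : IntervalIntegrable (fun s : ℝ => s ^ (-1 + ε)) volume 0 t :=
    intervalIntegral.intervalIntegrable_rpow' (by linarith)
  have i2 : IntervalIntegrable (fun s : ℝ => (t - s) ^ (-1 + ε)) volume 0 t := by
    simpa using (i1.comp_sub_left t).symm
  have e1 : ∫ s in (0 : ℝ)..t, s ^ (-1 + ε) = t ^ ε / ε := by
    rw [integral_rpow (Or.inl (by linarith))]
    simp [Real.zero_rpow hε.ne']
  have e2 : ∫ s in (0 : ℝ)..t, (t - s) ^ (-1 + ε) = t ^ ε / ε := by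
    rw [intervalIntegral.integral_comp_sub_left (fun s => s ^ (-1 + ε)) t]
    simpa using e1
  unfold endSing
  rw [intervalIntegral.integral_add i1 i2, e1, e2]
  have := rpow_le_one_add ht htT hε.le hε1
  rw [← add_div]
  gcongr
  linarith

/-! ### Measurability and joint integrability -/

theorem WeightedBd.continuous {T β θ lam N : ℝ} {f : Set.Icc (0 : ℝ) T → ℝ → ℝ} (hβ : 0 < β)
    (hθ : 0 ≤ θ) (hlam : 0 ≤ lam) (hN : 0 ≤ N) (h : WeightedBd β θ lam f N) :
    Continuous fun p : Set.Icc (0 : ℝ) T × ℝ => f p.1 p.2 := by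
  rw [continuous_iff_continuousAt]
  rintro ⟨s, x⟩
  set a := |x| + 1
  have ha : 1 ≤ a := by simp [a]
  have ha0 : 0 ≤ a := by linarith
  set D := N * weightE θ lam a T * a ^ (β / 2)
  set B : Set.Icc (0 : ℝ) T × ℝ → ℝ := fun p => D * (|(p.1 : ℝ) - s| ^ (β / 2) + |p.2 - x| ^ β)
  have hBc : Continuous B := by
    refine continuous_const.mul (Continuous.add ?_ ?_)
    · exact ((continuous_subtype_val.comp continuous_fst).sub continuous_const).abs.rpow_const
        fun _ => Or.inr (by linarith)
    · exact (continuous_snd.sub continuous_const).abs.rpow_const fun _ => Or.inr hβ.le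
  have hB0 : B (s, x) = 0 := by
    simp [B, Real.zero_rpow hβ.ne', Real.zero_rpow (by linarith : β / 2 ≠ 0)]
  have hlim : Filter.Tendsto B (nhds (s, x)) (nhds 0) := by
    have := hBc.tendsto (s, x)
    rwa [hB0] at this
  rw [ContinuousAt, tendsto_iff_dist_tendsto_zero]
  refine squeeze_zero' (Filter.Eventually.of_forall fun _ => dist_nonneg) ?_ hlim
  have hnear : ∀ᶠ p : Set.Icc (0 : ℝ) T × ℝ in nhds (s, x), p.2 ∈ Metric.ball x 1 :=
    continuous_snd.continuousAt.eventually (Metric.ball_mem_nhds x one_pos)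
  filter_upwards [hnear] with p hp
  rw [Metric.mem_ball, Real.dist_eq, abs_lt] at hp
  have hx : x ∈ Set.Icc (-a) a := mem_Icc_abs_add_one x
  have hy : p.2 ∈ Set.Icc (-a) a := by
    constructor <;> simp only [a] <;> linarith [neg_abs_le x, le_abs_self x]
  have hE : ∀ t : Set.Icc (0 : ℝ) T, N * weightE θ lam a t * a ^ (β / 2) ≤ D := fun t => by
    have := weightE_mono (θ := θ) (lam := lam) (a := a) hθ hlam ha0 t.2.2
    simp only [D]
    gcongr
  rw [Real.dist_eq]
  rcases le_total s p.1 with hsp | hsp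
  · refine (h.hol a ha s p.1 hsp x hx p.2 hy).trans ?_
    exact mul_le_mul_of_nonneg_right (hE _) (by positivity)
  · rw [abs_sub_comm]
    refine (h.hol a ha p.1 s hsp p.2 hy x hx).trans ?_
    rw [abs_sub_comm (s : ℝ), abs_sub_comm x]
    exact mul_le_mul_of_nonneg_right (hE _) (by positivity)

theorem measurable_coe_sign : Measurable fun z : ℝ => ((SignType.sign z : SignType) : ℝ) := by
  have : (fun z : ℝ => ((SignType.sign z : SignType) : ℝ))
      = fun z => if 0 < z then 1 else if z < 0 then -1 else 0 := by
    funext z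
    rw [sign_apply]
    split_ifs <;> simp
  rw [this]
  exact Measurable.ite measurableSet_Ioi measurable_const
    (Measurable.ite measurableSet_Iio measurable_const measurable_const)

theorem measurable_unifSum {X : Type*} [TopologicalSpace X] [MeasurableSpace X]
    [OpensMeasurableSpace X] [SecondCountableTopology X] {W : ℝ → ℝ} (hW : Continuous W)
    {v v' : X → ℝ → ℝ}
    (hv : Continuous fun p : X × ℝ => v p.1 p.2) (hv' : Continuous fun p : X × ℝ => v' p.1 p.2)
    (n : ℕ) (x : ℝ) : Measurable fun p : X × ℝ => unifSum W (v p.1) (v' p.1) n x p.2 := by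
  unfold unifSum
  refine Measurable.mul (measurable_coe_sign.comp (measurable_snd.sub measurable_const)) ?_
  refine Continuous.measurable ?_
  refine continuous_finsetSum _ fun i _ => ?_
  have hu : ∀ j : ℕ, Continuous fun p : X × ℝ => unifPart (min x p.2) (max x p.2) n j := fun j => by
    unfold unifPart
    fun_prop
  have h1 := hW.comp (hu i)
  have h2 := hW.comp (hu (i + 1))
  have h3 := hv.comp (continuous_fst.prodMk (hu i))
  have h4 := hv'.comp (continuous_fst.prodMk (hu i))
  simp only [Function.comp_def] at h1 h2 h3 h4
  unfold germ roughOne roughTwo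
  fun_prop

theorem RoughIntegrable.aestronglyMeasurable {W v v' : ℝ → ℝ} (hW : Continuous W)
    (hv : Continuous v) (hv' : Continuous v') (h : RoughIntegrable W v v') (x : ℝ) :
    AEStronglyMeasurable (roughIntegral W v v' x) volume := by
  refine aestronglyMeasurable_of_tendsto_ae Filter.atTop
    (f := fun n y => unifSum W v v' n x y) (fun n => ?_)
    (Filter.Eventually.of_forall fun y => h.tendsto_unifSum x y)
  have := measurable_unifSum (X := Unit) (v := fun _ => v) (v' := fun _ => v') hW
    (hv.comp continuous_snd) (hv'.comp continuous_snd) n x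
  exact (this.comp (measurable_const (a := ()) |>.prodMk measurable_id)).aestronglyMeasurable

theorem slice_eq {T : ℝ} (f : Set.Icc (0 : ℝ) T → ℝ → ℝ) {s : ℝ} (hs : s ∈ Set.Icc (0 : ℝ) T) :
    slice f s = f ⟨s, hs⟩ := by rw [slice, dif_pos hs]

theorem prod_restrict_Ioc (t : ℝ) :
    (volume.restrict (Set.Ioc (0 : ℝ) t)).prod (volume : Measure ℝ)
      = ((volume : Measure ℝ).prod (volume : Measure ℝ)).restrict (Set.Ioc 0 t ×ˢ Set.univ) := by
  rw [← Measure.prod_restrict, Measure.restrict_univ]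

theorem aestronglyMeasurable_roughIntegral_slice {T : ℝ} {W : ℝ → ℝ} (hW : Continuous W)
    {V : CPair T} (h1 : Continuous fun p : Set.Icc (0 : ℝ) T × ℝ => V.1 p.1 p.2)
    (h2 : Continuous fun p : Set.Icc (0 : ℝ) T × ℝ => V.2 p.1 p.2)
    (hI : ∀ s ∈ Set.Ioc (0 : ℝ) T, RoughIntegrable W (slice V.1 s) (slice V.2 s)) {t : ℝ}
    (ht : t ∈ Set.Icc (0 : ℝ) T) (x : ℝ) :
    AEStronglyMeasurable
      (fun q : ℝ × ℝ => roughIntegral W (slice V.1 q.1) (slice V.2 q.1) x q.2)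
      ((volume.restrict (Set.Ioc 0 t)).prod volume) := by
  have hT : 0 ≤ T := ht.1.trans ht.2
  -- Projecting time to `[0,T]` makes the approximating sums measurable on all of `ℝ × ℝ`; on the
  -- strip that carries the measure nothing changes.
  have hp : Continuous fun q : ℝ × ℝ => (Set.projIcc 0 T hT q.1, q.2) :=
    (continuous_projIcc.comp continuous_fst).prodMk continuous_snd
  refine aestronglyMeasurable_of_tendsto_ae Filter.atTop
    (f := fun n q => unifSum W (V.1 (Set.projIcc 0 T hT q.1)) (V.2 (Set.projIcc 0 T hT q.1)) n x q.2)
    (fun n => Measurable.aestronglyMeasurable ?_) ?_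
  · exact (measurable_unifSum hW h1 h2 n x).comp hp.measurable
  rw [prod_restrict_Ioc]
  filter_upwards [ae_restrict_mem (measurableSet_Ioc.prod MeasurableSet.univ)] with q hq
  have hq1 : q.1 ∈ Set.Ioc (0 : ℝ) T := ⟨hq.1.1, hq.1.2.trans ht.2⟩
  have hq2 : q.1 ∈ Set.Icc (0 : ℝ) T := ⟨hq1.1.le, hq1.2⟩
  rw [Set.projIcc_of_mem hT hq2, ← slice_eq V.1 hq2, ← slice_eq V.2 hq2]
  exact (hI q.1 hq1).tendsto_unifSum x q.2

/-- Tonelli: the slices are integrable with norms of size `endSing`, itself integrable in `s`. The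
time `s = t`, where the kernel degenerates, is a null set. -/
theorem integrable_joint {α β σ c T : ℝ} (hα : 0 < α) (hα1 : α ≤ 1) (hβ : 0 < β)
    (hβα : 2 * β + α ≤ 2) (hσ : 0 < σ) (hT : 0 < T) {t x ε B : ℝ} (ht0 : 0 ≤ t) (htT : t ≤ T)
    (hε : 0 < ε) (F : ℝ → ℝ → ℝ) (m₁ m₂ m₃ : ℝ → ℝ)
    (hF : AEStronglyMeasurable (fun q : ℝ × ℝ => F q.1 q.2)
      ((volume.restrict (Set.Ioc 0 t)).prod volume))
    (hFs : ∀ s, 0 < s → s < t → AEStronglyMeasurable (F s) volume)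
    (hm : ∀ s, 0 < s → s < t → 0 ≤ m₁ s ∧ 0 ≤ m₂ s ∧ 0 ≤ m₃ s)
    (hFb : ∀ s, 0 < s → s < t → ∀ y, |F s y| ≤ growth α β c (m₁ s) (m₂ s) (m₃ s) (y - x))
    (hd : ∀ s, 0 < s → s < t →
      decay α β (m₁ s) (m₂ s) (m₃ s) (t - s) ≤ B * endSing ε s (t - s)) :
    Integrable (fun q : ℝ × ℝ => heatKernelXX σ (t - q.1) (x - q.2) * F q.1 q.2)
      ((volume.restrict (Set.Ioc 0 t)).prod volume) := by
  obtain ⟨C, hC, hb⟩ := heatConv_bounds (c := c) hα hα1 hβ hβα hσ hT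
  have hk : Measurable fun q : ℝ × ℝ => heatKernelXX σ (t - q.1) (x - q.2) :=
    (measurable_heatKernelXX σ).comp
      ((measurable_const.sub measurable_fst).prodMk (measurable_const.sub measurable_snd))
  have hmeas : AEStronglyMeasurable
      (fun q : ℝ × ℝ => heatKernelXX σ (t - q.1) (x - q.2) * F q.1 q.2)
      ((volume.restrict (Set.Ioc 0 t)).prod volume) := hk.aestronglyMeasurable.mul hF
  have hae : ∀ᵐ s ∂(volume.restrict (Set.Ioc 0 t)), 0 < s ∧ s < t := by
    have : ∀ᵐ s ∂(volume.restrict (Set.Ioc 0 t)), s ≠ t :=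
      ae_restrict_of_ae (Measure.ae_ne volume t)
    filter_upwards [ae_restrict_mem measurableSet_Ioc, this] with s hs hne
    exact ⟨hs.1, lt_of_le_of_ne hs.2 hne⟩
  rw [integrable_prod_iff hmeas]
  have hkey : ∀ s, 0 < s → s < t →
      Integrable (fun y => heatKernelXX σ (t - s) (x - y) * F s y) ∧
        ∫ y, |heatKernelXX σ (t - s) (x - y) * F s y| ≤ C * (B * endSing ε s (t - s)) := by
    intro s hs hst
    obtain ⟨p1, p2, p3⟩ := hm s hs hst
    have := (hb (t - s) (by linarith) (by linarith) (F s) x _ _ _ p1 p2 p3 (hFs s hs hst)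
      (hFb s hs hst)).1
    exact ⟨this.1, this.2.trans (mul_le_mul_of_nonneg_left (hd s hs hst) hC.le)⟩
  refine ⟨?_, ?_⟩
  · filter_upwards [hae] with s hs
    exact (hkey s hs.1 hs.2).1
  · have hint := ((intervalIntegrable_endSing (t := t) hε).const_mul B).const_mul C
    rw [intervalIntegrable_iff_integrableOn_Ioc_of_le ht0] at hint
    refine hint.mono' hmeas.norm.integral_prod_right' ?_
    filter_upwards [hae] with s hs
    rw [Real.norm_eq_abs, abs_of_nonneg (integral_nonneg fun y => norm_nonneg _)]
    exact (hkey s hs.1 hs.2).2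

theorem intervalIntegrable_inner {t : ℝ} (ht : 0 ≤ t) {f : ℝ × ℝ → ℝ}
    (hf : Integrable f ((volume.restrict (Set.Ioc 0 t)).prod volume)) :
    IntervalIntegrable (fun s => ∫ y, f (s, y)) volume 0 t := by
  rw [intervalIntegrable_iff_integrableOn_Ioc_of_le ht]
  exact hf.integral_prod_left

/-! ### The averages of the path itself -/

section
variable {α β χ K : ℝ} {W : ℝ → ℝ}

theorem additiveGerm_roughOne (hW : Continuous W) : AdditiveGerm (roughOne W) where
  chain x y z := by simp only [roughOne]; ring
  meas x := (hW.sub continuous_const).aestronglyMeasurable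

theorem PathBd.growth_le (hW : PathBd α χ W K) (hχ0 : 0 ≤ χ) (hχ1 : χ ≤ 1) {c : ℝ} (hc : 1 ≤ c)
    {a x : ℝ} (ha : 1 ≤ a) (hx : x ∈ Set.Icc (-a) a) (y : ℝ) :
    |roughOne W x y| ≤ growth α β c (K * a ^ χ) 0 0 (y - x) := by
  have hK := hW.nonneg
  refine (hW.one_le_exp hχ0 hχ1 ha hx y).trans ?_
  rw [growth, zero_mul, zero_mul, add_zero, add_zero]
  have : |y - x| ≤ c * |y - x| := le_mul_of_one_le_left (abs_nonneg _) hc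
  gcongr

/-- The time integral of the averages of `W¹` is an average against the heat kernel. -/
theorem integral_heatAvg_roughOne {σ t x : ℝ} (hσ : 0 < σ) (ht : 0 < t)
    (hint : Integrable (fun q : ℝ × ℝ => heatKernelXX σ (t - q.1) (x - q.2) * roughOne W x q.2)
      ((volume.restrict (Set.Ioc 0 t)).prod volume)) :
    ∫ s in (0 : ℝ)..t, heatAvg σ (t - s) (roughOne W) x
      = 2 / σ ^ 2 * ∫ y, heatKernel σ t (x - y) * roughOne W x y := by
  rw [intervalIntegral.integral_of_le ht.le]
  unfold heatAvg
  rw [integral_integral_swap (f := fun s y => heatKernelXX σ (t - s) (x - y) * roughOne W x y) hint,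
    ← integral_const_mul]
  -- After exchanging the integrals the time integral is explicit, except on the diagonal, which is
  -- null.
  have hne : ∀ᵐ y : ℝ, y ≠ x := Measure.ae_ne volume x
  refine integral_congr_ae ?_
  filter_upwards [hne] with y hy
  rw [integral_mul_const, ← intervalIntegral.integral_of_le ht.le,
    intervalIntegral.integral_comp_sub_left (fun τ => heatKernelXX σ τ (x - y)) t, sub_self,
    sub_zero, integral_time_heatKernelXX hσ ht.le (sub_ne_zero.2 hy.symm)]
  ring

/-- Increments of the heat flow started from the path. -/
theorem heatFlow_incr_le {σ T : ℝ} {c : ℝ} (hα : 0 < α) (hα1 : α ≤ 1) (hβ : 0 < β)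
    (h2β : 2 * β ≤ 1) (hαβ : α ≤ 2 * β) (hσ : 0 < σ) (hT : 0 < T) (hχ0 : 0 ≤ χ)
    (hχ1 : χ ≤ 1) (hc : 1 ≤ c) :
    ∃ C, 0 < C ∧ ∀ W K, Continuous W → PathBd α χ W K → ∀ t, 0 < t → t ≤ T → ∀ a, 1 ≤ a →
      ∀ x ∈ Set.Icc (-a) a, ∀ x' ∈ Set.Icc (-a) a,
      |(∫ y, heatKernel σ t (x' - y) * roughOne W x' y)
          - (∫ y, heatKernel σ t (x - y) * roughOne W x y) + roughOne W x x'|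
        ≤ C * (K * a ^ χ * t ^ (α / 2) * (|x' - x| / Real.sqrt t) ^ (2 * β)) := by
  obtain ⟨C, hC, hb⟩ := heatConv_bounds (c := c) hα hα1 hβ (by linarith) hσ hT
  refine ⟨2 * C + 1, by positivity, ?_⟩
  intro W K hWc hW t ht htT a ha x hx x' hx'
  have hK := hW.nonneg
  have ha0 : 0 < a := by linarith
  have hM : 0 ≤ K * a ^ χ := by positivity
  have hs : 0 < Real.sqrt t := Real.sqrt_pos.2 ht
  have hG := additiveGerm_roughOne hWc
  have b := hb t ht htT _ x _ 0 0 hM le_rfl le_rfl (hG.meas x)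
    (hW.growth_le hχ0 hχ1 hc ha hx)
  have b' := hb t ht htT _ x' _ 0 0 hM le_rfl le_rfl (hG.meas x')
    (hW.growth_le hχ0 hχ1 hc ha hx')
  have hd : t * decay α β (K * a ^ χ) 0 0 t = K * a ^ χ * t ^ (α / 2) := by
    rw [decay, Real.rpow_add ht, Real.rpow_neg_one]
    field_simp
    ring
  set q := |x' - x| / Real.sqrt t with hq
  have hq0 : 0 ≤ q := by positivity
  have hX : 0 ≤ K * a ^ χ * t ^ (α / 2) := by positivity
  by_cases hh : |x' - x| ≤ Real.sqrt t
  · have h5 := b.2.2.2.2 (x' - x) hh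
    rw [add_sub_cancel] at h5
    have hi : Integrable fun y => heatKernel σ t (x' - y) :=
      (integrable_heatKernel hσ ht).comp_sub_left x'
    -- Since `p_t` has mass one, moving the base point from `x` to `x'` produces precisely
    -- `W¹(x,x')`; the whole expression becomes a kernel increment against `W¹(x,·)`.
    have e1 : ∫ y, heatKernel σ t (x' - y) * roughOne W x y
        = roughOne W x x' + ∫ y, heatKernel σ t (x' - y) * roughOne W x' y := by
      have e : ∀ y, heatKernel σ t (x' - y) * roughOne W x y
          = heatKernel σ t (x' - y) * roughOne W x x' + heatKernel σ t (x' - y) * roughOne W x' y :=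
        fun y => by rw [hG.chain x x' y]; ring
      simp_rw [e]
      rw [integral_add (hi.mul_const _) b'.2.2.2.1.1, integral_mul_const,
        integral_sub_left_eq_self (heatKernel σ t) volume x', integral_heatKernel hσ ht, one_mul]
    have e2 := integral_sub h5.1 b.2.2.2.1.1
    simp only [← sub_mul] at e2
    have e3 : (∫ y, heatKernel σ t (x' - y) * roughOne W x' y)
          - (∫ y, heatKernel σ t (x - y) * roughOne W x y) + roughOne W x x'
        = ∫ y, (heatKernel σ t (x' - y) - heatKernel σ t (x - y)) * roughOne W x y := by
      rw [e2, e1]; ring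
    rw [e3]
    have hqq : q ≤ q ^ (2 * β) := le_rpow_of_le_one hq0 ((div_le_one hs).2 hh) h2β
    calc _ ≤ _ := h5.2
      _ = C * (K * a ^ χ * t ^ (α / 2) * q) := by rw [← hd]; ring
      _ ≤ C * (K * a ^ χ * t ^ (α / 2) * q ^ (2 * β)) := by gcongr
      _ ≤ _ := by gcongr; linarith
  · have hq1 : 1 ≤ q := (one_le_div hs).2 (not_le.1 hh).le
    have hf : 1 ≤ q ^ (2 * β) := Real.one_le_rpow hq1 (by linarith)
    have n1 := b.2.2.2.1.2
    have n2 := b'.2.2.2.1.2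
    rw [mul_assoc, hd] at n1 n2
    -- Here `q ≥ 1` and `α ≤ 2β`, so `q^α` may be raised to `q^(2β)`.
    have n3 : |roughOne W x x'| ≤ K * a ^ χ * t ^ (α / 2) * q ^ (2 * β) := by
      have e : |x' - x| ^ α = t ^ (α / 2) * q ^ α := by
        rw [hq, Real.div_rpow (abs_nonneg _) hs.le, Real.sqrt_eq_rpow, ← Real.rpow_mul ht.le]
        rw [show 1 / 2 * α = α / 2 by ring]
        field_simp
      refine (hW.one a ha x hx x' hx').trans ?_
      rw [e, ← mul_assoc]
      gcongr
    have n4 : C * (K * a ^ χ * t ^ (α / 2)) ≤ C * (K * a ^ χ * t ^ (α / 2) * q ^ (2 * β)) :=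
      mul_le_mul_of_nonneg_left (le_mul_of_one_le_right hX hf) hC.le
    rw [abs_le] at *
    constructor <;> nlinarith [n1.1, n1.2, n2.1, n2.2, n3.1, n3.2]

end

/-! ### The heat flow driven by additive two-point functions -/

/-- Additive two-point functions `I s` that are locally described by `v s` and the path. -/
structure RoughFlow (α β χ θ lam T N K P : ℝ) (W : ℝ → ℝ) (v : ℝ → ℝ → ℝ) (I : ℝ → ℝ → ℝ → ℝ) :
    Prop where
  path : PathBd α χ W K
  cont : Continuous W
  N_nonneg : 0 ≤ N
  P_nonneg : 0 ≤ P
  NK_le : N * K ≤ P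
  germ : ∀ s, 0 < s → s ≤ T → AdditiveGerm (I s)
  joint : ∀ t, 0 ≤ t → t ≤ T → ∀ x, AEStronglyMeasurable (fun q : ℝ × ℝ => I q.1 x q.2)
    ((volume.restrict (Set.Ioc 0 t)).prod volume)
  total : ∀ s, 0 < s → s ≤ T → ∀ a, 1 ≤ a → ∀ x ∈ Set.Icc (-a) a, ∀ y,
    |I s x y| ≤ growth α β (growthRate θ T) (P * weightE θ lam a s * a ^ χ)
      (P * weightE θ lam a s * (lam ^ ((α - β) / 4) * a ^ (2 * χ)))
      (P * weightE θ lam a s * (lam ^ ((α - β) / 4) * remCoeff β χ a s)) (y - x)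
  rem : ∀ s, 0 < s → s ≤ T → ∀ a, 1 ≤ a → ∀ x ∈ Set.Icc (-a) a, ∀ y,
    |I s x y - v s x * roughOne W x y| ≤ growth α β (growthRate θ T) 0
      (P * weightE θ lam a s * (lam ^ ((α - β) / 4) * a ^ (2 * χ)))
      (P * weightE θ lam a s * (lam ^ ((α - β) / 4) * remCoeff β χ a s)) (y - x)
  sup : ∀ s, 0 ≤ s → s ≤ T → ∀ a, 1 ≤ a → ∀ x ∈ Set.Icc (-a) a, |v s x| ≤ N * weightE θ lam a s
  hol : ∀ s t, 0 ≤ s → s ≤ t → t ≤ T → ∀ a, 1 ≤ a → ∀ x ∈ Set.Icc (-a) a, ∀ y ∈ Set.Icc (-a) a,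
    |v t y - v s x| ≤ N * weightE θ lam a t * a ^ (β / 2)
      * (|t - s| ^ (β / 2) + |y - x| ^ β)

/-- The heat flow `∫₀ᵗ ∫ ∂²p_{t-s}(x-y) I_s(x,y) dy ds`. -/
def flowMap (σ : ℝ) (I : ℝ → ℝ → ℝ → ℝ) (t x : ℝ) : ℝ :=
  ∫ s in (0 : ℝ)..t, heatAvg σ (t - s) (I s) x

theorem decay_mul (α β c m₁ m₂ m₃ τ : ℝ) :
    decay α β (c * m₁) (c * m₂) (c * m₃) τ = c * decay α β m₁ m₂ m₃ τ := by
  unfold decay; ring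

theorem decay_mul_zero (α β c m₂ m₃ τ : ℝ) :
    decay α β 0 (c * m₂) (c * m₃) τ = c * decay α β 0 m₂ m₃ τ := by
  unfold decay; ring

theorem div_sqrt_rpow (h : ℝ) {τ : ℝ} (hτ : 0 < τ) (η : ℝ) :
    (|h| / Real.sqrt τ) ^ η = |h| ^ η * τ ^ (-(η / 2)) := by
  rw [Real.div_rpow (abs_nonneg _) (Real.sqrt_nonneg _), Real.sqrt_eq_rpow, ← Real.rpow_mul hτ.le,
    Real.rpow_neg hτ.le, div_eq_mul_inv]
  ring_nf

theorem abs_integral_le_of_endSing {f : ℝ → ℝ} {ε D t₀ t T : ℝ} (hε : 0 < ε) (hε1 : ε ≤ 1)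
    (hD : 0 ≤ D) (ht₀ : 0 ≤ t₀) (ht : t₀ ≤ t) (htT : t ≤ T)
    (hf : ∀ s, t₀ < s → s < t → |f s| ≤ D * endSing ε s (t - s)) :
    |∫ s in t₀..t, f s| ≤ D * (2 * (1 + T) / ε) := by
  have ht0 : 0 ≤ t := ht₀.trans ht
  have hi := (intervalIntegrable_endSing (t := t) hε).const_mul D
  have hsub : Set.uIcc t₀ t ⊆ Set.uIcc 0 t := by
    rw [Set.uIcc_of_le ht, Set.uIcc_of_le ht0]; exact Set.Icc_subset_Icc_left ht₀
  have h1 : ‖∫ s in t₀..t, f s‖ ≤ ∫ s in t₀..t, D * endSing ε s (t - s) := by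
    refine intervalIntegral.norm_integral_le_of_norm_le ht ?_ (hi.mono_set hsub)
    filter_upwards [Measure.ae_ne volume t] with s hne hs
    exact hf s hs.1 (lt_of_le_of_ne hs.2 hne)
  rw [Real.norm_eq_abs] at h1
  refine h1.trans ?_
  have h2 : ∫ s in t₀..t, D * endSing ε s (t - s) ≤ ∫ s in (0 : ℝ)..t, D * endSing ε s (t - s) := by
    refine intervalIntegral.integral_mono_interval ht₀ ht le_rfl ?_ hi
    filter_upwards [ae_restrict_mem measurableSet_Ioc] with s hs
    exact mul_nonneg hD (endSing_nonneg hs.1.le (by linarith [hs.2]))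
  refine h2.trans ?_
  rw [intervalIntegral.integral_const_mul]
  exact mul_le_mul_of_nonneg_left (integral_endSing_le hε hε1 ht0 htT) hD

theorem remCoeff_nonneg {β χ a s : ℝ} (ha : 0 ≤ a) (hs : 0 ≤ s) : 0 ≤ remCoeff β χ a s := by
  unfold remCoeff; positivity

section
variable {α β χ θ σ T : ℝ} (hβ : 1 / 3 < β) (hβα : β < α) (hα : α < 1 / 2) (hχ0 : 0 < χ)
  (hχβ : χ < β / 2) (hθ : 1 ≤ θ) (hσ : 0 < σ) (hT : 0 < T)

include hβ hβα hα hχ0 hχβ hθ hσ hT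

theorem RoughFlow.integrable {lam N K P : ℝ} {W : ℝ → ℝ} {v : ℝ → ℝ → ℝ} {I : ℝ → ℝ → ℝ → ℝ}
    (hlam : 1 ≤ lam) (h : RoughFlow α β χ θ lam T N K P W v I) {t : ℝ} (ht0 : 0 ≤ t)
    (htT : t ≤ T) (x : ℝ) :
    Integrable (fun q : ℝ × ℝ => heatKernelXX σ (t - q.1) (x - q.2) * I q.1 x q.2)
      ((volume.restrict (Set.Ioc 0 t)).prod volume) := by
  set a := |x| + 1
  have ha : 1 ≤ a := by simp [a]
  have ha0 : 0 < a := by linarith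
  have hl0 : 0 < lam := by linarith
  have hP := h.P_nonneg
  refine integrable_joint (α := α) (β := β) (c := growthRate θ T)
    (B := P * (weightE θ lam a t * lam ^ (-((α - β) / 4)) * (4 * (1 + T))))
    (by linarith) (by linarith) (by linarith) (by linarith) hσ hT ht0 htT
    (endExp_pos hβα hχβ) (fun s => I s x)
    (fun s => P * weightE θ lam a s * a ^ χ)
    (fun s => P * weightE θ lam a s * (lam ^ ((α - β) / 4) * a ^ (2 * χ)))
    (fun s => P * weightE θ lam a s * (lam ^ ((α - β) / 4) * remCoeff β χ a s))
    (h.joint t ht0 htT x) (fun s hs hst => (h.germ s hs (by linarith)).meas x) ?_ ?_ ?_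
  · intro s hs _
    have := weightE_pos θ lam a s
    have := remCoeff_nonneg (β := β) (χ := χ) ha0.le hs.le
    exact ⟨by positivity, by positivity, by positivity⟩
  · exact fun s hs hst y => h.total s hs (by linarith) a ha x (mem_Icc_abs_add_one x) y
  · intro s hs hst
    have := weighted_decay_sup_le (τ := t - s) hβ hβα hα hχ0 hχβ hθ hlam ha hs (by linarith)
      (show s ≤ T by linarith) (by linarith)
    rw [add_sub_cancel] at this
    simp only [decay_mul]
    calc _ = P * (weightE θ lam a s * decay α β (a ^ χ) (lam ^ ((α - β) / 4) * a ^ (2 * χ))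
        (lam ^ ((α - β) / 4) * remCoeff β χ a s) (t - s)) := by ring
      _ ≤ P * _ := mul_le_mul_of_nonneg_left this hP
      _ = _ := by ring

theorem RoughFlow.intervalIntegrable {lam N K P : ℝ} {W : ℝ → ℝ} {v : ℝ → ℝ → ℝ}
    {I : ℝ → ℝ → ℝ → ℝ}
    (hlam : 1 ≤ lam) (h : RoughFlow α β χ θ lam T N K P W v I) {t : ℝ} (ht0 : 0 ≤ t)
    (htT : t ≤ T) (x : ℝ) :
    IntervalIntegrable (fun s => heatAvg σ (t - s) (I s) x) volume 0 t :=
  intervalIntegrable_inner ht0 (h.integrable hβ hβα hα hχ0 hχβ hθ hσ hT hlam ht0 htT x)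

/-- `heatAvg_bounds` is applied for each `s` with exponent `β` in space and `β/2` in time, both
costing `τ^(-β/2)`. The weighted decay estimates then convert this into the weight at `t` times an
integrable function of `s`. -/
theorem flowMap_bounds : ∃ C, 0 < C ∧ ∀ (lam N K P : ℝ) (W : ℝ → ℝ) (v : ℝ → ℝ → ℝ)
    (I : ℝ → ℝ → ℝ → ℝ), 1 ≤ lam → RoughFlow α β χ θ lam T N K P W v I →
    ∀ a, 1 ≤ a → ∀ t, 0 ≤ t → t ≤ T → ∀ x ∈ Set.Icc (-a) a,
      |flowMap σ I t x| ≤ C * (P * weightE θ lam a t * lam ^ (-((α - β) / 4))) ∧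
      (∀ x' ∈ Set.Icc (-a) a, |flowMap σ I t x' - flowMap σ I t x|
        ≤ C * (P * weightE θ lam a t * (lam ^ (-((α - β) / 4)) * a ^ (β / 2)) * |x' - x| ^ β)) ∧
      (∀ s, 0 ≤ s → s ≤ t → |flowMap σ I t x - flowMap σ I s x|
        ≤ C * (P * weightE θ lam a t * (lam ^ (-((α - β) / 4)) * a ^ (β / 2))
          * |t - s| ^ (β / 2))) := by
  obtain ⟨C, hC, hb⟩ := heatAvg_bounds (α := α) (β := β) (c := growthRate θ T) (T := T)
    (by linarith) (by linarith) (by linarith) (by linarith) hσ hT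
  have hε := endExp_pos (α := α) (β := β) (χ := χ) hβα hχβ
  have hε1 : endExp α β χ ≤ 1 := (min_le_left _ _).trans (by linarith)
  set Z := 2 * (1 + T) / endExp α β χ with hZ
  have hZ0 : 0 < Z := by positivity
  refine ⟨2 * (C * (4 * (1 + T)) * Z), by positivity, ?_⟩
  intro lam N K P W v I hlam h a ha t ht0 htT x hx
  have hP := h.P_nonneg
  have ha0 : 0 < a := by linarith
  have hl0 : 0 < lam := by linarith
  have hm : ∀ s, 0 < s → 0 ≤ P * weightE θ lam a s * a ^ χ ∧
      0 ≤ P * weightE θ lam a s * (lam ^ ((α - β) / 4) * a ^ (2 * χ)) ∧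
      0 ≤ P * weightE θ lam a s * (lam ^ ((α - β) / 4) * remCoeff β χ a s) := by
    intro s hs
    have := weightE_pos θ lam a s
    have := remCoeff_nonneg (β := β) (χ := χ) ha0.le hs.le
    exact ⟨by positivity, by positivity, by positivity⟩
  have base : ∀ s, 0 < s → ∀ t, s < t → t ≤ T → ∀ x ∈ Set.Icc (-a) a, _ := fun s hs t hst htT x hx =>
    hb (t - s) (sub_pos.2 hst) (by linarith) (I s) (h.germ s hs (by linarith)) _ _ _ (hm s hs).1
      (hm s hs).2.1 (hm s hs).2.2 x (h.total s hs (by linarith) a ha x hx)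
  have wS : ∀ s, 0 < s → ∀ t, s < t → t ≤ T → _ := fun s hs t hst htT =>
    weighted_decay_sup_le (s := s) (τ := t - s) hβ hβα hα hχ0 hχβ hθ hlam ha hs (sub_pos.2 hst)
      (show s ≤ T by linarith) (show t - s ≤ T by linarith)
  have wH : ∀ s, 0 < s → ∀ t, s < t → t ≤ T → _ := fun s hs t hst htT =>
    weighted_decay_hol_le (s := s) (τ := t - s) hβ hβα hα hχ0 hχβ hθ hlam ha hs (sub_pos.2 hst)
      (show s ≤ T by linarith) (show t - s ≤ T by linarith)
  simp only [add_sub_cancel] at wS wH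
  set d : ℝ → ℝ → ℝ := fun s t => decay α β (a ^ χ) (lam ^ ((α - β) / 4) * a ^ (2 * χ))
    (lam ^ ((α - β) / 4) * remCoeff β χ a s) (t - s) with hd
  have hE := weightE_pos θ lam a t
  have hol : ∀ s, 0 < s → ∀ r, s < r → r ≤ t → ∀ q, 0 ≤ q → ∀ A,
      A ≤ C * (P * weightE θ lam a s * d s r) * (q * (r - s) ^ (-(β / 2))) →
      A ≤ C * (4 * (1 + T)) * (P * weightE θ lam a t
        * (lam ^ (-((α - β) / 4)) * a ^ (β / 2)) * q) * endSing (endExp α β χ) s (r - s) := by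
    intro s hs r hsr hrt q hq A hA
    have hw := wH s hs r hsr (by linarith)
    have hEE : weightE θ lam a r ≤ weightE θ lam a t :=
      weightE_mono (by linarith) (by linarith) ha0.le hrt
    have hes := endSing_nonneg (ε := endExp α β χ) hs.le (sub_pos.2 hsr).le
    calc A ≤ _ := hA
      _ = C * P * q * (weightE θ lam a s * (d s r * (r - s) ^ (-(β / 2)))) := by ring
      _ ≤ C * P * q * (weightE θ lam a r * (lam ^ (-((α - β) / 4)) * a ^ (β / 2))
          * (4 * (1 + T) * endSing (endExp α β χ) s (r - s))) := by gcongr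
      _ ≤ C * P * q * (weightE θ lam a t * (lam ^ (-((α - β) / 4)) * a ^ (β / 2))
          * (4 * (1 + T) * endSing (endExp α β χ) s (r - s))) := by gcongr
      _ = _ := by ring
  have hD : ∀ q, 0 ≤ q → 0 ≤ C * (4 * (1 + T)) * (P * weightE θ lam a t
        * (lam ^ (-((α - β) / 4)) * a ^ (β / 2)) * q) := fun q hq => by positivity
  refine ⟨?_, ?_, ?_⟩
  · have := abs_integral_le_of_endSing (f := fun s => heatAvg σ (t - s) (I s) x) hε hε1
      (D := C * (4 * (1 + T)) * (P * weightE θ lam a t * lam ^ (-((α - β) / 4))))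
      (by positivity) le_rfl ht0 htT ?_
    · refine this.trans ?_
      rw [← hZ]
      have : 0 ≤ C * (4 * (1 + T)) * (P * weightE θ lam a t * lam ^ (-((α - β) / 4))) * Z := by
        positivity
      linarith
    · intro s hs hst
      have b := (base s hs t hst htT x hx).1
      rw [decay_mul] at b
      have w := wS s hs t hst htT
      calc _ ≤ _ := b
        _ = C * P * (weightE θ lam a s * d s t) := by ring
        _ ≤ C * P * _ := mul_le_mul_of_nonneg_left w (by positivity)
        _ = _ := by ring
  · intro x' hx'
    have i1 := h.intervalIntegrable hβ hβα hα hχ0 hχβ hθ hσ hT hlam ht0 htT x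
    have i2 := h.intervalIntegrable hβ hβα hα hχ0 hχβ hθ hσ hT hlam ht0 htT x'
    rw [flowMap, flowMap, ← intervalIntegral.integral_sub i2 i1]
    have := abs_integral_le_of_endSing
      (f := fun s => heatAvg σ (t - s) (I s) x' - heatAvg σ (t - s) (I s) x) hε hε1
      (hD (|x' - x| ^ β) (by positivity)) le_rfl ht0 htT ?_
    · refine this.trans ?_
      rw [← hZ]
      have := mul_nonneg (hD (|x' - x| ^ β) (by positivity)) hZ0.le
      linarith
    · intro s hs hst
      refine hol s hs t hst le_rfl _ (by positivity) _ ?_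
      have b := (base s hs t hst htT x hx).2.1 x' (h.total s hs (by linarith) a ha x' hx') β
        (by linarith) (by linarith)
      rwa [decay_mul, div_sqrt_rpow _ (sub_pos.2 hst)] at b
  · intro r hr hrt
    have i1 := h.intervalIntegrable hβ hβα hα hχ0 hχβ hθ hσ hT hlam ht0 htT x
    have i2 := h.intervalIntegrable hβ hβα hα hχ0 hχβ hθ hσ hT hlam hr (by linarith) x
    have i3 : IntervalIntegrable (fun s => heatAvg σ (t - s) (I s) x) volume 0 r :=
      i1.mono_set (by
        rw [Set.uIcc_of_le hr, Set.uIcc_of_le ht0]; exact Set.Icc_subset_Icc_right hrt)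
    have i4 : IntervalIntegrable (fun s => heatAvg σ (t - s) (I s) x) volume r t :=
      i1.mono_set (by
        rw [Set.uIcc_of_le hrt, Set.uIcc_of_le ht0]; exact Set.Icc_subset_Icc_left hr)
    -- The recent past `[r,t]` is bounded by size, the older past `[0,r]` by the time increment of
    -- the kernel.
    have e : flowMap σ I t x - flowMap σ I r x
        = (∫ s in r..t, heatAvg σ (t - s) (I s) x)
          + ∫ s in (0 : ℝ)..r, (heatAvg σ (t - s) (I s) x - heatAvg σ (r - s) (I s) x) := by
      rw [intervalIntegral.integral_sub i3 i2, flowMap, flowMap,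
        ← intervalIntegral.integral_add_adjacent_intervals i3 i4]
      ring
    have hq : 0 ≤ |t - r| ^ (β / 2) := by positivity
    have htr : |t - r| = t - r := abs_of_nonneg (by linarith)
    have p1 := abs_integral_le_of_endSing (f := fun s => heatAvg σ (t - s) (I s) x) hε hε1
      (hD (|t - r| ^ (β / 2)) hq) hr hrt htT ?_
    have p2 := abs_integral_le_of_endSing
      (f := fun s => heatAvg σ (t - s) (I s) x - heatAvg σ (r - s) (I s) x) hε hε1
      (hD (|t - r| ^ (β / 2)) hq) le_rfl hr (hrt.trans htT) ?_
    · rw [e]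
      refine (abs_add_le _ _).trans ((add_le_add p1 p2).trans (le_of_eq ?_))
      rw [← hZ]; ring
    · intro s hs hsr
      refine hol s hs r hsr hrt _ hq _ ?_
      have b := (base s hs r hsr (by linarith) x hx).2.2.1 (t - r) (by linarith) (by linarith)
        (β / 2) (by linarith) (by linarith)
      have e' : ((t - r) / (r - s)) ^ (β / 2) = (t - r) ^ (β / 2) * (r - s) ^ (-(β / 2)) := by
        rw [Real.div_rpow (by linarith) (by linarith), Real.rpow_neg (by linarith),
          div_eq_mul_inv]
      rw [decay_mul, e', show r - s + (t - r) = t - s by ring] at b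
      rwa [htr]
    · intro s hs hst
      have hs0 : 0 < s := by linarith
      refine hol s hs0 t hst le_rfl _ hq _ ?_
      have b := (base s hs0 t hst htT x hx).1
      rw [decay_mul] at b
      refine b.trans ?_
      have hdn := (decay_nonneg (α := α) (β := β) (hm s hs0).1 (hm s hs0).2.1 (hm s hs0).2.2
        (sub_pos.2 hst).le)
      rw [decay_mul] at hdn
      -- For `r < s < t` one has `t - s ≤ t - r`, so the factor `((t-r)/(t-s))^(β/2)` is at least
      -- `1` and may be inserted.
      refine le_mul_of_one_le_right (mul_nonneg hC.le hdn) ?_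
      have hts : 0 < t - s := sub_pos.2 hst
      rw [htr, Real.rpow_neg hts.le, ← div_eq_mul_inv, one_le_div (by positivity)]
      exact Real.rpow_le_rpow hts.le (by linarith) (by linarith)

end

/-! ### The remainder of the heat flow -/

section
variable {α β χ θ σ T : ℝ} (hβ : 1 / 3 < β) (hβα : β < α) (hα : α < 1 / 2) (hχ0 : 0 < χ)
  (hχβ : χ < β / 2) (hθ : 1 ≤ θ) (hσ : 0 < σ) (hT : 0 < T)

include hβ hβα hα hχ0 hχβ hθ hσ hT

omit hθ in
theorem integrable_heatKernelXX_roughOne {K : ℝ} {W : ℝ → ℝ} (hWc : Continuous W)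
    (hW : PathBd α χ W K) {t : ℝ} (ht0 : 0 ≤ t) (htT : t ≤ T) (x : ℝ) :
    Integrable (fun q : ℝ × ℝ => heatKernelXX σ (t - q.1) (x - q.2) * roughOne W x q.2)
      ((volume.restrict (Set.Ioc 0 t)).prod volume) := by
  set a := |x| + 1
  have ha : 1 ≤ a := by simp [a]
  have ha0 : 0 < a := by linarith
  have hK := hW.nonneg
  refine integrable_joint (α := α) (β := β) (c := 1) (B := K * a ^ χ * (1 + T))
    (by linarith) (by linarith) (by linarith) (by linarith) hσ hT ht0 htT
    (endExp_pos hβα hχβ) (fun _ => roughOne W x) (fun _ => K * a ^ χ) (fun _ => 0) (fun _ => 0)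
    ?_ (fun s hs hst => (additiveGerm_roughOne hWc).meas x)
    (fun s hs hst => ⟨by positivity, le_rfl, le_rfl⟩)
    (fun s hs hst y => hW.growth_le hχ0.le (by linarith) le_rfl ha (mem_Icc_abs_add_one x) y) ?_
  · exact ((hWc.comp continuous_snd).sub continuous_const).aestronglyMeasurable
  · intro s hs hst
    have hε1 : endExp α β χ ≤ (α - β) / 4 := min_le_left _ _
    have := rpow_mul_rpow_le_endSing (T := T) (q := 0) (r := α / 2) (ε := endExp α β χ) hs
      (sub_pos.2 hst) (by linarith) (by linarith) le_rfl (by linarith) (endExp_pos hβα hχβ)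
      (by linarith)
    rw [neg_zero, Real.rpow_zero, one_mul] at this
    simp only [decay, zero_mul, add_zero]
    calc _ ≤ K * a ^ χ * ((1 + T) * endSing (endExp α β χ) s (t - s)) := by gcongr
      _ = _ := by ring

/-- With `v s x` as coefficient this is the controlled estimate of `heatAvg_bounds`. Replacing it by
`v t x`, which no longer depends on `s`, costs `|v_s(x) - v_t(x)|` times an increment of the
averages of `W¹`. The time regularity `τ^(β/2)` of `v` keeps this integrable, the total exponent
being `-1 + (α-β)/2`. -/
theorem heatAvg_rem_le : ∃ C, 0 < C ∧ ∀ (lam N K P : ℝ) (W : ℝ → ℝ) (v : ℝ → ℝ → ℝ)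
    (I : ℝ → ℝ → ℝ → ℝ), 1 ≤ lam → RoughFlow α β χ θ lam T N K P W v I →
    ∀ a, 1 ≤ a → ∀ t, t ≤ T → ∀ x ∈ Set.Icc (-a) a, ∀ x' ∈ Set.Icc (-a) a,
    ∀ s, 0 < s → s < t →
      |heatAvg σ (t - s) (I s) x' - heatAvg σ (t - s) (I s) x
        - v t x * (heatAvg σ (t - s) (roughOne W) x' - heatAvg σ (t - s) (roughOne W) x)|
      ≤ C * (P * weightE θ lam a t * a ^ (χ + β / 2) * |x' - x| ^ (2 * β))
        * endSing (endExp α β χ) s (t - s) := by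
  obtain ⟨C, hC, hb⟩ := heatAvg_bounds (α := α) (β := β) (c := growthRate θ T) (T := T)
    (by linarith) (by linarith) (by linarith) (by linarith) hσ hT
  refine ⟨C * (5 * (1 + T)), by positivity, ?_⟩
  intro lam N K P W v I hlam h a ha t htT x hx x' hx' s hs hst
  have ht0 : 0 < t := hs.trans hst
  set τ := t - s with hτdef
  have hτ : 0 < τ := sub_pos.2 hst
  have hsT : s ≤ T := by linarith
  have hτT : τ ≤ T := by linarith
  have hP := h.P_nonneg
  have hN := h.N_nonneg
  have hK := h.path.nonneg
  have ha0 : 0 < a := by linarith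
  have hl0 : 0 < lam := by linarith
  have hEs := weightE_pos θ lam a s
  have hEt := weightE_pos θ lam a t
  have hrc := remCoeff_nonneg (β := β) (χ := χ) ha0.le hs.le
  have hc : 1 ≤ growthRate θ T := by
    unfold growthRate
    have : 0 ≤ θ * (1 + T) := by positivity
    linarith
  have hG := additiveGerm_roughOne h.cont
  have gx := fun y => h.path.growth_le (β := β) hχ0.le (by linarith) hc ha hx y
  have gx' := fun y => h.path.growth_le (β := β) hχ0.le (by linarith) hc ha hx' y
  have hKa : 0 ≤ K * a ^ χ := by positivity
  have bI := (hb τ hτ hτT (I s) (h.germ s hs hsT) (P * weightE θ lam a s * a ^ χ)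
    (P * weightE θ lam a s * (lam ^ ((α - β) / 4) * a ^ (2 * χ)))
    (P * weightE θ lam a s * (lam ^ ((α - β) / 4) * remCoeff β χ a s)) (by positivity)
    (by positivity) (by positivity) x (h.total s hs hsT a ha x hx)).2.2.2
    x' (roughOne W) (v s x) (v s x') (N * weightE θ lam a s * a ^ (β / 2)) (K * a ^ χ) hG hKa
    (by positivity) gx gx' (h.rem s hs hsT a ha x hx) (h.rem s hs hsT a ha x' hx')
    (by
      have := h.hol s s hs.le le_rfl hsT a ha x hx x' hx'
      rwa [sub_self, abs_zero, Real.zero_rpow (by linarith), zero_add] at this) (by linarith)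
  have bW := (hb τ hτ hτT (roughOne W) hG (K * a ^ χ) 0 0 hKa le_rfl le_rfl x gx).2.1
    x' gx' (2 * β) (by linarith) (by linarith)
  have bv : |v s x - v t x| ≤ N * weightE θ lam a t * a ^ (β / 2) * τ ^ (β / 2) := by
    have := h.hol s t hs.le hst.le htT a ha x hx x hx
    rwa [sub_self, abs_zero, Real.zero_rpow (by linarith), add_zero, abs_of_pos hτ,
      abs_sub_comm] at this
  rw [decay_mul_zero, div_sqrt_rpow _ hτ, div_sqrt_rpow _ hτ] at bI
  rw [div_sqrt_rpow _ hτ] at bW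
  have w1 := weighted_decay_rem_le hβ hβα hα hχ0 hχβ hθ hlam ha hs hτ hsT hτT
  have w2 := weighted_decay_extra_le hβ hβα hα hχβ hθ hlam ha hs hτ hsT hτT
  rw [show s + τ = t by simp [hτdef]] at w1 w2
  have hε := endExp_pos (α := α) (β := β) (χ := χ) hβα hχβ
  have hε1 : endExp α β χ ≤ (α - β) / 4 := min_le_left _ _
  have w3 := rpow_mul_rpow_le_endSing (T := T) (q := 0) (r := α / 2 - β / 2)
    (ε := endExp α β χ) hs hτ hsT hτT le_rfl (by linarith) hε (by linarith)
  rw [neg_zero, Real.rpow_zero, one_mul] at w3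
  set S := endSing (endExp α β χ) s τ with hS
  have hS0 : 0 ≤ S := endSing_nonneg hs.le hτ.le
  set h2 := |x' - x| ^ (2 * β) with hh2
  have hh : |x' - x| ^ β * |x' - x| ^ β = h2 := by
    rw [hh2, ← Real.rpow_add_of_nonneg (abs_nonneg _) (by linarith) (by linarith)]; ring_nf
  have hh0 : 0 ≤ h2 := by positivity
  have ea : a ^ (χ + β / 2) = a ^ χ * a ^ (β / 2) := Real.rpow_add ha0 _ _
  have eτ1 : τ ^ (-1 + α / 2) * τ ^ (-(β / 2)) = τ ^ (-1 + (α / 2 - β / 2)) := by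
    rw [← Real.rpow_add hτ]; ring_nf
  have eτ2 : τ ^ (β / 2) * (τ ^ (-1 + α / 2) * τ ^ (-β)) = τ ^ (-1 + (α / 2 - β / 2)) := by
    rw [← Real.rpow_add hτ, ← Real.rpow_add hτ]; ring_nf
  have e2β : -(2 * β / 2) = -β := by ring
  rw [e2β] at bI bW
  have split : ∀ A B c d : ℝ, |A - c * B| ≤ |A - d * B| + |d - c| * |B| := by
    intro A B c d
    rw [← abs_mul]
    refine le_trans (le_of_eq ?_) (abs_add_le _ _)
    ring_nf
  refine (split _ _ _ (v s x)).trans ?_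
  have hNK := h.NK_le
  have q1 : C * (P * weightE θ lam a s * decay α β 0 (lam ^ ((α - β) / 4) * a ^ (2 * χ))
      (lam ^ ((α - β) / 4) * remCoeff β χ a s) τ) * (h2 * τ ^ (-β))
      ≤ C * P * h2 * (weightE θ lam a t * a ^ (χ + β / 2) * (3 * (1 + T) * S)) := by
    refine le_trans (le_of_eq ?_) (mul_le_mul_of_nonneg_left w1 (by positivity))
    ring
  have q2 : C * (N * weightE θ lam a s * a ^ (β / 2) * |x' - x| ^ β
      * (K * a ^ χ * τ ^ (-1 + α / 2)) * (|x' - x| ^ β * τ ^ (-(β / 2))))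
      ≤ C * P * h2 * (weightE θ lam a t * a ^ (χ + β / 2) * ((1 + T) * S)) := by
    calc _ = C * (N * K) * h2 * (a ^ (χ + β / 2) *
          (weightE θ lam a s * τ ^ (-1 + (α / 2 - β / 2)))) := by
          rw [← eτ1, ← hh, ea]; ring
      _ ≤ C * P * h2 * (a ^ (χ + β / 2) * (weightE θ lam a t * ((1 + T) * S))) := by gcongr
      _ = _ := by ring
  have q3 : |v s x - v t x| * |heatAvg σ τ (roughOne W) x' - heatAvg σ τ (roughOne W) x|
      ≤ C * P * h2 * (weightE θ lam a t * a ^ (χ + β / 2) * ((1 + T) * S)) := by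
    calc _ ≤ (N * weightE θ lam a t * a ^ (β / 2) * τ ^ (β / 2))
          * (C * decay α β (K * a ^ χ) 0 0 τ * (h2 * τ ^ (-β))) :=
          mul_le_mul bv bW (abs_nonneg _) (by positivity)
      _ = C * (N * K) * h2 * (weightE θ lam a t * a ^ (χ + β / 2)
            * τ ^ (-1 + (α / 2 - β / 2))) := by
          rw [← eτ2, ea, decay]; ring
      _ ≤ _ := by gcongr
  refine (add_le_add (bI.trans (add_le_add q1 q2)) q3).trans (le_of_eq ?_)
  ring

/-- Subtracting `v t x` times the same flow driven by `W¹` leaves an integrable remainder `J`. The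
subtracted flow is `2/σ²` times an average against `p_t`, whose increment is `-W¹(x,x')` up to the
error `D` of `heatFlow_incr_le`. This identifies the derivative as `-(2/σ²) v`. -/
theorem flowMap_rem_le : ∃ C, 0 < C ∧ ∀ (lam N K P : ℝ) (W : ℝ → ℝ) (v : ℝ → ℝ → ℝ)
    (I : ℝ → ℝ → ℝ → ℝ), 1 ≤ lam → RoughFlow α β χ θ lam T N K P W v I →
    ∀ a, 1 ≤ a → ∀ t, 0 < t → t ≤ T → ∀ x ∈ Set.Icc (-a) a, ∀ x' ∈ Set.Icc (-a) a,
      |flowMap σ I t x' - flowMap σ I t x + 2 / σ ^ 2 * v t x * roughOne W x x'|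
        ≤ C * (P * weightE θ lam a t * (a ^ χ * (a ^ (β / 2) + t ^ (-(β / 2))))
          * |x' - x| ^ (2 * β)) := by
  obtain ⟨C₁, hC₁, hb⟩ := heatAvg_rem_le hβ hβα hα hχ0 hχβ hθ hσ hT
  obtain ⟨C₂, hC₂, hw⟩ := heatFlow_incr_le (α := α) (β := β) (χ := χ) (c := 1) (by linarith)
    (by linarith) (by linarith) (by linarith) (by linarith) hσ hT hχ0.le (by linarith) le_rfl
  have hε := endExp_pos (α := α) (β := β) (χ := χ) hβα hχβ
  have hε1 : endExp α β χ ≤ 1 := (min_le_left _ _).trans (by linarith)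
  set Z := 2 * (1 + T) / endExp α β χ with hZ
  have hZ0 : 0 < Z := by positivity
  refine ⟨C₁ * Z + 2 / σ ^ 2 * C₂ * (1 + T), by positivity, ?_⟩
  intro lam N K P W v I hlam h a ha t ht htT x hx x' hx'
  have hP := h.P_nonneg
  have hN := h.N_nonneg
  have hK := h.path.nonneg
  have ha0 : 0 < a := by linarith
  have hE := weightE_pos θ lam a t
  have j := fun x => h.intervalIntegrable hβ hβα hα hχ0 hχβ hθ hσ hT hlam ht.le htT x
  have jW := fun x => integrable_heatKernelXX_roughOne hβ hβα hα hχ0 hχβ hσ hT h.cont h.path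
    ht.le htT x
  have iW : ∀ x, IntervalIntegrable (fun s => heatAvg σ (t - s) (roughOne W) x) volume 0 t :=
    fun x => intervalIntegrable_inner ht.le (jW x)
  set J := ∫ s in (0 : ℝ)..t, (heatAvg σ (t - s) (I s) x' - heatAvg σ (t - s) (I s) x
    - v t x * (heatAvg σ (t - s) (roughOne W) x' - heatAvg σ (t - s) (roughOne W) x)) with hJ
  have eJ : J = flowMap σ I t x' - flowMap σ I t x
      - v t x * (2 / σ ^ 2 * (∫ y, heatKernel σ t (x' - y) * roughOne W x' y)
        - 2 / σ ^ 2 * ∫ y, heatKernel σ t (x - y) * roughOne W x y) := by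
    rw [hJ, intervalIntegral.integral_sub ((j x').sub (j x)) (((iW x').sub (iW x)).const_mul _),
      intervalIntegral.integral_sub (j x') (j x), intervalIntegral.integral_const_mul,
      intervalIntegral.integral_sub (iW x') (iW x), integral_heatAvg_roughOne hσ ht (jW x'),
      integral_heatAvg_roughOne hσ ht (jW x)]
    rfl
  set h2 := |x' - x| ^ (2 * β) with hh2
  have hh0 : 0 ≤ h2 := by positivity
  have bJ : |J| ≤ C₁ * (P * weightE θ lam a t * a ^ (χ + β / 2) * h2) * Z :=
    abs_integral_le_of_endSing hε hε1 (by positivity) le_rfl ht.le htT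
      fun s hs hst => hb lam N K P W v I hlam h a ha t htT x hx x' hx' s hs hst
  have bw := hw W K h.cont h.path t ht htT a ha x hx x' hx'
  rw [div_sqrt_rpow _ ht] at bw
  set D := (∫ y, heatKernel σ t (x' - y) * roughOne W x' y)
    - (∫ y, heatKernel σ t (x - y) * roughOne W x y) + roughOne W x x' with hD
  have split : flowMap σ I t x' - flowMap σ I t x + 2 / σ ^ 2 * v t x * roughOne W x x'
      = J + 2 / σ ^ 2 * (v t x * D) := by rw [eJ, hD]; ring
  -- The smoothed path has `2β`-increments of size `t^(α/2-β)`; this is the singular part that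
  -- `Q(a,t)` allows.
  have eT : t ^ (α / 2) * t ^ (-(2 * β / 2)) = t ^ ((α - β) / 2) * t ^ (-(β / 2)) := by
    rw [← Real.rpow_add ht, ← Real.rpow_add ht]; ring_nf
  have eT' : t ^ ((α - β) / 2) ≤ 1 + T := rpow_le_one_add ht.le htT (by linarith) (by linarith)
  have bD : |v t x * D| ≤ P * weightE θ lam a t * a ^ χ * h2 * (C₂ * ((1 + T) * t ^ (-(β / 2)))) := by
    rw [abs_mul]
    calc _ ≤ (N * weightE θ lam a t)
          * (C₂ * (K * a ^ χ * t ^ (α / 2) * (h2 * t ^ (-(2 * β / 2))))) :=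
          mul_le_mul (h.sup t ht.le htT a ha x hx) bw (abs_nonneg _) (by positivity)
      _ = (N * K) * weightE θ lam a t * a ^ χ * h2
          * (C₂ * (t ^ ((α - β) / 2) * t ^ (-(β / 2)))) := by rw [← eT]; ring
      _ ≤ P * weightE θ lam a t * a ^ χ * h2 * (C₂ * ((1 + T) * t ^ (-(β / 2)))) := by
          have := h.NK_le
          gcongr
  have ea : a ^ (χ + β / 2) = a ^ χ * a ^ (β / 2) := Real.rpow_add ha0 _ _
  rw [split]
  have p1 : 0 ≤ C₁ * Z * (P * weightE θ lam a t * a ^ χ * h2) * t ^ (-(β / 2)) := by positivity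
  have p2 : 0 ≤ 2 / σ ^ 2 * C₂ * (1 + T) * (P * weightE θ lam a t * a ^ χ * h2) * a ^ (β / 2) := by
    positivity
  have h3 : 0 ≤ 2 / σ ^ 2 := by positivity
  have : |2 / σ ^ 2 * (v t x * D)|
      ≤ 2 / σ ^ 2 * (P * weightE θ lam a t * a ^ χ * h2 * (C₂ * ((1 + T) * t ^ (-(β / 2))))) := by
    rw [abs_mul, abs_of_nonneg h3]
    exact mul_le_mul_of_nonneg_left bD h3
  refine (abs_add_le _ _).trans ((add_le_add bJ this).trans ?_)
  rw [ea]
  linarith [p1, p2]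

end

/-! ### The map `ℳ` on pairs with finite norm -/

theorem WeightedBd.mono {T β θ lam N N' : ℝ} {f : Set.Icc (0 : ℝ) T → ℝ → ℝ}
    (h : WeightedBd β θ lam f N) (hNN : N ≤ N') : WeightedBd β θ lam f N' where
  sup a ha t x hx := (h.sup a ha t x hx).trans
    (mul_le_mul_of_nonneg_right hNN (weightE_pos _ _ _ _).le)
  hol a ha s t hst x hx y hy := by
    have ha0 : 0 ≤ a := by linarith
    have hE := weightE_pos θ lam a t
    refine (h.hol a ha s t hst x hx y hy).trans ?_
    gcongr

theorem WeightedBd.const_mul {T β θ lam N : ℝ} {f : Set.Icc (0 : ℝ) T → ℝ → ℝ}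
    (h : WeightedBd β θ lam f N) (c : ℝ) :
    WeightedBd β θ lam (fun t x => c * f t x) (|c| * N) where
  sup a ha t x hx := by
    rw [abs_mul, mul_assoc]
    exact mul_le_mul_of_nonneg_left (h.sup a ha t x hx) (abs_nonneg c)
  hol a ha s t hst x hx y hy := by
    rw [← mul_sub, abs_mul]
    refine (mul_le_mul_of_nonneg_left (h.hol a ha s t hst x hx y hy) (abs_nonneg c)).trans
      (le_of_eq ?_)
    ring

theorem slice_add {T : ℝ} (f g : Set.Icc (0 : ℝ) T → ℝ → ℝ) (s : ℝ) :
    slice (f + g) s = slice f s + slice g s := by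
  unfold slice
  split_ifs <;> simp

theorem slice_smul {T : ℝ} (c : ℝ) (f : Set.Icc (0 : ℝ) T → ℝ → ℝ) (s : ℝ) :
    slice (c • f) s = c • slice f s := by
  unfold slice
  split_ifs <;> simp

theorem mapM_fst {T : ℝ} (σ : ℝ) (W : ℝ → ℝ) (V : CPair T) (t : Set.Icc (0 : ℝ) T) (x : ℝ) :
    (mapM σ W V).1 t x
      = flowMap σ (fun s => roughIntegral W (slice V.1 s) (slice V.2 s)) t x := by
  simp only [mapM, mapMIntegrand, iteratedDeriv_two_heatKernel, flowMap, heatAvg]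

section
variable {α β χ θ σ T : ℝ} (hβ : 1 / 3 < β) (hβα : β < α) (hα : α < 1 / 2) (hχ0 : 0 < χ)
  (hχβ : χ < β / 2) (hθ : 1 ≤ θ)

include hβ hβα hα hχ0 hχβ hθ

theorem roughIntegrable_slice {lam N K : ℝ} {W : ℝ → ℝ} {V : CPair T} (hlam : 0 < lam)
    (hN0 : 0 ≤ N) (hN : Theta α β χ θ lam W V ≤ ENNReal.ofReal N) (hW : PathBd α χ W K)
    {s : ℝ} (hs : s ∈ Set.Ioc 0 T) : RoughIntegrable W (slice V.1 s) (slice V.2 s) := by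
  intro x y
  have hs' : s ∈ Set.Icc 0 T := ⟨hs.1.le, hs.2⟩
  rw [slice_eq _ hs', slice_eq _ hs']
  obtain ⟨I, hI, -⟩ := exists_roughIntegral_bound hβ hβα hα hχ0.le hχβ (by linarith)
    (by positivity) hW (weightedBd_snd hlam hN0 hN) (weightedRem_of_Theta_le hlam hN0 hN)
    ⟨s, hs'⟩ hs.1 (by simp) (mem_Icc_abs_add_one x) y
  exact ⟨I, hI⟩

/-- The second and third orders carry `λ^γ` because they involve the derivative and the remainder of
the pair; the first order involves `v` alone. -/
theorem roughFlow_of_Theta_le {lam N K : ℝ} {W : ℝ → ℝ} {V : CPair T} (hlam : 0 < lam)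
    (hN0 : 0 ≤ N) (hN : Theta α β χ θ lam W V ≤ ENNReal.ofReal N) (hW : PathBd α χ W K) :
    RoughFlow α β χ θ lam T N K (2 * (sewConst (2 * β + α) + 1) * (N * K)) W (slice V.1)
      (fun s => roughIntegral W (slice V.1 s) (slice V.2 s)) := by
  have hS : 0 < sewConst (2 * β + α) := sewConst_pos (by linarith)
  have hK := hW.nonneg
  have hWc := hW.continuous (by linarith)
  have b1 := weightedBd_fst hN0 hN
  have b2 := weightedBd_snd hlam hN0 hN
  have b3 := weightedRem_of_Theta_le hlam hN0 hN
  have hL : 0 < lam ^ ((α - β) / 4) := Real.rpow_pos_of_pos hlam _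
  have c1 := b1.continuous (by linarith) (by linarith) hlam.le hN0
  have c2 := b2.continuous (by linarith) (by linarith) hlam.le (by positivity)
  have hI : ∀ s ∈ Set.Ioc (0 : ℝ) T, RoughIntegrable W (slice V.1 s) (slice V.2 s) :=
    fun s hs => roughIntegrable_slice hβ hβα hα hχ0 hχβ hθ hlam hN0 hN hW hs
  set P := 2 * (sewConst (2 * β + α) + 1) * (N * K) with hP
  have hP0 : 0 ≤ P := by positivity
  have hNK : N * K ≤ P := by
    have : 0 ≤ N * K := by positivity
    rw [hP]
    nlinarith
  have rem : ∀ s, 0 < s → s ≤ T → ∀ a, 1 ≤ a → ∀ x ∈ Set.Icc (-a) a, ∀ y,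
      |roughIntegral W (slice V.1 s) (slice V.2 s) x y - slice V.1 s x * roughOne W x y|
        ≤ growth α β (growthRate θ T) 0
          (P * weightE θ lam a s * (lam ^ ((α - β) / 4) * a ^ (2 * χ)))
          (P * weightE θ lam a s * (lam ^ ((α - β) / 4) * remCoeff β χ a s)) (y - x) := by
    intro s hs hsT a ha x hx y
    have hs' : s ∈ Set.Icc 0 T := ⟨hs.le, hsT⟩
    obtain ⟨I, hI, hb⟩ := exists_roughIntegral_bound hβ hβα hα hχ0.le hχβ (by linarith)
      (by positivity) hW b2 b3 ⟨s, hs'⟩ hs ha hx y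
    rw [slice_eq _ hs', slice_eq _ hs', hI.eq]
    refine hb.trans (le_of_eq ?_)
    rw [growth, hP, remCoeff]
    ring
  have sup : ∀ s, 0 ≤ s → s ≤ T → ∀ a, 1 ≤ a → ∀ x ∈ Set.Icc (-a) a,
      |slice V.1 s x| ≤ N * weightE θ lam a s := by
    intro s hs hsT a ha x hx
    rw [slice_eq _ ⟨hs, hsT⟩]
    exact b1.sup a ha _ x hx
  have cont : ∀ (f : Set.Icc (0 : ℝ) T → ℝ → ℝ),
      (Continuous fun p : Set.Icc (0 : ℝ) T × ℝ => f p.1 p.2) → ∀ s ∈ Set.Icc 0 T,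
      Continuous (slice f s) := by
    intro f hf s hs
    rw [slice_eq _ hs]
    exact hf.comp (continuous_const.prodMk continuous_id)
  refine ⟨hW, hWc, hN0, hP0, hNK, ?_, ?_, ?_, rem, sup, ?_⟩
  · intro s hs hsT
    have hs' : s ∈ Set.Icc 0 T := ⟨hs.le, hsT⟩
    exact ⟨(hI s ⟨hs, hsT⟩).chain, (hI s ⟨hs, hsT⟩).aestronglyMeasurable hWc
      (cont _ c1 s hs') (cont _ c2 s hs')⟩
  · exact fun t ht0 htT x => aestronglyMeasurable_roughIntegral_slice hWc c1 c2 hI ⟨ht0, htT⟩ x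
  · intro s hs hsT a ha x hx y
    have hE := weightE_pos θ lam a s
    have ha0 : 0 < a := by linarith
    have hc : 1 ≤ growthRate θ T := by
      unfold growthRate
      have : 0 ≤ θ * (1 + T) := mul_nonneg (by linarith) (by linarith)
      linarith
    have g := hW.growth_le (β := β) hχ0.le (by linarith) hc ha hx y
    have h1 : |slice V.1 s x * roughOne W x y| ≤ growth α β (growthRate θ T)
        (P * weightE θ lam a s * a ^ χ) 0 0 (y - x) := by
      rw [abs_mul]
      refine (mul_le_mul (sup s hs.le hsT a ha x hx) g (abs_nonneg _) (by positivity)).trans ?_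
      simp only [growth, zero_mul, add_zero]
      calc _ = (N * K) * weightE θ lam a s * a ^ χ * |y - x| ^ α
            * Real.exp (growthRate θ T * |y - x|) := by ring
        _ ≤ _ := by gcongr
    calc _ = |(roughIntegral W (slice V.1 s) (slice V.2 s) x y - slice V.1 s x * roughOne W x y)
          + slice V.1 s x * roughOne W x y| := by rw [sub_add_cancel]
      _ ≤ _ := (abs_add_le _ _).trans (add_le_add (rem s hs hsT a ha x hx y) h1)
      _ = _ := by simp only [growth]; ring
  · intro s t hs hst htT a ha x hx y hy
    rw [slice_eq _ ⟨hs, hst.trans htT⟩, slice_eq _ ⟨hs.trans hst, htT⟩]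
    exact b1.hol a ha _ _ hst x hx y hy

theorem integrable_mapMIntegrand (hσ : 0 < σ) (hT : 0 < T) {lam N K : ℝ} {W : ℝ → ℝ} {V : CPair T}
    (hlam : 1 ≤ lam)
    (hN0 : 0 ≤ N) (hN : Theta α β χ θ lam W V ≤ ENNReal.ofReal N) (hW : PathBd α χ W K)
    {t : ℝ} (ht : t ∈ Set.Icc 0 T) (x : ℝ) :
    Integrable (fun q : ℝ × ℝ => mapMIntegrand σ W V t x q.1 q.2)
      ((volume.restrict (Set.Ioc 0 t)).prod volume) := by
  simp only [mapMIntegrand, iteratedDeriv_two_heatKernel]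
  exact (roughFlow_of_Theta_le hβ hβα hα hχ0 hχβ hθ (by linarith) hN0 hN hW).integrable
    hβ hβα hα hχ0 hχβ hθ hσ hT hlam ht.1 ht.2 x

/-- The flow itself is smaller by `λ^(-γ)`. The new derivative and remainder have no such gain, but
`Θ` multiplies them by `λ^(-γ)`. The derivative does not see the path, hence `1 + K` instead of `K`.
-/
theorem Theta_mapM_le (hσ : 0 < σ) (hT : 0 < T) : ∃ C, 0 < C ∧ ∀ (lam N K : ℝ) (W : ℝ → ℝ)
    (V : CPair T), 1 ≤ lam → 0 ≤ N → Theta α β χ θ lam W V ≤ ENNReal.ofReal N →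
    PathBd α χ W K → Theta α β χ θ lam W (mapM σ W V)
      ≤ ENNReal.ofReal (C * (1 + K) * lam ^ (-((α - β) / 4)) * N) := by
  obtain ⟨C₁, hC₁, hb₁⟩ := flowMap_bounds hβ hβα hα hχ0 hχβ hθ hσ hT
  obtain ⟨C₂, hC₂, hb₂⟩ := flowMap_rem_le hβ hβα hα hχ0 hχβ hθ hσ hT
  have hS : 0 < sewConst (2 * β + α) := sewConst_pos (by linarith)
  set S := 2 * (sewConst (2 * β + α) + 1) with hSdef
  have hS0 : 0 < S := by positivity
  refine ⟨5 * (C₁ * S + C₂ * S + 2 / σ ^ 2), by positivity, ?_⟩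
  intro lam N K W V hlam hN0 hN hW
  have hl0 : 0 < lam := by linarith
  have hK := hW.nonneg
  have hR := roughFlow_of_Theta_le hβ hβα hα hχ0 hχβ hθ hl0 hN0 hN hW
  have B₁ := hb₁ lam _ _ _ W _ _ hlam hR
  have B₂ := hb₂ lam _ _ _ W _ _ hlam hR
  set L := lam ^ ((α - β) / 4) with hL
  have hL0 : 0 < L := Real.rpow_pos_of_pos hl0 _
  have hLi : lam ^ (-((α - β) / 4)) = L⁻¹ := Real.rpow_neg hl0.le _
  rw [hLi] at B₁ ⊢
  set N₁ := (C₁ * S + C₂ * S + 2 / σ ^ 2) * (1 + K) * L⁻¹ * N with hN₁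
  have hN₁0 : 0 ≤ N₁ := by positivity
  have hNL : N₁ * L = (C₁ * S + C₂ * S + 2 / σ ^ 2) * (1 + K) * N := by
    rw [hN₁]; field_simp
  have e5 : 5 * (C₁ * S + C₂ * S + 2 / σ ^ 2) * (1 + K) * L⁻¹ * N = 5 * N₁ := by rw [hN₁]; ring
  rw [e5]
  have k1 : C₁ * (S * (N * K)) * L⁻¹ ≤ N₁ := by
    have : 0 ≤ L⁻¹ * N * (C₁ * S + (C₂ * S + 2 / σ ^ 2) * (1 + K)) := by positivity
    rw [hN₁]
    linarith
  have k2 : |-(2 / σ ^ 2)| * N ≤ N₁ * L := by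
    have h0 : 0 ≤ 2 / σ ^ 2 := by positivity
    have : 0 ≤ N * ((C₁ * S + C₂ * S) * (1 + K) + 2 / σ ^ 2 * K) := by positivity
    rw [hNL, abs_neg, abs_of_nonneg h0]
    linarith
  have k3 : C₂ * (S * (N * K)) ≤ N₁ * L := by
    have : 0 ≤ N * (C₂ * S + (C₁ * S + 2 / σ ^ 2) * (1 + K)) := by positivity
    rw [hNL]
    linarith
  refine Theta_le_of_bounds (by linarith) hl0 hN₁0 ?_ ?_ ?_
  · refine WeightedBd.mono (N := C₁ * (S * (N * K)) * L⁻¹) ⟨?_, ?_⟩ k1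
    · intro a ha t x hx
      rw [mapM_fst]
      refine ((B₁ a ha t t.2.1 t.2.2 x hx).1).trans (le_of_eq ?_)
      ring
    · intro a ha s t hst x hx y hy
      rw [mapM_fst, mapM_fst]
      have b := B₁ a ha t t.2.1 t.2.2 x hx
      refine (abs_sub_le _ _ _).trans ((add_le_add (b.2.1 y hy) (b.2.2 s s.2.1 hst)).trans
        (le_of_eq ?_))
      ring
  · exact ((weightedBd_fst hN0 hN).const_mul _).mono k2
  · intro a ha t ht x hx y hy
    have b := B₂ a ha t ht t.2.2 x hx y hy
    have e : remainder W (mapM σ W V) t x y = flowMap σ (fun s => roughIntegral W (slice V.1 s)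
        (slice V.2 s)) t y - flowMap σ (fun s => roughIntegral W (slice V.1 s) (slice V.2 s)) t x
        + 2 / σ ^ 2 * slice V.1 t x * roughOne W x y := by
      rw [remainder, mapM_fst, mapM_fst, slice_eq _ t.2]
      simp only [mapM, roughOne]
      ring
    rw [e]
    have ha0 : 0 < a := by linarith
    have hE := weightE_pos θ lam a t
    calc _ ≤ _ := b
      _ = C₂ * (S * (N * K)) * weightE θ lam a t
          * (a ^ χ * (a ^ (β / 2) + (t : ℝ) ^ (-(β / 2)))) * |y - x| ^ (2 * β) := by ring
      _ ≤ _ := by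
          have := t.2.1
          gcongr

/-- Rough integrals and Bochner integrals have default values where they do not exist, so linearity
is available only on pairs of finite norm. There the iterated integral is an integral over the
product, and the integrands add almost everywhere. -/
theorem mapM_linear (hσ : 0 < σ) (hT : 0 < T) {lam K : ℝ} {W : ℝ → ℝ} (hlam : 1 ≤ lam)
    (hW : PathBd α χ W K) : ∀ V ∈ spaceB T α β χ θ lam W,
      (∀ V' ∈ spaceB T α β χ θ lam W, mapM σ W (V + V') = mapM σ W V + mapM σ W V') ∧
      ∀ c : ℝ, mapM σ W (c • V) = c • mapM σ W V := by
  have hl0 : 0 < lam := by linarith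
  have hI : ∀ V ∈ spaceB T α β χ θ lam W, ∀ s ∈ Set.Ioc 0 T,
      RoughIntegrable W (slice V.1 s) (slice V.2 s) := fun V hV s hs =>
    roughIntegrable_slice hβ hβα hα hχ0 hχβ hθ hl0 ENNReal.toReal_nonneg
      (ENNReal.ofReal_toReal (ne_of_lt hV)).ge hW hs
  have hint : ∀ V ∈ spaceB T α β χ θ lam W, ∀ t : Set.Icc (0 : ℝ) T, ∀ x : ℝ,
      Integrable (fun q : ℝ × ℝ => mapMIntegrand σ W V t x q.1 q.2)
        ((volume.restrict (Set.Ioc 0 (t : ℝ))).prod volume) := fun V hV t x =>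
    integrable_mapMIntegrand hβ hβα hα hχ0 hχβ hθ hσ hT hlam ENNReal.toReal_nonneg
      (ENNReal.ofReal_toReal (ne_of_lt hV)).ge hW t.2 x
  have hfst : ∀ V ∈ spaceB T α β χ θ lam W, ∀ t : Set.Icc (0 : ℝ) T, ∀ x : ℝ,
      (mapM σ W V).1 t x = ∫ q : ℝ × ℝ, mapMIntegrand σ W V t x q.1 q.2
        ∂((volume.restrict (Set.Ioc 0 (t : ℝ))).prod volume) := by
    intro V hV t x
    rw [integral_prod _ (hint V hV t x)]
    exact intervalIntegral.integral_of_le t.2.1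
  have hae : ∀ t : Set.Icc (0 : ℝ) T,
      ∀ᵐ q ∂((volume.restrict (Set.Ioc 0 (t : ℝ))).prod (volume : Measure ℝ)),
        q.1 ∈ Set.Ioc 0 T := by
    intro t
    rw [prod_restrict_Ioc]
    filter_upwards [ae_restrict_mem (measurableSet_Ioc.prod MeasurableSet.univ)] with q hq
    exact ⟨hq.1.1, hq.1.2.trans t.2.2⟩
  intro V hV
  refine ⟨fun V' hV' => Prod.ext ?_ ?_, fun c => Prod.ext ?_ ?_⟩
  · funext t x
    have hsum := (spaceB T α β χ θ lam W).add_mem hV hV'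
    rw [Prod.fst_add, Pi.add_apply, Pi.add_apply, hfst _ hsum, hfst V hV, hfst V' hV',
      ← integral_add (hint V hV t x) (hint V' hV' t x)]
    refine integral_congr_ae ?_
    filter_upwards [hae t] with q hq
    have h'' := hI _ hsum q.1 hq
    rw [Prod.fst_add, Prod.snd_add, slice_add, slice_add] at h''
    simp only [mapMIntegrand]
    rw [Prod.fst_add, Prod.snd_add, slice_add, slice_add,
      (hI V hV q.1 hq).integral_add (hI V' hV' q.1 hq) h'', mul_add]
  · funext t x
    simp only [mapM, Prod.fst_add, Prod.snd_add, Pi.add_apply]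
    ring
  · funext t x
    have hs := (spaceB T α β χ θ lam W).smul_mem c hV
    rw [Prod.smul_fst, Pi.smul_apply, Pi.smul_apply, hfst _ hs, hfst V hV, smul_eq_mul,
      ← integral_const_mul]
    refine integral_congr_ae ?_
    filter_upwards [hae t] with q hq
    have h'' := hI _ hs q.1 hq
    rw [Prod.smul_fst, Prod.smul_snd, slice_smul, slice_smul] at h''
    simp only [mapMIntegrand]
    rw [Prod.smul_fst, Prod.smul_snd, slice_smul, slice_smul,
      (hI V hV q.1 hq).integral_smul c h'', mul_left_comm]
  · funext t x
    simp only [mapM, Prod.smul_fst, Prod.smul_snd, Pi.smul_apply, smul_eq_mul]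
    ring

end

end

/-! ### The Banach space and the contraction -/

theorem mainTheorem5 (α β χ θ σ T : ℝ)
    (hβ : 1 / 3 < β) (hβα : β < α) (hα : α < 1 / 2)
    (hχ : 1 / 2 - α < χ) (hχβ : χ < β / 2)
    (hθ : 1 < θ) (hσ : 0 < σ) (hT : 0 < T) :
    ∃ C : ℝ, 0 < C ∧ ∃ Λ : ℝ → ℝ, ∀ W : ℝ → ℝ, kappa α χ W < ∞ → ∀ lam : ℝ, 1 < lam →
      -- the space with this norm is a Banach space (finiteness, the triangle inequality and
      -- homogeneity are part of its construction as a submodule)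
      (∀ V ∈ spaceB T α β χ θ lam W, Theta α β χ θ lam W V = 0 → V = 0) ∧
      (∀ u : ℕ → spaceB T α β χ θ lam W,
        (∀ ε : ℝ≥0∞, 0 < ε → ∃ N, ∀ m ≥ N, ∀ n ≥ N,
          Theta α β χ θ lam W ((u m : CPair T) - (u n : CPair T)) ≤ ε) →
        ∃ V : spaceB T α β χ θ lam W, Filter.Tendsto
          (fun n => Theta α β χ θ lam W ((u n : CPair T) - (V : CPair T)))
          Filter.atTop (nhds 0)) ∧
      -- the integrals that define the map exist
      (∀ V ∈ spaceB T α β χ θ lam W,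
        (∀ s ∈ Set.Ioc (0 : ℝ) T, ∀ x y : ℝ,
          ∃ I, HasRoughIntegral W (slice V.1 s) (slice V.2 s) x y I) ∧
        (∀ t ∈ Set.Icc (0 : ℝ) T, ∀ x : ℝ,
          Integrable (fun q : ℝ × ℝ => mapMIntegrand σ W V t x q.1 q.2)
            ((volume.restrict (Set.Ioc 0 t)).prod volume))) ∧
      -- the map is a linear map of the space to itself
      ∃ M : spaceB T α β χ θ lam W →ₗ[ℝ] spaceB T α β χ θ lam W,
        (∀ V : spaceB T α β χ θ lam W, (M V : CPair T) = mapM σ W (V : CPair T)) ∧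
        -- the norm estimate
        (∀ V : spaceB T α β χ θ lam W,
          Theta α β χ θ lam W (M V : CPair T) ≤
            ENNReal.ofReal (C * (1 + (kappa α χ W).toReal) * lam ^ (-((α - β) / 4)))
              * Theta α β χ θ lam W (V : CPair T)) ∧
        -- the contraction property for large values of the parameter
        (Λ (kappa α χ W).toReal ≤ lam →
          (∀ V : spaceB T α β χ θ lam W,
            Theta α β χ θ lam W (M V : CPair T) ≤ 2⁻¹ * Theta α β χ θ lam W (V : CPair T)) ∧
          (∀ V V' : spaceB T α β χ θ lam W,
            Theta α β χ θ lam W ((M V : CPair T) - (M V' : CPair T)) ≤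
              2⁻¹ * Theta α β χ θ lam W ((V : CPair T) - (V' : CPair T)))) := by
  have hχ0 : 0 < χ := by linarith
  have hθ' : 1 ≤ θ := hθ.le
  obtain ⟨C, hC, hb⟩ := Theta_mapM_le (σ := σ) (T := T) hβ hβα hα hχ0 hχβ hθ' hσ hT
  -- The threshold solves `C (1 + K) λ^(-(α-β)/4) = 1/2` for `λ`.
  refine ⟨C, hC, fun K => (2 * C * (1 + K)) ^ (4 / (α - β)), ?_⟩
  intro W hκ lam hlam
  have hl0 : 0 < lam := by linarith
  have hW := pathBd_of_kappa hκ
  have hK := hW.nonneg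
  have hN : ∀ V ∈ spaceB T α β χ θ lam W, Theta α β χ θ lam W V
      ≤ ENNReal.ofReal (Theta α β χ θ lam W V).toReal := fun V hV =>
    (ENNReal.ofReal_toReal (ne_of_lt hV)).ge
  have hb' : ∀ V ∈ spaceB T α β χ θ lam W, Theta α β χ θ lam W (mapM σ W V) ≤
      ENNReal.ofReal (C * (1 + (kappa α χ W).toReal) * lam ^ (-((α - β) / 4)))
        * Theta α β χ θ lam W V := by
    intro V hV
    refine (hb lam _ _ W V hlam.le ENNReal.toReal_nonneg (hN V hV) hW).trans (le_of_eq ?_)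
    rw [ENNReal.ofReal_mul (by positivity), ENNReal.ofReal_toReal (ne_of_lt hV)]
  have hlin := mapM_linear (σ := σ) (T := T) hβ hβα hα hχ0 hχβ hθ' hσ hT hlam.le hW
  obtain ⟨M, hM⟩ : ∃ M : spaceB T α β χ θ lam W →ₗ[ℝ] spaceB T α β χ θ lam W,
      ∀ V : spaceB T α β χ θ lam W, (M V : CPair T) = mapM σ W (V : CPair T) := by
    have hmem : ∀ V : spaceB T α β χ θ lam W, mapM σ W V ∈ spaceB T α β χ θ lam W := fun V =>
      lt_of_le_of_lt (hb' V V.2) (ENNReal.mul_lt_top ENNReal.ofReal_lt_top V.2)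
    exact ⟨IsLinearMap.mk' (fun V => ⟨mapM σ W V, hmem V⟩)
      ⟨fun V V' => Subtype.ext ((hlin V V.2).1 V' V'.2),
        fun c V => Subtype.ext ((hlin V V.2).2 c)⟩, fun V => rfl⟩
  refine ⟨fun V _ h => eq_zero_of_Theta_eq_zero hl0 h, exists_limit_of_Theta_cauchy hl0,
    fun V hV => ⟨fun s hs => roughIntegrable_slice hβ hβα hα hχ0 hχβ hθ' hl0
        ENNReal.toReal_nonneg (hN V hV) hW hs,
      fun t ht x => integrable_mapMIntegrand hβ hβα hα hχ0 hχβ hθ' hσ hT hlam.le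
        ENNReal.toReal_nonneg (hN V hV) hW ht x⟩,
    M, hM, fun V => ?_, fun hΛ => ?_⟩
  · rw [hM]
    exact hb' V V.2
  have hhalf : C * (1 + (kappa α χ W).toReal) * lam ^ (-((α - β) / 4)) ≤ 1 / 2 := by
    have h0 : 0 < 2 * C * (1 + (kappa α χ W).toReal) := by positivity
    have h1 := Real.rpow_le_rpow (by positivity) hΛ (show 0 ≤ (α - β) / 4 by linarith)
    rw [← Real.rpow_mul h0.le,
      show 4 / (α - β) * ((α - β) / 4) = 1 by field_simp [show α - β ≠ 0 by linarith],
      Real.rpow_one] at h1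
    have hL : 0 < lam ^ ((α - β) / 4) := Real.rpow_pos_of_pos hl0 _
    rw [Real.rpow_neg hl0.le, ← div_eq_mul_inv, div_le_iff₀ hL]
    linarith
  have hhalf' : ENNReal.ofReal (C * (1 + (kappa α χ W).toReal) * lam ^ (-((α - β) / 4)))
      ≤ 2⁻¹ := by
    refine (ENNReal.ofReal_le_ofReal hhalf).trans (le_of_eq ?_)
    rw [one_div, ENNReal.ofReal_inv_of_pos two_pos, ENNReal.ofReal_ofNat]
  have hcontr : ∀ V ∈ spaceB T α β χ θ lam W,
      Theta α β χ θ lam W (mapM σ W V) ≤ 2⁻¹ * Theta α β χ θ lam W V := fun V hV =>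
    (hb' V hV).trans (mul_le_mul_left hhalf' _)
  refine ⟨fun V => hM V ▸ hcontr V V.2, fun V V' => ?_⟩
  have e : mapM σ W (V : CPair T) - mapM σ W (V' : CPair T)
      = mapM σ W ((V : CPair T) - (V' : CPair T)) := by
    have h1 := (hlin V V.2).1 ((-1 : ℝ) • (V' : CPair T)) (Submodule.smul_mem _ _ V'.2)
    rw [(hlin V' V'.2).2, neg_one_smul, neg_one_smul, ← sub_eq_add_neg, ← sub_eq_add_neg] at h1
    exact h1.symm
  rw [hM, hM, e]
  exact hcontr _ (Submodule.sub_mem _ V.2 V'.2)
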